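/- Let $S$ be a compact connected oriented surface with (possibly empty) boundary, given with a finite oriented triangulation (that is, glued from finitely many oriented triangles by identifying pairs of sides by orientation-reversing maps; every such surface arises so). Its genus $g$ is determined by $\chi(S) = 2 - 2g - k$, where $k$ is the number of boundary components $C_1, \dots, C_k$ (listed in any order) and $\chi(S)$ is the Euler characteristic; $S$ is called planar if $g = 0$. Let $\pi : \widetilde C \to \partial S$ be a covering map all of whose fibres have exactly $n$ points, and for each $i$ let $\Gamma_i$ be the conjugacy class in the symmetric group $S_n$ of the monodromy permutation of a generator of $\pi_1(C_i)$ acting on a fibre of $\pi$ over a point of $C_i$, after numbering the points of the fibre. Then $\pi$ extends to a covering of $S$, i.e. there are an $n$-sheeted covering map $\Pi : \widetilde S \to S$ (not required to be connected) and a homeomorphism $h : \widetilde C \to \Pi^{-1}(\partial S)$ with $\Pi \circ h = \pi$, if and only if one of the following holds: 1. $S$ is planar, and there are $\sigma_i \in \Gamma_i$ ($i = 1, \dots, k$) with $\sigma_1 \sigma_2 \cdots \sigma_k = e$, the identity of $S_n$; 2. $S$ is not planar, and the sum in $\mathbb{Z}/2$ of the parities of $\Gamma_1, \dots, \Gamma_k$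 is zero. -/

import Mathlib

/-- A finite collection of oriented triangles, some of whose sides are glued in pairs.
The vertices of a triangle `f` are numbered `0, 1, 2`, in the cyclic order given by its orientation,
and the pair `(f, i)` stands for the side of `f` that runs from vertex `i` to vertex `i + 1`.
The sides `d` with `glue d = d` stay free; any other side `d` is glued to the side `glue d`. -/
structure TriangleGluing where
  Face : Type
  finite_face : Finite Face
  glue : Face × Fin 3 → Face × Fin 3
  glue_glue : ∀ d, glue (glue d) = d

/-- The point at parameter `t` of the side of the standard triangle
that runs from vertex `i` to vertex `i + 1`. -/
noncomputable def sidePoint (i : Fin 3) (t : unitInterval) : stdSimplex ℝ (Fin 3) :=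
  ⟨(1 - (t : ℝ)) • Pi.single i 1 + (t : ℝ) • Pi.single (i + 1) 1,
    convex_stdSimplex ℝ (Fin 3) (single_mem_stdSimplex ℝ i) (single_mem_stdSimplex ℝ (i + 1))
      (sub_nonneg.2 t.2.2) t.2.1 (sub_add_cancel 1 (t : ℝ))⟩

namespace TriangleGluing

/-- The disjoint union of the triangles, before gluing. -/
abbrev Pieces (G : TriangleGluing) : Type := Σ _ : G.Face, stdSimplex ℝ (Fin 3)

/-- The point at parameter `t` of the side `d`. -/
noncomputable def side (G : TriangleGluing) (d : G.Face × Fin 3) (t : unitInterval) : G.Pieces :=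
  ⟨d.1, sidePoint d.2 t⟩

/-- A side `d` that is not free is identified with `glue d` by the affine map that reverses the
direction, so that the orientations of the triangles match along the common side. -/
inductive Glued (G : TriangleGluing) : G.Pieces → G.Pieces → Prop
  | mk (d : G.Face × Fin 3) (t : unitInterval) (h : G.glue d ≠ d) :
      Glued G (G.side d t) (G.side (G.glue d) (unitInterval.symm t))

/-- The space obtained by gluing the triangles, with the quotient topology. -/
def Realization (G : TriangleGluing) : Type := Quot G.Glued

instance (G : TriangleGluing) : TopologicalSpace G.Realization :=
  inferInstanceAs (TopologicalSpace (Quot G.Glued))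

/-- The boundary of the glued space: the union of the free sides. -/
def boundary (G : TriangleGluing) : Set G.Realization :=
  {x | ∃ d t, G.glue d = d ∧ x = Quot.mk G.Glued (G.side d t)}

/-- The identification of the corners of the triangles that the gluing generates; `(f, i)` is here
the vertex `i` of `f`. Gluing the side `(f, i)` to `(f', j)` identifies the initial vertex `i` of
the first with the end vertex `j + 1` of the second (and, since `(f', j)` is also glued to
`(f, i)`, the initial vertex `j` of the second with the end vertex `i + 1` of the first). -/
inductive CornerGlued (G : TriangleGluing) : G.Face × Fin 3 → G.Face × Fin 3 → Prop
  | mk (d : G.Face × Fin 3) (h : G.glue d ≠ d) :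
      CornerGlued G d ((G.glue d).1, (G.glue d).2 + 1)

/-- Number of vertices after gluing. -/
noncomputable def numVertices (G : TriangleGluing) : ℕ := Nat.card (Quot G.CornerGlued)

/-- Number of edges after gluing. -/
noncomputable def numEdges (G : TriangleGluing) : ℕ := Nat.card (Quot fun d d' => d' = G.glue d)

/-- The Euler characteristic `V - E + F`. -/
noncomputable def eulerChar (G : TriangleGluing) : ℤ :=
  (G.numVertices : ℤ) - G.numEdges + Nat.card G.Face

end TriangleGluing

/-- An oriented (finite) triangulation of a space `S`: a homeomorphism to `S` from a space glued
from finitely many oriented triangles. The spaces that have one are the compact oriented surfaces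
with (possibly empty) boundary. -/
structure OrientedTriangulation (S : Type*) [TopologicalSpace S] where
  gluing : TriangleGluing
  homeo : gluing.Realization ≃ₜ S

namespace OrientedTriangulation

variable {S : Type*} [TopologicalSpace S]

/-- The boundary `∂S`. -/
def boundary (T : OrientedTriangulation S) : Set S := T.homeo '' T.gluing.boundary

/-- The genus `g` of a connected surface, determined by `χ = 2 - 2 g - k`, where `χ` is the Euler
characteristic and `k` is the number of boundary components. -/
noncomputable def genus (T : OrientedTriangulation S) : ℤ :=
  (2 - Nat.card (ConnectedComponents T.boundary) - T.gluing.eulerChar) / 2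

/-- A surface is planar if its genus is zero. -/
def IsPlanar (T : OrientedTriangulation S) : Prop := T.genus = 0

end OrientedTriangulation

/-- `Γ` is the conjugacy class in `S_n` that describes the `n`-sheeted covering `p` over the
component `c` of its base `B`: the class of the monodromy of a generator of the fundamental group
of `c` on a fibre over a point of `c`, after some numbering of the points of the fibre. -/
def IsMonodromyClass {B C : Type*} [TopologicalSpace B] [TopologicalSpace C] {p : C → B}
    (hp : IsCoveringMap p) {n : ℕ} (c : ConnectedComponents B)
    (Γ : ConjClasses (Equiv.Perm (Fin n))) : Prop :=
  ∃ (x : B) (γ : FundamentalGroup B x) (e : p ⁻¹' {x} ≃ Fin n),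
    (x : ConnectedComponents B) = c ∧ Subgroup.zpowers γ = ⊤ ∧
      Γ = ConjClasses.mk (e.permCongr (hp.monodromyPerm x γ))

/-- The parity of a conjugacy class in `S_n`: `0` if its elements are even, `1` if they are odd. -/
def parity {n : ℕ} : ConjClasses (Equiv.Perm (Fin n)) → ZMod 2 :=
  Quotient.lift (fun σ => if Equiv.Perm.sign σ = 1 then 0 else 1) fun σ τ h => by
    have h' : Equiv.Perm.sign σ = Equiv.Perm.sign τ :=
      isConj_iff_eq.1 (MonoidHom.map_isConj Equiv.Perm.sign h)
    simp only [h']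

universe u v

/-- The `n`-sheeted covering `p : C → A` of a subspace `A` of `S` extends to `S`: there is an
`n`-sheeted covering `P : S' → S` whose restriction `P ⁻¹' A → A` is isomorphic to `p` over `A`. -/
def ExtendsToCovering {S : Type u} [TopologicalSpace S] {C : Type v} [TopologicalSpace C]
    (n : ℕ) (A : Set S) (p : C → A) : Prop :=
  ∃ (S' : Type u) (_ : TopologicalSpace S') (P : S' → S),
    IsCoveringMap P ∧ (∀ x, (P ⁻¹' {x}).encard = n) ∧
      ∃ h : C ≃ₜ (P ⁻¹' A), ∀ y, P (h y) = p y

/-! Cut `S` into its triangles. A covering with `n` sheets is trivial over each triangle, so it is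
described by a permutation `g d` for every side `d`, which records how the numbering of the sheets
changes across `d`; here `g (glue d)` is inverse to `g d`, and `g d = 1` on free sides. Let `α` be
the gluing, `φ` the rotation of the sides of each triangle, and `ρ = φ * α`. A cycle of `ρ` without
free sides turns around an interior vertex; a cycle with free sides runs along one boundary
component. Such a `g` comes from a covering exactly when its holonomy `hol` around the interior
vertices is trivial, and the covering over the boundary is then determined up to isomorphism by the
conjugacy classes of the other holonomies. Thus `extendsToCovering_iff` turns the extension problem
into `Realizable`: find `g` with a prescribed holonomy class on each cycle of `ρ`. The trivial
classes at interior vertices change neither products nor signs, and `genus_eq` computes the genus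
from the numbers of cycles.

`realizable_iff` solves the combinatorial problem for a connected map whose vertices are the cycles
of `φ` and whose faces are the cycles of `ρ`, by induction on the number of points moved by `α`. An
edge between different vertices is contracted after a gauge transformation that makes `g` trivial on
it (`realizable_contract`). An edge between different faces is deleted; the faces merge and suitable
representatives of their classes are multiplied (`Realizable.exists_isMerged`,
`IsMerged.realizable`). Both moves preserve the genus and the criterion. What remains has one vertex
and one face. Without edges it has genus zero and trivial holonomy. Otherwise there are two
interlaced edges (`exists_interlaced`), so the genus is positive. Each side then occurs once in the
holonomy, which is therefore even; conversely the two interlaced edges alone produce any commutator,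
and every even permutation is one (`exists_commutator_eq`), because it is a product of two full
cycles.

On the boundary circles no fundamental group is computed. The orbits of the monodromy of a generator
are the traces on the fibre of the path components of the total space. The holonomy has the same
orbits, and permutations of a finite set with the same orbits are conjugate
(`isConj_of_sameCycle_iff`). -/

section

open Equiv Equiv.Perm Function

/-! ### Even permutations as products of two full cycles and as commutators. -/

namespace Equiv.Perm

variable {X : Type*}

/-- The step `z ↦ y` of the cycle is replaced by `z ↦ a ↦ y`, so the new point is spliced in just
before `y`. -/
theorem IsCycleOn.swap_mul [DecidableEq X] {u : Perm X} {Y : Set X} (hu : u.IsCycleOn Y)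
    {a y : X} (ha : a ∉ Y) (hy : y ∈ Y) (hua : u a = a) :
    (swap a y * u).IsCycleOn (insert a Y) := by
  set w := swap a y * u with hw
  have hay : a ≠ y := fun h => ha (h ▸ hy)
  have hne : ∀ x ∈ Y, u x ≠ a := fun x hx h => ha (h ▸ hu.1.mapsTo hx)
  have hwa : w a = y := by simp [hw, hua]
  have hwu : ∀ x ∈ Y, u x = y → w x = a := fun x hx h => by simp [hw, h]
  have hwo : ∀ x ∈ Y, u x ≠ y → w x = u x := fun x hx h => by
    simp [hw, swap_apply_of_ne_of_ne (hne x hx) h]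
  have hstep : ∀ x ∈ Y, w.SameCycle x (u x) := by
    intro x hx
    by_cases h : u x = y
    · refine ⟨2, ?_⟩
      rw [zpow_ofNat, sq, mul_apply, hwu x hx h, hwa, h]
    · exact ⟨1, by rw [zpow_one, hwo x hx h]⟩
  have hpow : ∀ (n : ℕ), ∀ x ∈ Y, w.SameCycle x ((u ^ n) x) := by
    intro n
    induction n with
    | zero => intro x _; exact SameCycle.refl _ _
    | succ n ih =>
      intro x hx
      rw [pow_succ, mul_apply]
      exact (hstep x hx).trans (ih _ (hu.1.mapsTo hx))
  have hY : ∀ x ∈ Y, ∀ x' ∈ Y, w.SameCycle x x' := by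
    intro x hx x' hx'
    obtain ⟨i, rfl⟩ := hu.2 hx hx'
    obtain ⟨m, rfl | rfl⟩ := i.eq_nat_or_neg
    · exact_mod_cast hpow m x hx
    · have := hpow m _ hx'
      rw [← zpow_natCast, ← mul_apply, ← zpow_add] at this
      simpa using this.symm
  have hay' : w.SameCycle a y := ⟨1, by rw [zpow_one, hwa]⟩
  refine ⟨⟨?_, w.injective.injOn, ?_⟩, ?_⟩
  · rintro x (rfl | hx)
    · exact Or.inr (hwa ▸ hy)
    · by_cases h : u x = y
      · exact Or.inl (hwu x hx h)
      · exact Or.inr (by rw [hwo x hx h]; exact hu.1.mapsTo hx)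
  · rintro x (rfl | hx)
    · obtain ⟨z, hz, rfl⟩ := hu.1.surjOn hy
      exact ⟨z, Or.inr hz, hwu z hz rfl⟩
    · by_cases h : x = y
      · exact ⟨a, Or.inl rfl, h ▸ hwa⟩
      · obtain ⟨z, hz, rfl⟩ := hu.1.surjOn hx
        exact ⟨z, Or.inr hz, hwo z hz h⟩
  · rintro x (rfl | hx) z (rfl | hz)
    · exact SameCycle.refl _ _
    · exact hay'.trans (hY _ hy _ hz)
    · exact ((hay'.trans (hY _ hy _ hx))).symm
    · exact hY _ hx _ hz

/-- Two new points can be inserted into a cycle. -/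
theorem IsCycleOn.swap_mul_swap_mul [DecidableEq X] {u : Perm X} {Y : Set X}
    (hu : u.IsCycleOn Y) (hY : ∀ x ∉ Y, u x = x) {a c y : X} (ha : a ∉ Y) (hc : c ∉ Y)
    (hac : a ≠ c) (hy : y ∈ Y) :
    (swap a c * (swap c y * u)).IsCycleOn (insert a (insert c Y)) ∧
      ∀ x ∉ insert a (insert c Y), (swap a c * (swap c y * u)) x = x := by
  have h1 := hu.swap_mul hc hy (hY c hc)
  have hay : a ≠ y := fun h => ha (h ▸ hy)
  refine ⟨h1.swap_mul (by simp [hac, ha]) (by simp) ?_, ?_⟩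
  · rw [mul_apply, hY a ha, swap_apply_of_ne_of_ne hac hay]
  · intro x hx
    simp only [Set.mem_insert_iff, not_or] at hx
    rw [mul_apply, mul_apply, hY x hx.2.2,
      swap_apply_of_ne_of_ne hx.2.1 (fun h => hx.2.2 (h ▸ hy)),
      swap_apply_of_ne_of_ne hx.1 hx.2.1]

theorem apply_eq_of_isCycleOn_insert {u : Perm X} {Y : Set X} (hY : ∀ x ∉ Y, u x = x) {x : X}
    (hx : x ∉ Y) : u⁻¹ x = x := by
  rw [inv_eq_iff_eq, hY x hx]

/-- If `σ` is the product of two permutations that each permute `Y` cyclically, then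
so is its product with `(a c y) (a c y')`, on a set with two more points. -/
theorem isCycleOn_mul_of_insert [DecidableEq X] {u v : Perm X} {Y : Set X}
    (hu : u.IsCycleOn Y) (hv : v.IsCycleOn Y) (hYu : ∀ x ∉ Y, u x = x) (hYv : ∀ x ∉ Y, v x = x)
    {a c y y' : X} (ha : a ∉ Y) (hc : c ∉ Y) (hac : a ≠ c) (hy : y ∈ Y) (hy' : y' ∈ Y) :
    ∃ u' v' : Perm X, u'.IsCycleOn (insert a (insert c Y)) ∧
      v'.IsCycleOn (insert a (insert c Y)) ∧ (∀ x ∉ insert a (insert c Y), u' x = x) ∧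
      (∀ x ∉ insert a (insert c Y), v' x = x) ∧
      u' * v' = swap a c * swap c y * (swap a c * swap c y') * (u * v) := by
  -- The second factor is extended at `u⁻¹ y'` rather than at `y'`, because its transpositions must
  -- still be moved to the left past `u`, which conjugates them and fixes `a` and `c`.
  have hz : u⁻¹ y' ∈ Y := by
    obtain ⟨z, hz, rfl⟩ := hu.1.surjOn hy'
    simpa using hz
  obtain ⟨h1, h2⟩ := hu.swap_mul_swap_mul hYu ha hc hac hy
  obtain ⟨h3, h4⟩ := hv.swap_mul_swap_mul hYv ha hc hac hz
  refine ⟨_, _, h1, h3, h2, h4, ?_⟩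
  have e1 : swap a c = u⁻¹ * swap a c * u := by
    have := Equiv.swap_apply_apply u⁻¹ a c
    rw [inv_inv, apply_eq_of_isCycleOn_insert hYu ha, apply_eq_of_isCycleOn_insert hYu hc] at this
    exact this
  have e2 : swap c (u⁻¹ y') = u⁻¹ * swap c y' * u := by
    have := Equiv.swap_apply_apply u⁻¹ c y'
    rw [inv_inv, apply_eq_of_isCycleOn_insert hYu hc] at this
    exact this
  rw [e2]
  nth_rewrite 2 [e1]
  simp only [mul_assoc, mul_inv_cancel_left]

/-- Induction on the set: an even factor `(a c)(c y)(a c)(c y')` that agrees with `σ` at `a` and `c`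
is split off. The rest is even and lives on two points fewer, and `isCycleOn_mul_of_insert` inserts
`a` and `c` into both of its cycles. The identity is the base case, as a cycle times its inverse. -/
theorem exists_isCycleOn_mul_eq [DecidableEq X] [Fintype X] (Y : Finset X) :
    Y.Nonempty → ∀ σ : Perm X, (∀ x ∉ Y, σ x = x) → sign σ = 1 → ∃ u v : Perm X,
      u.IsCycleOn Y ∧ v.IsCycleOn Y ∧ (∀ x ∉ Y, u x = x) ∧ (∀ x ∉ Y, v x = x) ∧ u * v = σ := by
  induction Y using Finset.strongInduction with
  | H Y ih =>
  intro hne σ hσ hs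
  by_cases h1 : σ = 1
  · obtain ⟨u, hu, hsu⟩ := Y.exists_cycleOn
    have hu' : ∀ x ∉ Y, u x = x := fun x hx => by
      by_contra h
      exact hx (hsu (mem_support.2 h))
    exact ⟨u, u⁻¹, hu, hu.inv, hu', fun x hx => apply_eq_of_isCycleOn_insert hu' hx,
      by simp [h1]⟩
  obtain ⟨a, ha⟩ : ∃ a, σ a ≠ a := by
    by_contra! h
    exact h1 (Equiv.ext h)
  have hin : ∀ x, σ x ≠ x → x ∈ Y := fun x hx => by
    by_contra h
    exact hx (hσ x h)
  -- the common inductive step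
  have key : ∀ a c y y' : X, a ≠ c → a ≠ y → c ≠ y → a ≠ y' → c ≠ y' → a ∈ Y → c ∈ Y → y ∈ Y →
      y' ∈ Y → (∀ τ, τ = (swap a c * swap c y * (swap a c * swap c y'))⁻¹ * σ →
        τ a = a ∧ τ c = c) →
      ∃ u v : Perm X, u.IsCycleOn Y ∧ v.IsCycleOn Y ∧ (∀ x ∉ Y, u x = x) ∧
        (∀ x ∉ Y, v x = x) ∧ u * v = σ := by
    intro a c y y' hac hay hcy hay' hcy' haY hcY hyY hyY' hfix
    obtain ⟨hτa, hτc⟩ := hfix _ rfl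
    set τ := (swap a c * swap c y * (swap a c * swap c y'))⁻¹ * σ with hτ
    have hτσ : σ = swap a c * swap c y * (swap a c * swap c y') * τ := by
      rw [hτ, mul_inv_cancel_left]
    have hτY : ∀ x ∉ (Y.erase a).erase c, τ x = x := by
      intro x hx
      by_cases hxa : x = a
      · rw [hxa, hτa]
      by_cases hxc : x = c
      · rw [hxc, hτc]
      have hxY : x ∉ Y := by simpa [hxa, hxc] using hx
      have : ∀ z ∈ Y, x ≠ z := fun z hz h => hxY (h ▸ hz)
      simp only [hτ, mul_inv_rev, swap_inv, mul_apply, hσ x hxY]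
      simp [swap_apply_of_ne_of_ne, hxa, hxc, this y hyY, this y' hyY']
    have hτs : sign τ = 1 := by
      simp [hτ, hs, hac, hcy, hcy']
    have hlt : (Y.erase a).erase c ⊂ Y :=
      (Finset.erase_subset _ _).trans_ssubset (Finset.erase_ssubset haY)
    have hy1 : y ∈ (Y.erase a).erase c := by simp [hay.symm, hcy.symm, hyY]
    have hy2 : y' ∈ (Y.erase a).erase c := by simp [hay'.symm, hcy'.symm, hyY']
    obtain ⟨u, v, hu, hv, hu', hv', huv⟩ := ih _ hlt ⟨y, hy1⟩ τ hτY hτs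
    obtain ⟨u', v', h1, h2, h3, h4, h5⟩ := isCycleOn_mul_of_insert hu hv hu' hv'
      (a := a) (c := c) (by simp) (by simp) hac hy1 hy2
    have hYY : insert a (insert c (((Y.erase a).erase c : Finset X) : Set X)) = Y := by
      rw [← Finset.coe_insert, ← Finset.coe_insert, Finset.insert_erase (by simp [hcY, hac.symm]),
        Finset.insert_erase haY]
    rw [hYY] at h1 h2 h3 h4
    exact ⟨u', v', h1, h2, h3, h4, by rw [h5, huv, hτσ]⟩
  by_cases h2 : ∃ a, σ a ≠ a ∧ σ (σ a) ≠ a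
  · obtain ⟨a, ha, ha2⟩ := h2
    have hab : σ (σ a) ≠ σ a := fun h => ha (σ.injective h)
    have hb : σ (σ (σ a)) ≠ σ (σ a) := fun h => hab (σ.injective h)
    -- With `y = y'` the factor is the square of a three-cycle, here the three-cycle `a ↦ σ a ↦ σ (σ
    -- a) ↦ a`, which agrees with `σ` at `a` and `σ a`.
    refine key (σ a) a (σ (σ a)) (σ (σ a)) ha hab.symm ha2.symm hab.symm ha2.symm (hin _ hab)
      (hin _ ha) (hin _ hb) (hin _ hb) ?_
    rintro τ rfl
    simp only [mul_inv_rev, swap_inv, mul_apply]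
    constructor
    · simp [swap_apply_def, ha, ha.symm, ha2, ha2.symm, hab, hab.symm]
    · simp [swap_apply_def, ha, ha.symm, ha2, ha2.symm, hab, hab.symm]
  · push Not at h2
    have hb := h2 a ha
    -- Now `σ` is an involution. It is even, hence not a single transposition; the factor split off
    -- below is `(a (σ a)) (c (σ c))`.
    obtain ⟨c, hca, hcb, hc⟩ : ∃ c, c ≠ a ∧ c ≠ σ a ∧ σ c ≠ c := by
      by_contra! h
      have : σ = swap a (σ a) := by
        ext x
        rcases eq_or_ne x a with rfl | hxa
        · simp
        rcases eq_or_ne x (σ a) with rfl | hxb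
        · simp [hb]
        rw [swap_apply_of_ne_of_ne hxa hxb, h x hxa hxb]
      rw [this, sign_swap ha.symm] at hs
      exact absurd hs (by decide)
    have hd := h2 c hc
    have hda : σ c ≠ a := fun h => hcb (by rw [← h, hd])
    have hdb : σ c ≠ σ a := fun h => hca (σ.injective h)
    refine key a c (σ a) (σ c) hca.symm ha.symm hcb hda.symm hc.symm (hin _ ha) (hin _ hc)
      (hin _ (by rw [hb]; exact ha.symm)) (hin _ (by rw [hd]; exact hc.symm)) ?_
    rintro τ rfl
    simp only [mul_inv_rev, swap_inv, mul_apply]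
    constructor <;>
    simp [swap_apply_def, ha, ha.symm, hca, hca.symm, hcb, hcb.symm, hc, hc.symm, hda, hda.symm,
      hdb, hdb.symm]

/-- Every even permutation of a finite set is a commutator. -/
theorem exists_commutator_eq [DecidableEq X] [Fintype X] (σ : Perm X) (hs : sign σ = 1) :
    ∃ a b : Perm X, σ = a * b * a⁻¹ * b⁻¹ := by
  rcases subsingleton_or_nontrivial X with hX | hX
  · exact ⟨1, 1, Subsingleton.elim _ _⟩
  obtain ⟨u, v, hu, hv, -, -, rfl⟩ :=
    exists_isCycleOn_mul_eq Finset.univ Finset.univ_nonempty σ (by simp) hs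
  rw [Finset.coe_univ] at hu hv
  have hcyc : ∀ w : Perm X, w.IsCycleOn _root_.Set.univ → w.IsCycle ∧ w.support.card = Fintype.card X := by
    intro w hw
    refine ⟨isCycle_iff_exists_isCycleOn.2 ⟨_, Set.nontrivial_univ, hw, by simp⟩, ?_⟩
    have : w.support = Finset.univ := by
      ext x
      simpa using hw.apply_ne Set.nontrivial_univ (Set.mem_univ x)
    rw [this, Finset.card_univ]
  obtain ⟨hu1, hu2⟩ := hcyc _ hu
  obtain ⟨hv1, hv2⟩ := hcyc _ hv.inv
  -- Full cycles are conjugate, so `v = c * u⁻¹ * c⁻¹` and `u * v` is a commutator.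
  obtain ⟨c, hc⟩ := isConj_iff.1 ((hu1.isConj_iff hv1).2 (hu2.trans hv2.symm))
  refine ⟨u, c, ?_⟩
  have : v = c * u⁻¹ * c⁻¹ := by
    rw [← inv_inv v, ← hc]
    group
  rw [this]
  group

end Equiv.Perm

end

/-! ### Holonomy along the orbits of a map, and the merging of two cycles by a transposition. -/

section

open Equiv Equiv.Perm Function

section Walk

variable {D H : Type*}

/-- The product of the values of `g` along the first `i` points of the `f`-orbit of `d`,
later factors on the left. -/
def walk [Monoid H] (f : D → D) (g : D → H) (d : D) : ℕ → H
  | 0 => 1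
  | i + 1 => g (f^[i] d) * walk f g d i

/-- The holonomy of `g` around the `f`-orbit of the periodic point `d`. -/
noncomputable def hol [Monoid H] (f : D → D) (g : D → H) (d : D) : H :=
  walk f g d (minimalPeriod f d)

section Monoid

variable [Monoid H] {f f' : D → D} {g g' : D → H} {d : D}

theorem walk_succ (i : ℕ) : walk f g d (i + 1) = g (f^[i] d) * walk f g d i := rfl

theorem walk_one : walk f g d 1 = g d := by simp [walk]

theorem walk_add (i j : ℕ) : walk f g d (i + j) = walk f g (f^[i] d) j * walk f g d i := by
  induction j with
  | zero => simp [walk]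
  | succ j ih =>
    rw [← add_assoc, walk_succ, ih, walk_succ, mul_assoc, ← Function.iterate_add_apply, add_comm j]

theorem walk_succ' (i : ℕ) : walk f g d (i + 1) = walk f g (f d) i * g d := by
  rw [add_comm, walk_add, walk_one, iterate_one]

theorem walk_congr {d' : D} {i : ℕ} (h : ∀ j < i, g (f^[j] d) = g' (f'^[j] d')) :
    walk f g d i = walk f' g' d' i := by
  induction i with
  | zero => rfl
  | succ i ih => rw [walk_succ, walk_succ, ih fun j hj => h j (by omega), h i (by omega)]

theorem walk_eq_one {i : ℕ} (h : ∀ j < i, g (f^[j] d) = 1) : walk f g d i = 1 := by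
  induction i with
  | zero => rfl
  | succ i ih => rw [walk_succ, ih fun j hj => h j (by omega), h i (by omega), one_mul]

theorem walk_eq_head {i : ℕ} (hi : 0 < i) (h : ∀ j < i, 0 < j → g (f^[j] d) = 1) :
    walk f g d i = g d := by
  obtain ⟨i, rfl⟩ := Nat.exists_eq_add_of_lt hi
  rw [zero_add, walk_succ', walk_eq_one, one_mul]
  intro j hj
  rw [← iterate_succ_apply]
  exact h _ (by omega) (by omega)

theorem iterate_eq_of_agree (h : ∀ i, f' (f^[i] d) = f (f^[i] d)) (i : ℕ) :
    f'^[i] d = f^[i] d := by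
  induction i with
  | zero => rfl
  | succ i ih => rw [iterate_succ_apply', iterate_succ_apply', ih, h]

theorem hol_eq_of_agree (h : ∀ i, f' (f^[i] d) = f (f^[i] d))
    (hg : ∀ i, g' (f^[i] d) = g (f^[i] d)) : hol f' g' d = hol f g d := by
  have h1 := iterate_eq_of_agree h
  have : minimalPeriod f' d = minimalPeriod f d := by
    rw [minimalPeriod_eq_minimalPeriod_iff]
    intro n
    rw [IsPeriodicPt, IsPeriodicPt, IsFixedPt, IsFixedPt, h1]
  rw [hol, hol, this]
  exact walk_congr fun j _ => by rw [h1, hg]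

end Monoid

section Group

variable [Group H] {f : D → D} {g : D → H} {d : D}

/-- The inner gauge factors telescope. -/
theorem walk_gauge (u : D → H) (i : ℕ) :
    walk f (fun x => u (f x) * g x * (u x)⁻¹) d i = u (f^[i] d) * walk f g d i * (u d)⁻¹ := by
  induction i with
  | zero => simp [walk]
  | succ i ih => rw [walk_succ, walk_succ, ih, iterate_succ_apply']; group

theorem hol_gauge (u : D → H) :
    hol f (fun x => u (f x) * g x * (u x)⁻¹) d = u d * hol f g d * (u d)⁻¹ := by
  rw [hol, walk_gauge, iterate_minimalPeriod, hol]

/-- Moving the base point one step along the orbit conjugates the holonomy by `g d`. -/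
theorem isConj_hol_apply (hd : d ∈ periodicPts f) : IsConj (hol f g d) (hol f g (f d)) := by
  rw [isConj_iff]
  refine ⟨g d, ?_⟩
  have h1 := walk_succ (f := f) (g := g) (d := d) (minimalPeriod f d)
  rw [walk_succ', iterate_minimalPeriod] at h1
  rw [hol, hol, minimalPeriod_apply hd, ← h1, mul_inv_cancel_right]

/-- The conjugacy class of the holonomy. -/
noncomputable def holClass (f : D → D) (g : D → H) (d : D) : ConjClasses H :=
  ConjClasses.mk (hol f g d)

theorem holClass_apply (hd : d ∈ periodicPts f) : holClass f g (f d) = holClass f g d :=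
  (ConjClasses.mk_eq_mk_iff_isConj.2 (isConj_hol_apply hd)).symm

end Group

end Walk

namespace Equiv.Perm

variable {D : Type*}

theorem mem_periodicPts [Finite D] (ρ : Perm D) (d : D) : d ∈ periodicPts ρ := by
  obtain ⟨n, hn, h⟩ := (isOfFinOrder_of_finite ρ).exists_pow_eq_one
  refine ⟨n, hn, ?_⟩
  rw [IsPeriodicPt, IsFixedPt, iterate_eq_pow, h, one_apply]

theorem minimalPeriod_pos [Finite D] (ρ : Perm D) (d : D) : 0 < minimalPeriod ρ d :=
  minimalPeriod_pos_of_mem_periodicPts (ρ.mem_periodicPts d)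

theorem sameCycle_iff_iterate [Finite D] {ρ : Perm D} {x y : D} :
    ρ.SameCycle x y ↔ ∃ i < minimalPeriod ρ x, ρ^[i] x = y := by
  constructor
  · intro h
    obtain ⟨i, hi⟩ := h.exists_nat_pow_eq
    refine ⟨i % minimalPeriod ρ x, Nat.mod_lt _ (ρ.minimalPeriod_pos x), ?_⟩
    rw [iterate_mod_minimalPeriod_eq, iterate_eq_pow, hi]
  · rintro ⟨i, -, rfl⟩
    rw [iterate_eq_pow]
    exact ⟨i, by rw [zpow_natCast]⟩

theorem sameCycle_iterate (ρ : Perm D) (x : D) (i : ℕ) : ρ.SameCycle x (ρ^[i] x) := by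
  rw [iterate_eq_pow]
  exact ⟨i, by rw [zpow_natCast]⟩

theorem SameCycle.of_forall_eq {α : Type*} {ρ : Perm D} {F : D → α} (hF : ∀ x, F (ρ x) = F x)
    {x y : D} (h : ρ.SameCycle x y) : F x = F y := by
  have hF' : ∀ (n : ℕ) x, F ((ρ ^ n) x) = F x := by
    intro n
    induction n with
    | zero => intro x; rfl
    | succ n ih => intro x; rw [pow_succ, mul_apply, ih, hF]
  obtain ⟨i, rfl⟩ := h
  obtain ⟨m, rfl | rfl⟩ := i.eq_nat_or_neg
  · exact_mod_cast (hF' m x).symm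
  · have := hF' m ((ρ ^ (-(m : ℤ))) x)
    rw [← zpow_natCast, ← mul_apply, ← zpow_add] at this
    simpa using this

/-- The type of cycles of a permutation, including the fixed points. -/
abbrev Cycles (ρ : Perm D) : Type _ := Quotient (SameCycle.setoid ρ)

/-- The number of cycles of a permutation, including the fixed points. -/
noncomputable def numCycles (ρ : Perm D) : ℕ := Nat.card ρ.Cycles

/-- The cycle of a point. -/
def cyc (ρ : Perm D) (d : D) : ρ.Cycles := Quotient.mk _ d

theorem cyc_eq_cyc {ρ : Perm D} {x y : D} : ρ.cyc x = ρ.cyc y ↔ ρ.SameCycle x y := Quotient.eq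

theorem cyc_apply (ρ : Perm D) (x : D) : ρ.cyc (ρ x) = ρ.cyc x :=
  cyc_eq_cyc.2 (sameCycle_apply_left.2 (SameCycle.refl _ _))

theorem cyc_surjective (ρ : Perm D) : Surjective ρ.cyc := Quotient.mk_surjective

section Merge

variable [DecidableEq D] {ρ : Perm D} {a b : D}

theorem mul_swap_apply_of_ne {x : D} (ha : x ≠ a) (hb : x ≠ b) : (ρ * swap a b) x = ρ x := by
  rw [mul_apply, swap_apply_of_ne_of_ne ha hb]

theorem mul_swap_agree {x : D} (ha : ¬ ρ.SameCycle a x) (hb : ¬ ρ.SameCycle b x) (i : ℕ) :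
    (ρ * swap a b) (ρ^[i] x) = ρ (ρ^[i] x) :=
  mul_swap_apply_of_ne (fun h => ha (h ▸ (sameCycle_iterate ρ x i).symm))
    (fun h => hb (h ▸ (sameCycle_iterate ρ x i).symm))

/-- The transposition diverts the first step from `a` to `ρ b`. From there the orbit follows the
cycle of `b`, meeting `a` never and `b` only at the end of the period. -/
theorem mul_swap_iterate (hab : ¬ ρ.SameCycle a b) (i : ℕ) (hi : i < minimalPeriod ρ b) :
    (ρ * swap a b)^[i + 1] a = ρ^[i + 1] b := by
  induction i with
  | zero => simp
  | succ i ih =>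
    rw [iterate_succ_apply', ih (by omega), iterate_succ_apply' _ (i + 1), mul_swap_apply_of_ne]
    · exact fun h => hab (h ▸ (sameCycle_iterate ρ b (i + 1)).symm)
    · exact fun h => not_isPeriodicPt_of_pos_of_lt_minimalPeriod (by omega) hi h

variable [Finite D]

theorem mul_swap_iterate_period (hab : ¬ ρ.SameCycle a b) :
    (ρ * swap a b)^[minimalPeriod ρ b] a = b := by
  have h := ρ.minimalPeriod_pos b
  have := mul_swap_iterate hab (minimalPeriod ρ b - 1) (by omega)
  rwa [Nat.sub_add_cancel h, iterate_minimalPeriod] at this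

theorem mul_swap_iterate_period' (hab : ¬ ρ.SameCycle a b) :
    (ρ * swap a b)^[minimalPeriod ρ a] b = a := by
  rw [swap_comm]
  exact mul_swap_iterate_period fun h => hab h.symm

theorem mul_swap_sameCycle (hab : ¬ ρ.SameCycle a b) : (ρ * swap a b).SameCycle a b := by
  have := sameCycle_iterate (ρ * swap a b) a (minimalPeriod ρ b)
  rwa [mul_swap_iterate_period hab] at this

/-- From `a` the orbit makes one lap of the cycle of `b`, ending at `b`, and then one lap of the
cycle of `a`. -/
theorem minimalPeriod_mul_swap (hab : ¬ ρ.SameCycle a b) :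
    minimalPeriod (ρ * swap a b) a = minimalPeriod ρ b + minimalPeriod ρ a := by
  set ρ' := ρ * swap a b with hρ'
  have hper : IsPeriodicPt ρ' (minimalPeriod ρ b + minimalPeriod ρ a) a := by
    rw [IsPeriodicPt, IsFixedPt, add_comm, iterate_add_apply, mul_swap_iterate_period hab,
      mul_swap_iterate_period' hab]
  refine le_antisymm (hper.minimalPeriod_le (by have := ρ.minimalPeriod_pos b; omega)) ?_
  by_contra! hlt
  have hpos := ρ'.minimalPeriod_pos a
  have hfix := iterate_minimalPeriod (f := ρ') (x := a)
  -- A return during the first lap would put `a` on the cycle of `b`; one during the second lap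
  -- would be a premature return to `a` under `ρ`.
  rcases le_or_gt (minimalPeriod ρ' a) (minimalPeriod ρ b) with hle | hgt
  · obtain ⟨i, hi⟩ := Nat.exists_eq_add_of_lt hpos
    rw [zero_add] at hi
    rw [hi, hρ', mul_swap_iterate hab i (by omega)] at hfix
    exact hab (hfix ▸ (sameCycle_iterate ρ b (i + 1)).symm)
  · obtain ⟨i, hi⟩ := Nat.exists_eq_add_of_lt hgt
    rw [hi, add_assoc, add_comm, iterate_add_apply, hρ', mul_swap_iterate_period hab, swap_comm,
      mul_swap_iterate (fun h => hab h.symm) i (by omega)] at hfix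
    exact not_isPeriodicPt_of_pos_of_lt_minimalPeriod (by omega) (by omega) hfix

/-- A step of `ρ` is a step of the new permutation after a possible exchange of `a` and `b`, which
now share a cycle. -/
theorem SameCycle.mul_swap (hab : ¬ ρ.SameCycle a b) {x y : D} (h : ρ.SameCycle x y) :
    (ρ * swap a b).SameCycle x y := by
  refine cyc_eq_cyc.1 (SameCycle.of_forall_eq (fun x => ?_) h)
  set ρ' := ρ * swap a b with hρ'
  have key : ρ'.cyc a = ρ'.cyc b := cyc_eq_cyc.2 (mul_swap_sameCycle hab)
  have : ρ x = ρ' (swap a b x) := by simp [hρ']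
  rw [this, cyc_apply, swap_apply_def]
  split_ifs with h1 h2
  · rw [h1, key]
  · rw [h2, key]
  · rfl

theorem mul_swap_sameCycle_iff (hab : ¬ ρ.SameCycle a b) {x y : D} :
    (ρ * swap a b).SameCycle x y ↔ ρ.SameCycle x y ∨
      (ρ.SameCycle a x ∨ ρ.SameCycle b x) ∧ (ρ.SameCycle a y ∨ ρ.SameCycle b y) := by
  constructor
  · intro h
    by_cases hx : ρ.SameCycle a x ∨ ρ.SameCycle b x
    · refine Or.inr ⟨hx, ?_⟩
      have : (ρ.SameCycle a x ∨ ρ.SameCycle b x) = (ρ.SameCycle a y ∨ ρ.SameCycle b y) := by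
        refine SameCycle.of_forall_eq (F := fun x => ρ.SameCycle a x ∨ ρ.SameCycle b x) ?_ h
        intro x
        simp only [mul_apply, sameCycle_apply_right, eq_iff_iff, swap_apply_def]
        split_ifs with h1 h2 <;> simp_all [SameCycle.refl]
      rwa [← this]
    · push Not at hx
      obtain ⟨i, -, rfl⟩ := sameCycle_iff_iterate.1 h
      rw [iterate_eq_of_agree (mul_swap_agree hx.1 hx.2)]
      exact Or.inl (sameCycle_iterate _ _ _)
  · have key := mul_swap_sameCycle hab
    rintro (h | ⟨h1, h2⟩)
    · exact h.mul_swap hab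
    · have h3 : ∀ z, (ρ.SameCycle a z ∨ ρ.SameCycle b z) → (ρ * swap a b).SameCycle a z := by
        rintro z (h | h)
        · exact h.mul_swap hab
        · exact key.trans (h.mul_swap hab)
      exact (h3 x h1).symm.trans (h3 y h2)

/-- The map on cycles when two cycles are merged. -/
def mergeCycles (hab : ¬ ρ.SameCycle a b) : ρ.Cycles → (ρ * swap a b).Cycles :=
  Quotient.map' id fun _ _ h => SameCycle.mul_swap hab h

theorem mergeCycles_cyc (hab : ¬ ρ.SameCycle a b) (x : D) :
    mergeCycles hab (ρ.cyc x) = (ρ * swap a b).cyc x := rfl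

/-- Only the cycles of `a` and `b` become equal, so leaving out one of them restores injectivity
without losing the merged cycle. Counts and products over cycles are compared along this bijection.
-/
theorem mergeCycles_bijective (hab : ¬ ρ.SameCycle a b) :
    Bijective fun o : {o : ρ.Cycles // o ≠ ρ.cyc b} => mergeCycles hab o.1 := by
  constructor
  · rintro ⟨o, ho⟩ ⟨o', ho'⟩ h
    obtain ⟨x, rfl⟩ := ρ.cyc_surjective o
    obtain ⟨y, rfl⟩ := ρ.cyc_surjective o'
    simp only [mergeCycles_cyc, cyc_eq_cyc, mul_swap_sameCycle_iff hab, ne_eq] at h ho ho'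
    rw [Subtype.mk.injEq, cyc_eq_cyc]
    rcases h with h | ⟨h1, h2⟩
    · exact h
    · exact (h1.resolve_right fun h => ho h.symm).symm.trans (h2.resolve_right fun h => ho' h.symm)
  · intro o
    obtain ⟨x, rfl⟩ := cyc_surjective _ o
    by_cases hx : ρ.SameCycle x b
    · refine ⟨⟨ρ.cyc a, fun h => hab (cyc_eq_cyc.1 h)⟩, ?_⟩
      simp only [mergeCycles_cyc, cyc_eq_cyc, mul_swap_sameCycle_iff hab]
      exact Or.inr ⟨Or.inl (SameCycle.refl _ _), Or.inr hx.symm⟩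
    · exact ⟨⟨ρ.cyc x, fun h => hx (cyc_eq_cyc.1 h)⟩, rfl⟩

theorem numCycles_mul_swap (hab : ¬ ρ.SameCycle a b) :
    ρ.numCycles = (ρ * swap a b).numCycles + 1 := by
  classical
  have := Fintype.ofFinite ρ.Cycles
  have h1 := Nat.card_congr (Equiv.ofBijective _ (mergeCycles_bijective hab))
  rw [numCycles, numCycles, ← h1, Nat.card_eq_fintype_card, Nat.card_eq_fintype_card,
    Fintype.card_subtype_compl (· = ρ.cyc b), Fintype.card_subtype_eq]
  have : 0 < Fintype.card ρ.Cycles := Fintype.card_pos_iff.2 ⟨ρ.cyc a⟩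
  omega

theorem prod_mergeCycles {M : Type*} [CommMonoid M] [Fintype ρ.Cycles]
    [Fintype (ρ * swap a b).Cycles] (hab : ¬ ρ.SameCycle a b) (F : ρ.Cycles → M)
    (F' : (ρ * swap a b).Cycles → M) (h1 : F' (mergeCycles hab (ρ.cyc a)) = F (ρ.cyc a) * F (ρ.cyc b))
    (h2 : ∀ o, o ≠ ρ.cyc a → o ≠ ρ.cyc b → F' (mergeCycles hab o) = F o) :
    ∏ o, F' o = ∏ o, F o := by
  classical
  have hne : ρ.cyc a ≠ ρ.cyc b := fun h => hab (cyc_eq_cyc.1 h)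
  rw [← (Equiv.ofBijective _ (mergeCycles_bijective hab)).prod_comp F']
  simp only [Equiv.ofBijective_apply]
  rw [← Finset.prod_subtype (Finset.univ.erase (ρ.cyc b)) (by simp)
      (fun o => F' (mergeCycles hab o)),
    ← Finset.mul_prod_erase Finset.univ F (Finset.mem_univ (ρ.cyc b)),
    ← Finset.mul_prod_erase (Finset.univ.erase (ρ.cyc b)) F (a := ρ.cyc a) (by simp [hne]),
    ← Finset.mul_prod_erase (Finset.univ.erase (ρ.cyc b)) _ (a := ρ.cyc a) (by simp [hne]),
    h1, ← mul_assoc, mul_comm (F (ρ.cyc b))]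
  congr 1
  refine Finset.prod_congr rfl fun o ho => ?_
  simp only [Finset.mem_erase] at ho
  exact h2 o ho.1 ho.2.1

end Merge

end Equiv.Perm

end

/-! ### Cocycles with prescribed holonomy: contraction and deletion of an edge. -/

section

open Equiv Equiv.Perm Function
open scoped Pointwise

section Cocycle

variable {D H : Type*}

theorem holClass_eq_of_sameCycle [Group H] [Finite D] {ρ : Perm D} {g : D → H} {x y : D}
    (h : ρ.SameCycle x y) : holClass ρ g x = holClass ρ g y :=
  SameCycle.of_forall_eq (fun z => holClass_apply (ρ.mem_periodicPts z)) h

/-- Transition functions along the edges `{d, α d}`; the fixed points of `α` carry none. -/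
def IsCocycle [Group H] (α : Perm D) (g : D → H) : Prop :=
  (∀ d, g (α d) * g d = 1) ∧ ∀ d, α d = d → g d = 1

/-- There are transition functions with the prescribed holonomy around the cycles of `ρ`. -/
def Realizable [Group H] (α ρ : Perm D) (Γ : ρ.Cycles → ConjClasses H) : Prop :=
  ∃ g : D → H, IsCocycle α g ∧ ∀ d, holClass ρ g d = Γ (ρ.cyc d)

theorem iterate_ne_of_lt [Finite D] {ρ : Perm D} {a b : D} (hab : ¬ ρ.SameCycle a b) {j : ℕ}
    (hj : j < minimalPeriod ρ a - 1) : ρ^[j] (ρ a) ≠ a ∧ ρ^[j] (ρ a) ≠ b := by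
  rw [← iterate_succ_apply]
  exact ⟨not_isPeriodicPt_of_pos_of_lt_minimalPeriod (by omega) (by omega),
    fun h => hab (h ▸ sameCycle_iterate ρ a (j + 1))⟩

/-- This isolates the factor `g a`, the one that changes when an edge is deleted or restored. -/
theorem hol_eq_walk_mul [Monoid H] [Finite D] {ρ : Perm D} {a : D} (g : D → H) :
    hol ρ g a = walk ρ g (ρ a) (minimalPeriod ρ a - 1) * g a := by
  have h := ρ.minimalPeriod_pos a
  rw [← walk_succ', Nat.sub_add_cancel h, hol]

variable [DecidableEq D] {α : Perm D} {a : D}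

/-- Multiplication by the transposition cuts the edge `{a, α a}` into two fixed points. Fixed points
carry trivial transition functions, so a cut edge no longer contributes to holonomies. -/
theorem mul_swap_apply_cases (hα : ∀ d, α (α d) = d) (x : D) :
    ((x = a ∨ x = α a) ∧ (α * swap a (α a)) x = x) ∨
      (x ≠ a ∧ x ≠ α a ∧ (α * swap a (α a)) x = α x) := by
  by_cases h1 : x = a
  · subst h1
    simp [hα]
  by_cases h2 : x = α a
  · subst h2
    simp
  · exact Or.inr ⟨h1, h2, mul_swap_apply_of_ne h1 h2⟩

theorem isCocycle_mul_swap_iff [Group H] (hα : ∀ d, α (α d) = d) {g : D → H} :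
    IsCocycle (α * swap a (α a)) g ↔ IsCocycle α g ∧ g a = 1 := by
  constructor
  · rintro ⟨h1, h2⟩
    have ha : g a = 1 := h2 a (by simp [hα])
    have hb : g (α a) = 1 := h2 _ (by simp)
    refine ⟨⟨fun x => ?_, fun x hx => ?_⟩, ha⟩
    · rcases mul_swap_apply_cases (a := a) hα x with ⟨rfl | rfl, h⟩ | ⟨-, -, h⟩
      · rw [ha, hb, one_mul]
      · rw [hα, ha, hb, one_mul]
      · rw [← h, h1]
    · rcases mul_swap_apply_cases (a := a) hα x with ⟨rfl | rfl, h⟩ | ⟨-, -, h⟩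
      · exact ha
      · exact hb
      · exact h2 x (h.trans hx)
  · rintro ⟨⟨h1, h2⟩, ha⟩
    have hb : g (α a) = 1 := by simpa [ha] using h1 a
    refine ⟨fun x => ?_, fun x hx => ?_⟩ <;>
    rcases mul_swap_apply_cases (a := a) hα x with ⟨rfl | rfl, h⟩ | ⟨-, -, h⟩
    · rw [h, ha, one_mul]
    · rw [h, hb, one_mul]
    · rw [h, h1]
    · exact ha
    · exact hb
    · exact h2 x (h.symm.trans hx)

theorem mul_swap_involutive (hα : ∀ d, α (α d) = d) (x : D) :
    (α * swap a (α a)) ((α * swap a (α a)) x) = x := by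
  rcases mul_swap_apply_cases (a := a) hα x with ⟨-, h⟩ | ⟨h1, h2, h⟩
  · rw [h, h]
  · rw [h, mul_swap_apply_of_ne, hα]
    · exact fun h => h2 (by rw [← h, hα])
    · exact fun h => h1 (α.injective h)

theorem numCycles_involution_mul_swap [Finite D] (hα : ∀ d, α (α d) = d) (ha : α a ≠ a) :
    (α * swap a (α a)).numCycles = α.numCycles + 1 := by
  have h : ¬ (α * swap a (α a)).SameCycle a (α a) := by
    intro h
    obtain ⟨i, -, hi⟩ := sameCycle_iff_iterate.1 h
    rw [iterate_fixed (by simp [hα])] at hi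
    exact ha hi.symm
  rw [numCycles_mul_swap h, mul_assoc, swap_mul_self, mul_one]

/-- The measure for the induction in `realizable_iff`. -/
theorem card_moved_mul_swap_lt [Finite D] (hα : ∀ d, α (α d) = d) (ha : α a ≠ a) :
    Nat.card {x // (α * Equiv.swap a (α a)) x ≠ x} < Nat.card {x // α x ≠ x} := by
  refine Set.ncard_lt_ncard (s := {x | (α * Equiv.swap a (α a)) x ≠ x}) (t := {x | α x ≠ x})
    ⟨fun x hx => ?_, fun h => ?_⟩ (Set.toFinite _)
  · rcases mul_swap_apply_cases (a := a) hα x with ⟨-, h⟩ | ⟨-, -, h⟩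
    · exact absurd h hx
    · rwa [Set.mem_ofPred_eq, h] at hx
  · exact h (show α a ≠ a from ha) (by simp [hα])

/-- Contracting the edge `{a, α a}` between different cycles of `φ`. -/
theorem realizable_contract [Group H] [Finite D] {φ ρ : Perm D} (hρ : ∀ d, ρ d = φ (α d))
    (hα : ∀ d, α (α d) = d) (ha : ¬ φ.SameCycle a (α a)) (Γ : ρ.Cycles → ConjClasses H) :
    Realizable α ρ Γ ↔ Realizable (α * swap a (α a)) ρ Γ := by
  classical
  constructor
  · rintro ⟨g, ⟨h1, h2⟩, h3⟩
    -- This gauge renumbers the vertex of `a` only. Since `u (ρ x) = u (α x)` and `α a` lies at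
    -- another vertex, the new value at `a` is `1 * g a * (g a)⁻¹`.
    set u : D → H := fun x => if φ.SameCycle a x then g a else 1 with hu
    have huφ : ∀ x, u (φ x) = u x := fun x => by simp [hu, sameCycle_apply_right]
    refine ⟨fun x => u (ρ x) * g x * (u x)⁻¹, (isCocycle_mul_swap_iff hα).2 ⟨⟨?_, ?_⟩, ?_⟩, ?_⟩
    · intro x
      change u (ρ (α x)) * g (α x) * (u (α x))⁻¹ * (u (ρ x) * g x * (u x)⁻¹) = 1
      rw [hρ, hρ, hα, huφ, huφ]
      calc _ = u x * (g (α x) * g x) * (u x)⁻¹ := by group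
        _ = 1 := by rw [h1]; group
    · intro x hx
      change u (ρ x) * g x * (u x)⁻¹ = 1
      rw [hρ, huφ, hx, h2 x hx]; group
    · rw [hρ, huφ]
      simp [hu, ha, SameCycle.refl]
    · intro d
      rw [← h3, holClass, hol_gauge, holClass, ConjClasses.mk_eq_mk_iff_isConj, isConj_comm,
        isConj_iff]
      exact ⟨_, rfl⟩
  · rintro ⟨g, h1, h2⟩
    exact ⟨g, ((isCocycle_mul_swap_iff hα).1 h1).1, h2⟩

section Delete

variable {ρ : Perm D} {b : D}

theorem walk_mul_swap [Monoid H] [Finite D] (hab : ¬ ρ.SameCycle a b) {g : D → H} (ha : g a = 1) :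
    walk (ρ * swap a b) g a (minimalPeriod ρ b) = walk ρ g (ρ b) (minimalPeriod ρ b - 1) := by
  have h := ρ.minimalPeriod_pos b
  conv_lhs => rw [← Nat.sub_add_cancel h, walk_succ', ha, mul_one]
  refine walk_congr fun j hj => ?_
  rw [← iterate_succ_apply, mul_swap_iterate hab j (by omega), iterate_succ_apply]

/-- The merged orbit from `a` traverses the cycle of `b` before that of `a`, and later factors stand
on the left; the values at `a` and `b` themselves are trivial. -/
theorem hol_mul_swap [Monoid H] [Finite D] (hab : ¬ ρ.SameCycle a b) {g : D → H} (ha : g a = 1)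
    (hb : g b = 1) :
    hol (ρ * swap a b) g a = walk ρ g (ρ a) (minimalPeriod ρ a - 1) *
      walk ρ g (ρ b) (minimalPeriod ρ b - 1) := by
  rw [hol, minimalPeriod_mul_swap hab, walk_add, walk_mul_swap hab ha,
    mul_swap_iterate_period hab, swap_comm, walk_mul_swap (fun h => hab h.symm) hb]

/-- Data on the cycles of `ρ` and on those of `ρ * swap a b` that agree away from the merged
cycles, where the product of `x` and `y` describes the new one. -/
structure IsMerged [Group H] [Finite D] (hab : ¬ ρ.SameCycle a b) (Γ : ρ.Cycles → ConjClasses H)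
    (x y : H) (Γ' : (ρ * swap a b).Cycles → ConjClasses H) : Prop where
  left : ConjClasses.mk x = Γ (ρ.cyc a)
  right : ConjClasses.mk y = Γ (ρ.cyc b)
  merged : Γ' (mergeCycles hab (ρ.cyc a)) = ConjClasses.mk (x * y)
  other : ∀ o, o ≠ ρ.cyc a → o ≠ ρ.cyc b → Γ' (mergeCycles hab o) = Γ o

theorem exists_isMerged [Group H] [Finite D] (hab : ¬ ρ.SameCycle a b)
    (Γ : ρ.Cycles → ConjClasses H) {x y : H} (hx : ConjClasses.mk x = Γ (ρ.cyc a))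
    (hy : ConjClasses.mk y = Γ (ρ.cyc b)) : ∃ Γ', IsMerged hab Γ x y Γ' := by
  classical
  have hne : ρ.cyc a ≠ ρ.cyc b := fun h => hab (cyc_eq_cyc.1 h)
  set E := Equiv.ofBijective _ (mergeCycles_bijective hab) with hE
  have hEs : ∀ o (ho : o ≠ ρ.cyc b), E.symm (mergeCycles hab o) = ⟨o, ho⟩ := fun o ho => by
    rw [Equiv.symm_apply_eq, hE, Equiv.ofBijective_apply]
  refine ⟨fun o => if (E.symm o).1 = ρ.cyc a then ConjClasses.mk (x * y) else Γ (E.symm o).1,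
    hx, hy, ?_, ?_⟩
  · simp [hEs _ hne]
  · intro o h1 h2
    simp [hEs _ h2, h1]

/-- The holonomies at the two ends are `Wa * g a` and, up to conjugation, `(g a)⁻¹ * Wb`. Their
product is `Wa * Wb`, which is the holonomy of the merged face once the values on the deleted edge
are replaced by `1`. -/
theorem Realizable.exists_isMerged [Group H] [Finite D] {Γ : ρ.Cycles → ConjClasses H}
    (hα : ∀ d, α (α d) = d) (hαa : α a ≠ a) (hab : ¬ ρ.SameCycle a (α a))
    (h : Realizable α ρ Γ) :
    ∃ x y Γ', IsMerged hab Γ x y Γ' ∧ Realizable (α * swap a (α a)) (ρ * swap a (α a)) Γ' := by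
  obtain ⟨g, ⟨h1, h2⟩, h3⟩ := h
  set Wa := walk ρ g (ρ a) (minimalPeriod ρ a - 1) with hWa
  set Wb := walk ρ g (ρ (α a)) (minimalPeriod ρ (α a) - 1) with hWb
  have hgb : g (α a) = (g a)⁻¹ := eq_inv_of_mul_eq_one_left (h1 a)
  obtain ⟨Γ', hΓ'⟩ := _root_.exists_isMerged hab Γ (x := Wa * g a) (y := (g a)⁻¹ * Wb)
    (by rw [← h3, holClass, hol_eq_walk_mul])
    (by
      rw [← h3, holClass, hol_eq_walk_mul, hgb, ← hWb, ConjClasses.mk_eq_mk_iff_isConj, isConj_iff]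
      exact ⟨g a, by group⟩)
  refine ⟨_, _, Γ', hΓ', ?_⟩
  set g' : D → H := fun x => if x = a ∨ x = α a then 1 else g x with hg'
  have hg'a : g' a = 1 := by simp [hg']
  have hg'b : g' (α a) = 1 := by simp [hg']
  refine ⟨g', (isCocycle_mul_swap_iff hα).2 ⟨⟨fun x => ?_, fun x hx => ?_⟩, hg'a⟩, fun d => ?_⟩
  · rcases mul_swap_apply_cases (a := a) hα x with ⟨rfl | rfl, h⟩ | ⟨h1', h2', -⟩
    · rw [hg'a, hg'b, one_mul]
    · rw [hα, hg'a, hg'b, one_mul]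
    · have e1 : α x ≠ a := fun h => h2' (by rw [← h, hα])
      have e2 : α x ≠ α a := fun h => h1' (α.injective h)
      simp [hg', h1', h2', e1, h1]
  · by_cases hxa : x = a ∨ x = α a
    · simp [hg', hxa]
    · simp [hg', hxa, h2 x hx]
  · by_cases hd : ρ.SameCycle a d ∨ ρ.SameCycle (α a) d
    · have hs : (ρ * swap a (α a)).SameCycle a d :=
        (mul_swap_sameCycle_iff hab).2 (Or.inr ⟨Or.inl (SameCycle.refl _ _), hd⟩)
      rw [← holClass_eq_of_sameCycle hs, ← cyc_eq_cyc.2 hs, ← mergeCycles_cyc hab, hΓ'.merged,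
        holClass, hol_mul_swap hab hg'a hg'b]
      congr 1
      rw [← mul_assoc, mul_inv_cancel_right]
      congr 1
      · refine walk_congr fun j hj => ?_
        have := iterate_ne_of_lt hab hj
        simp [hg', this.1, this.2]
      · refine walk_congr fun j hj => ?_
        have := iterate_ne_of_lt (fun h => hab h.symm) hj
        simp [hg', this.1, this.2]
    · push Not at hd
      rw [← mergeCycles_cyc hab, hΓ'.other _ (fun h => hd.1 (cyc_eq_cyc.1 h).symm)
        (fun h => hd.2 (cyc_eq_cyc.1 h).symm), ← h3, holClass, holClass,
        hol_eq_of_agree (mul_swap_agree hd.1 hd.2)]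
      intro i
      have hi := sameCycle_iterate ρ d i
      have e1 : ρ^[i] d ≠ a := fun h => hd.1 (h ▸ hi).symm
      have e2 : ρ^[i] d ≠ α a := fun h => hd.2 (h ▸ hi).symm
      simp [hg', e1, e2]

/-- Restoring the edge leaves one value free. It is chosen to give one face the right holonomy, and
the known product then forces the class of the other. -/
theorem IsMerged.realizable [Group H] [Finite D] {Γ : ρ.Cycles → ConjClasses H}
    (hα : ∀ d, α (α d) = d) (hαa : α a ≠ a) {hab : ¬ ρ.SameCycle a (α a)} {x y : H}
    {Γ' : (ρ * swap a (α a)).Cycles → ConjClasses H} (hΓ' : IsMerged hab Γ x y Γ')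
    (h : Realizable (α * swap a (α a)) (ρ * swap a (α a)) Γ') : Realizable α ρ Γ := by
  obtain ⟨g', h1, h3⟩ := h
  obtain ⟨⟨h1, h2⟩, hg'a⟩ := (isCocycle_mul_swap_iff hα).1 h1
  have hg'b : g' (α a) = 1 := by simpa [hg'a] using h1 a
  set Wa := walk ρ g' (ρ a) (minimalPeriod ρ a - 1) with hWa
  set Wb := walk ρ g' (ρ (α a)) (minimalPeriod ρ (α a) - 1) with hWb
  have key := h3 a
  rw [← mergeCycles_cyc hab, hΓ'.merged, holClass, hol_mul_swap hab hg'a hg'b,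
    ConjClasses.mk_eq_mk_iff_isConj, isConj_comm, isConj_iff] at key
  obtain ⟨t, ht⟩ := key
  -- The solution of `Wa * u = t * x * t⁻¹`, where `t` conjugates `x * y` into `Wa * Wb`. It makes
  -- `Wb * u⁻¹` the conjugate of `y` by `u * t`.
  set u := Wa⁻¹ * (t * x * t⁻¹) with hu
  set g : D → H := fun z => if z = a then u else if z = α a then u⁻¹ else g' z with hg
  have hga : g a = u := by simp [hg]
  have hgb : g (α a) = u⁻¹ := by simp [hg, hαa]
  have hgo : ∀ z, z ≠ a → z ≠ α a → g z = g' z := fun z h1 h2 => by simp [hg, h1, h2]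
  have hola : holClass ρ g a = Γ (ρ.cyc a) := by
    rw [holClass, hol_eq_walk_mul, hga, ← hΓ'.left, ConjClasses.mk_eq_mk_iff_isConj, isConj_comm,
      isConj_iff]
    refine ⟨t, ?_⟩
    rw [walk_congr (g' := g') (f' := ρ) (d' := ρ a) fun j hj =>
      hgo _ (iterate_ne_of_lt hab hj).1 (iterate_ne_of_lt hab hj).2, ← hWa, hu]
    group
  have holb : holClass ρ g (α a) = Γ (ρ.cyc (α a)) := by
    rw [holClass, hol_eq_walk_mul, hgb, ← hΓ'.right, ConjClasses.mk_eq_mk_iff_isConj,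
      isConj_comm, isConj_iff]
    have hba : ¬ ρ.SameCycle (α a) a := fun h => hab h.symm
    refine ⟨u * t, ?_⟩
    rw [walk_congr (g' := g') (f' := ρ) (d' := ρ (α a)) fun j hj =>
      hgo _ (iterate_ne_of_lt hba hj).2 (iterate_ne_of_lt hba hj).1, ← hWb]
    have : Wb = Wa⁻¹ * (t * (x * y) * t⁻¹) := by
      rw [ht, ← hWa, ← hWb, inv_mul_cancel_left]
    rw [this, hu]
    group
  refine ⟨g, ⟨fun z => ?_, fun z hz => ?_⟩, fun d => ?_⟩
  · rcases mul_swap_apply_cases (a := a) hα z with ⟨rfl | rfl, h⟩ | ⟨h1', h2', -⟩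
    · rw [hga, hgb, inv_mul_cancel]
    · rw [hα, hga, hgb, mul_inv_cancel]
    · rw [hgo z h1' h2', hgo, h1]
      · exact fun h => h2' (by rw [← h, hα])
      · exact fun h => h1' (α.injective h)
  · rw [hgo, h2 z hz]
    · rintro rfl
      exact hαa hz
    · rintro rfl
      exact hαa (α.injective hz)
  · by_cases hd1 : ρ.SameCycle a d
    · rw [← holClass_eq_of_sameCycle hd1, ← cyc_eq_cyc.2 hd1, hola]
    by_cases hd2 : ρ.SameCycle (α a) d
    · rw [← holClass_eq_of_sameCycle hd2, ← cyc_eq_cyc.2 hd2, holb]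
    have := h3 d
    rw [← mergeCycles_cyc hab, hΓ'.other _ (fun h => hd1 (cyc_eq_cyc.1 h).symm)
        (fun h => hd2 (cyc_eq_cyc.1 h).symm), holClass,
        hol_eq_of_agree (mul_swap_agree hd1 hd2) (g := g)] at this
    · exact this
    · intro i
      have hi := sameCycle_iterate ρ d i
      exact (hgo _ (fun h => hd1 (h ▸ hi).symm) (fun h => hd2 (h ▸ hi).symm)).symm

end Delete

end Cocycle

end

/-! ### Products of conjugacy classes. -/

section

open Equiv Equiv.Perm Function
open scoped Pointwise

section ClassProducts

variable {H : Type*} [Group H]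

theorem mem_carrier_iff {c : ConjClasses H} {x : H} : x ∈ c.carrier ↔ ConjClasses.mk x = c :=
  ConjClasses.mem_carrier_iff_mk_eq

/-- The elements of a conjugacy class, as a central element of the monoid of subsets. -/
def centralCarrier (c : ConjClasses H) : Submonoid.center (Set H) :=
  ⟨c.carrier, Submonoid.mem_center_iff.2 fun S => by
    -- An element passes across a class by `s * x = (s * x * s⁻¹) * s`. Centrality is what gives
    -- meaning to a product of classes over an unordered index set.
    have key : ∀ x ∈ c.carrier, ∀ s, s * x * s⁻¹ ∈ c.carrier ∧ s⁻¹ * x * s ∈ c.carrier := by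
      intro x hx s
      simp only [mem_carrier_iff] at hx ⊢
      rw [← hx, ConjClasses.mk_eq_mk_iff_isConj, ConjClasses.mk_eq_mk_iff_isConj, isConj_comm,
        isConj_iff, isConj_comm, isConj_iff]
      exact ⟨⟨s, rfl⟩, s⁻¹, by group⟩
    ext z
    constructor
    · rintro ⟨s, hs, x, hx, rfl⟩
      exact ⟨_, (key x hx s).1, s, hs, by simp⟩
    · rintro ⟨x, hx, s, hs, rfl⟩
      exact ⟨s, hs, _, (key x hx s).2, by simp [mul_assoc]⟩⟩

theorem mem_centralCarrier {c : ConjClasses H} {x : H} :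
    x ∈ (centralCarrier c).1 ↔ ConjClasses.mk x = c := mem_carrier_iff

theorem centralCarrier_one : centralCarrier (ConjClasses.mk (1 : H)) = 1 := by
  refine Subtype.ext (Set.ext fun x => ?_)
  rw [mem_centralCarrier, ConjClasses.mk_eq_mk_iff_isConj, isConj_one_left]
  exact Iff.rfl

/-- A conjugate of `x * y` is the product of the conjugates of `x` and `y` by the same element. -/
theorem centralCarrier_mk_mul_subset {c c' : ConjClasses H} {x y z : H}
    (hx : ConjClasses.mk x = c) (hy : ConjClasses.mk y = c')
    (hz : z ∈ (centralCarrier (ConjClasses.mk (x * y))).1) :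
    z ∈ (centralCarrier c * centralCarrier c').1 := by
  rw [mem_centralCarrier, ConjClasses.mk_eq_mk_iff_isConj, isConj_comm, isConj_iff] at hz
  obtain ⟨t, rfl⟩ := hz
  refine ⟨t * x * t⁻¹, ?_, t * y * t⁻¹, ?_, by group⟩
  · change _ ∈ c.carrier
    rw [mem_carrier_iff, ← hx, ConjClasses.mk_eq_mk_iff_isConj, isConj_comm, isConj_iff]
    exact ⟨t, rfl⟩
  · change _ ∈ c'.carrier
    rw [mem_carrier_iff, ← hy, ConjClasses.mk_eq_mk_iff_isConj, isConj_comm, isConj_iff]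
    exact ⟨t, rfl⟩

/-- Representatives of the given conjugacy classes can be chosen with product `1`. -/
def HasTrivialProduct {ι : Type*} [Fintype ι] (Γ : ι → ConjClasses H) : Prop :=
  (1 : H) ∈ (∏ i, centralCarrier (Γ i)).1

end ClassProducts

section Merge

variable {D H : Type*} [DecidableEq D] [Group H] [Finite D] {ρ : Perm D} {a b : D}
  [Fintype ρ.Cycles] [Fintype (ρ * Equiv.swap a b).Cycles]

/-- The common cofactor is the product over the cycles that do not take part in the merging; it does
not depend on `x`, `y` or `Γ'`. Applied to `centralCarrier` and to `classSign`. -/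
theorem prod_eq_mul_of_isMerged {M : Type*} [CommMonoid M] (F : ConjClasses H → M)
    (hab : ¬ ρ.SameCycle a b) (Γ : ρ.Cycles → ConjClasses H) :
    ∃ m, ∏ o, F (Γ o) = m * (F (Γ (ρ.cyc a)) * F (Γ (ρ.cyc b))) ∧
      ∀ x y Γ', IsMerged hab Γ x y Γ' → ∏ o, F (Γ' o) = m * F (ConjClasses.mk (x * y)) := by
  classical
  have hne : ρ.cyc a ≠ ρ.cyc b := fun h => hab (cyc_eq_cyc.1 h)
  refine ⟨∏ o ∈ (Finset.univ.erase (ρ.cyc b)).erase (ρ.cyc a), F (Γ o), ?_, ?_⟩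
  · rw [← Finset.mul_prod_erase Finset.univ _ (Finset.mem_univ (ρ.cyc b)),
      ← Finset.mul_prod_erase (Finset.univ.erase (ρ.cyc b)) _ (a := ρ.cyc a) (by simp [hne]),
      ← mul_assoc, mul_comm, mul_comm (F (Γ (ρ.cyc b)))]
  · intro x y Γ' h
    have key := prod_mergeCycles hab
      -- The merged value is placed on the cycle of `a` and `1` on that of `b`, so that the product
      -- can be taken over the old cycles.
      (fun o => if o = ρ.cyc a then F (ConjClasses.mk (x * y)) else if o = ρ.cyc b then 1
        else F (Γ o)) (fun o => F (Γ' o)) (by simp [h.merged, hne.symm])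
      (fun o h1 h2 => by simp [h1, h2, h.other o h1 h2])
    rw [key, ← Finset.mul_prod_erase Finset.univ _ (Finset.mem_univ (ρ.cyc b)),
      ← Finset.mul_prod_erase (Finset.univ.erase (ρ.cyc b)) _ (a := ρ.cyc a) (by simp [hne])]
    simp only [if_neg hne.symm, if_true, one_mul]
    rw [mul_comm]
    congr 1
    refine Finset.prod_congr rfl fun o ho => ?_
    simp only [Finset.mem_erase] at ho
    simp [ho.1, ho.2.1]

/-- Commutativity brings the representatives `x` and `y` of the two merging classes next to each
other, and `x * y` represents the new class. The existential is needed because a product of two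
classes is in general a union of several. -/
theorem hasTrivialProduct_iff_exists_isMerged (hab : ¬ ρ.SameCycle a b)
    (Γ : ρ.Cycles → ConjClasses H) :
    HasTrivialProduct Γ ↔ ∃ x y Γ', IsMerged hab Γ x y Γ' ∧ HasTrivialProduct Γ' := by
  obtain ⟨m, h1, h2⟩ := prod_eq_mul_of_isMerged centralCarrier hab Γ
  constructor
  · intro h
    rw [HasTrivialProduct, h1] at h
    obtain ⟨q, hq, z, ⟨x, hx, y, hy, rfl⟩, hz⟩ := h
    obtain ⟨Γ', hΓ'⟩ := exists_isMerged hab Γ (mem_centralCarrier.1 hx) (mem_centralCarrier.1 hy)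
    refine ⟨x, y, Γ', hΓ', ?_⟩
    rw [HasTrivialProduct, h2 x y Γ' hΓ']
    exact ⟨q, hq, _, mem_centralCarrier.2 rfl, hz⟩
  · rintro ⟨x, y, Γ', hΓ', h⟩
    rw [HasTrivialProduct, h2 x y Γ' hΓ'] at h
    obtain ⟨q, hq, z, hz, hqz⟩ := h
    rw [HasTrivialProduct, h1]
    exact ⟨q, hq, z, centralCarrier_mk_mul_subset hΓ'.left hΓ'.right hz, hqz⟩

end Merge

/-- The sign of a conjugacy class of permutations. -/
def classSign {X : Type*} [Fintype X] [DecidableEq X] : ConjClasses (Perm X) → ℤˣ :=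
  Quotient.lift sign fun _ _ h => isConj_iff_eq.1 (MonoidHom.map_isConj sign h)

theorem classSign_mk {X : Type*} [Fintype X] [DecidableEq X] (σ : Perm X) :
    classSign (ConjClasses.mk σ) = sign σ := rfl

/-! ### Maps with one vertex and one face. -/

section Unicellular

variable {D : Type*} {φ α ρ : Perm D}

/-- If no edge interlaced `{a, α a}`, then `α` would preserve the part of the face strictly between
`a` and `α a`. Since `φ = ρ * α`, the `φ`-orbit of `α a` would stay at the positions `1, ..., j` and
never reach `a`, although `φ` has a single cycle. -/
theorem exists_interlaced [Finite D] (hα : ∀ d, α (α d) = d) (hρ : ∀ d, ρ d = φ (α d))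
    (hφ : ∀ x y, φ.SameCycle x y) (a : D) {j : ℕ} (hj : ρ^[j] a = α a) (hj0 : 0 < j)
    (hjm : j < minimalPeriod ρ a) (hρ1 : ∀ x y, ρ.SameCycle x y) :
    ∃ i k, 0 < i ∧ i < j ∧ j < k ∧ k < minimalPeriod ρ a ∧ α (ρ^[i] a) = ρ^[k] a := by
  by_contra! hcon
  have hin : ∀ i, 0 < i → i < j → ∃ k, 0 < k ∧ k < j ∧ α (ρ^[i] a) = ρ^[k] a := by
    intro i h0 hij
    obtain ⟨k, hk, hk'⟩ := sameCycle_iff_iterate.1 (hρ1 a (α (ρ^[i] a)))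
    refine ⟨k, ?_, ?_, hk'.symm⟩
    · rcases Nat.eq_zero_or_pos k with rfl | h
      · have : ρ^[i] a = ρ^[j] a := by
          rw [hj, ← hα (ρ^[i] a), ← hk', iterate_zero_apply]
        rw [iterate_eq_iterate_iff_of_lt_minimalPeriod (hij.trans hjm) hjm] at this
        omega
      · exact h
    · rcases lt_trichotomy k j with h | rfl | h
      · exact h
      · have : ρ^[i] a = ρ^[0] a := by
          rw [← hα (ρ^[i] a), ← hk', hj, hα, iterate_zero_apply]
        rw [iterate_eq_iterate_iff_of_lt_minimalPeriod (hij.trans hjm) (by omega)] at this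
        omega
      · exact absurd hk'.symm (hcon i k h0 hij h hk)
  have hclosed : ∀ n : ℕ, ∃ i, 0 < i ∧ i ≤ j ∧ φ^[n] (α a) = ρ^[i] a := by
    intro n
    induction n with
    | zero => exact ⟨j, hj0, le_rfl, hj.symm⟩
    | succ n ih =>
      obtain ⟨i, h0, hij, h⟩ := ih
      rw [iterate_succ_apply', h]
      rcases hij.lt_or_eq with hij | rfl
      · obtain ⟨k, hk0, hkj, hk⟩ := hin i h0 hij
        refine ⟨k + 1, by omega, by omega, ?_⟩
        rw [iterate_succ_apply', hρ, ← hk, hα]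
      · exact ⟨1, one_pos, hj0, by rw [hj, iterate_one, hρ]⟩
  obtain ⟨n, -, hn⟩ := sameCycle_iff_iterate.1 (hφ (α a) a)
  obtain ⟨i, h0, hij, h⟩ := hclosed n
  rw [hn] at h
  exact not_isPeriodicPt_of_pos_of_lt_minimalPeriod h0.ne' (hij.trans_lt hjm) h.symm

/-- The values `x` and `y` are put on the two edges and `1` on all others. Around the face the four
ends occur in the order `a`, `e`, `α a`, `α e`, which produces a commutator. -/
theorem exists_cocycle_of_interlaced {H : Type*} [Group H] (hα : ∀ d, α (α d) = d) {a : D}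
    {i j k : ℕ} (hi : 0 < i) (hij : i < j) (hjk : j < k) (hk : k < minimalPeriod ρ a)
    (hj : ρ^[j] a = α a) (hik : α (ρ^[i] a) = ρ^[k] a) (x y : H) :
    ∃ g : D → H, IsCocycle α g ∧ hol ρ g a = y⁻¹ * x⁻¹ * y * x := by
  classical
  have hinj : ∀ s t, s < minimalPeriod ρ a → t < minimalPeriod ρ a → s ≠ t →
      ρ^[s] a ≠ ρ^[t] a := fun s t hs ht hst h =>
    hst ((iterate_eq_iterate_iff_of_lt_minimalPeriod hs ht).1 h)
  set e := ρ^[i] a with he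
  have h0i : a ≠ e := hinj 0 i (by omega) (by omega) (by omega)
  have h0j : a ≠ α a := by rw [← hj]; exact hinj 0 j (by omega) (by omega) (by omega)
  have h0k : a ≠ α e := by rw [hik]; exact hinj 0 k (by omega) (by omega) (by omega)
  have hij' : e ≠ α a := by rw [← hj]; exact hinj i j (by omega) (by omega) (by omega)
  have hik' : e ≠ α e := by rw [hik]; exact hinj i k (by omega) (by omega) (by omega)
  have hjk' : α a ≠ α e := by rw [hik, ← hj]; exact hinj j k (by omega) (by omega) (by omega)
  set g : D → H := fun z => if z = a then x else if z = e then y else if z = α a then x⁻¹ else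
    if z = α e then y⁻¹ else 1 with hg
  have ga : g a = x := by simp [hg]
  have ge : g e = y := by simp [hg, h0i.symm]
  have gαa : g (α a) = x⁻¹ := by simp [hg, h0j.symm, hij'.symm]
  have gαe : g (α e) = y⁻¹ := by simp [hg, h0k.symm, hik'.symm, hjk'.symm]
  have go : ∀ z, z ≠ a → z ≠ e → z ≠ α a → z ≠ α e → g z = 1 := fun z h1 h2 h3 h4 => by
    simp [hg, h1, h2, h3, h4]
  have go' : ∀ t < minimalPeriod ρ a, t ≠ 0 → t ≠ i → t ≠ j → t ≠ k → g (ρ^[t] a) = 1 := by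
    intro t ht h0 h1 h2 h3
    refine go _ (hinj t 0 ht (by omega) h0) (hinj t i ht (by omega) h1) ?_ ?_
    · rw [← hj]; exact hinj t j ht (by omega) h2
    · rw [hik]; exact hinj t k ht (by omega) h3
  refine ⟨g, ⟨fun z => ?_, fun z hz => ?_⟩, ?_⟩
  · by_cases h1 : z = a
    · rw [h1, ga, gαa, inv_mul_cancel]
    by_cases h2 : z = e
    · rw [h2, ge, gαe, inv_mul_cancel]
    by_cases h3 : z = α a
    · rw [h3, hα, ga, gαa, mul_inv_cancel]
    by_cases h4 : z = α e
    · rw [h4, hα, ge, gαe, mul_inv_cancel]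
    rw [go z h1 h2 h3 h4, mul_one, go]
    · exact fun h => h3 (by rw [← h, hα])
    · exact fun h => h4 (by rw [← h, hα])
    · exact fun h => h1 (α.injective h)
    · exact fun h => h2 (α.injective h)
  · refine go z ?_ ?_ ?_ ?_
    · rintro rfl; exact h0j hz.symm
    · intro h; rw [h] at hz; exact hik' hz.symm
    · rintro rfl; exact h0j (α.injective hz.symm)
    · intro h; rw [h] at hz; exact hik' (α.injective hz.symm)
  · have hm : minimalPeriod ρ a = i + (j - i) + (k - j) + (minimalPeriod ρ a - k) := by omega
    rw [hol, hm, walk_add, walk_add, walk_add]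
    have e1 : i + (j - i) = j := by omega
    have e2 : j + (k - j) = k := by omega
    rw [e1, e2, walk_eq_head hi, walk_eq_head (by omega), walk_eq_head (by omega),
      walk_eq_head (by omega), ga, ge, hj, gαa, ← hik, gαe]
    · group
    all_goals
      intro t ht ht0
      try rw [← iterate_add_apply]
      exact go' _ (by omega) (by omega) (by omega) (by omega) (by omega)

end Unicellular

end

/-! ### The criterion for prescribed holonomies on a connected map. -/

section

open Equiv Equiv.Perm Function
open scoped Pointwise

section Main

variable {D : Type*}

/-- Twice the genus of the map with vertex rotation `φ`, edge involution `α` and faces the cycles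
of `ρ = φ * α`. -/
noncomputable def twiceGenus (φ α ρ : Perm D) : ℤ :=
  2 - (φ.numCycles + α.numCycles + ρ.numCycles - Nat.card D)

/-- The points `a` and `e` lie on different edges, so both can be left out and every cycle of `α` is
still represented. -/
theorem card_cycles_add_two_le [Finite D] {α : Perm D} {a e : D} (hα : ∀ d, α (α d) = d)
    (ha : a ≠ α a) (hae : a ≠ e) (hae' : a ≠ α e) (he : e ≠ α e) :
    α.numCycles + 2 ≤ Nat.card D := by
  classical
  have := Fintype.ofFinite D
  have hea : e ≠ α a := fun h => hae' (by rw [h, hα])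
  have hsurj : Surjective fun x : {x : D // ¬ (x = a ∨ x = e)} => α.cyc x.1 := by
    intro o
    obtain ⟨x, rfl⟩ := α.cyc_surjective o
    by_cases h1 : x = a
    · exact ⟨⟨α a, by simp [ha.symm, hea.symm]⟩, by simp only [h1]; exact cyc_apply _ _⟩
    by_cases h2 : x = e
    · exact ⟨⟨α e, by simp [he.symm, hae'.symm]⟩, by simp only [h2]; exact cyc_apply _ _⟩
    · exact ⟨⟨x, by simp [h1, h2]⟩, rfl⟩
  have h1 := Nat.card_le_card_of_surjective _ hsurj
  have h2 : Fintype.card {x : D // x = a ∨ x = e} = 2 := by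
    rw [Fintype.card_subtype, show ({x | x = a ∨ x = e} : Finset D) = {a, e} by ext; simp,
      Finset.card_pair hae]
  have h3 : 2 ≤ Fintype.card D := h2 ▸ Fintype.card_subtype_le _
  rw [Nat.card_eq_fintype_card (α := {x : D // ¬ (x = a ∨ x = e)}), Fintype.card_subtype_compl,
    h2] at h1
  rw [numCycles, Nat.card_eq_fintype_card (α := D)]
  omega

theorem numCycles_eq_one {ρ : Perm D} [Nonempty D] (h : ∀ x y, ρ.SameCycle x y) :
    ρ.numCycles = 1 := by
  rw [numCycles, Nat.card_eq_one_iff_unique]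
  refine ⟨⟨fun o o' => ?_⟩, ⟨ρ.cyc (Classical.arbitrary D)⟩⟩
  obtain ⟨x, rfl⟩ := ρ.cyc_surjective o
  obtain ⟨y, rfl⟩ := ρ.cyc_surjective o'
  exact cyc_eq_cyc.2 (h x y)

/-- With a single face, every point contributes once to the holonomy, and the signs at the two ends
of an edge cancel. -/
theorem sign_hol_eq_one {X : Type*} [Fintype X] [DecidableEq X] [Finite D] {α ρ : Perm D}
    (hα : ∀ d, α (α d) = d) (hρ : ∀ x y, ρ.SameCycle x y) {g : D → Perm X} (hg : IsCocycle α g)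
    (a : D) : sign (hol ρ g a) = 1 := by
  classical
  have := Fintype.ofFinite D
  have h1 : ∀ n, sign (walk ρ g a n) = ∏ i ∈ Finset.range n, sign (g (ρ^[i] a)) := by
    intro n
    induction n with
    | zero => simp [walk]
    | succ n ih => rw [walk_succ, Perm.sign_mul, ih, Finset.prod_range_succ, mul_comm]
  rw [hol, h1]
  have h2 : ∏ i ∈ Finset.range (minimalPeriod ρ a), sign (g (ρ^[i] a)) = ∏ x, sign (g x) := by
    refine Finset.prod_bij (fun i _ => ρ^[i] a) (by simp) ?_ ?_ (by simp)
    · intro i hi j hj h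
      rw [Finset.mem_range] at hi hj
      exact (iterate_eq_iterate_iff_of_lt_minimalPeriod hi hj).1 h
    · intro y _
      obtain ⟨i, hi, h⟩ := sameCycle_iff_iterate.1 (hρ a y)
      exact ⟨i, Finset.mem_range.2 hi, h⟩
  rw [h2]
  refine Finset.prod_involution (fun x _ => α x) ?_ ?_ (by simp) (by simp [hα])
  · intro x _
    rw [mul_comm, ← Perm.sign_mul, hg.1, Perm.sign_one]
  · intro x _ hx h
    exact hx (by rw [hg.2 x h, Perm.sign_one])

variable {X : Type*} [Fintype X] [DecidableEq X]

/-- The end of the reduction. Without edges the holonomy is `1` and the genus is zero. With an edge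
there is an interlaced one: the genus is positive, evenness is necessary by `sign_hol_eq_one`, and
it suffices because even permutations are commutators. -/
theorem realizable_iff_of_unicellular [Finite D] [Nonempty D] {φ α ρ : Perm D} [Fintype ρ.Cycles]
    (hα : ∀ d, α (α d) = d) (hρ : ∀ d, ρ d = φ (α d)) (hφ1 : ∀ x y, φ.SameCycle x y)
    (hρ1 : ∀ x y, ρ.SameCycle x y) (Γ : ρ.Cycles → ConjClasses (Perm X)) :
    Realizable α ρ Γ ↔ (twiceGenus φ α ρ / 2 = 0 ∧ HasTrivialProduct Γ) ∨
      (twiceGenus φ α ρ / 2 ≠ 0 ∧ ∏ o, classSign (Γ o) = 1) := by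
  classical
  obtain ⟨d₀⟩ := ‹Nonempty D›
  have : Unique ρ.Cycles := by
    refine ⟨⟨ρ.cyc d₀⟩, fun o => ?_⟩
    obtain ⟨x, rfl⟩ := ρ.cyc_surjective o
    exact cyc_eq_cyc.2 (hρ1 x d₀)
  have hcyc : ∀ o x, o = ρ.cyc x := fun o x => by
    obtain ⟨y, rfl⟩ := ρ.cyc_surjective o
    exact cyc_eq_cyc.2 (hρ1 y x)
  have hg : twiceGenus φ α ρ = Nat.card D - α.numCycles := by
    have : Nonempty D := ⟨d₀⟩
    rw [twiceGenus, numCycles_eq_one hφ1, numCycles_eq_one hρ1]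
    push_cast
    ring
  have hprod : HasTrivialProduct Γ ↔ Γ (ρ.cyc d₀) = ConjClasses.mk 1 := by
    rw [HasTrivialProduct, Fintype.prod_eq_single (ρ.cyc d₀) fun o h => absurd (hcyc o d₀) h,
      mem_centralCarrier, eq_comm]
  have hsign : ∏ o, classSign (Γ o) = classSign (Γ (ρ.cyc d₀)) :=
    Fintype.prod_eq_single (ρ.cyc d₀) fun o h => absurd (hcyc o d₀) h
  by_cases hα1 : ∀ d, α d = d
  · have hz : α.numCycles = Nat.card D := by
      refine (Nat.card_congr (Equiv.ofBijective α.cyc ⟨fun x y h => ?_, cyc_surjective _⟩)).symm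
      obtain ⟨i, -, rfl⟩ := sameCycle_iff_iterate.1 (cyc_eq_cyc.1 h)
      rw [iterate_fixed (hα1 x)]
    rw [hz, sub_self] at hg
    simp only [hg, EuclideanDomain.zero_div, ne_eq, not_true, false_and, or_false, true_and, hprod]
    constructor
    · rintro ⟨g, hg, hΓ⟩
      rw [← hΓ, holClass, hol, walk_eq_one fun j _ => hg.2 _ (hα1 _)]
    · intro h
      refine ⟨fun _ => 1, ⟨by simp, by simp⟩, fun d => ?_⟩
      rw [hcyc (ρ.cyc d) d₀, h, holClass, hol, walk_eq_one fun j _ => rfl]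
  · push Not at hα1
    obtain ⟨a, ha⟩ := hα1
    obtain ⟨j, hjm, hj⟩ := sameCycle_iff_iterate.1 (hρ1 a (α a))
    have hj0 : 0 < j := by
      rcases Nat.eq_zero_or_pos j with rfl | h
      · exact absurd hj.symm ha
      · exact h
    obtain ⟨i, k, hi, hij, hjk, hk, hik⟩ := exists_interlaced hα hρ hφ1 a hj hj0 hjm hρ1
    have hinj : ∀ s t, s < minimalPeriod ρ a → t < minimalPeriod ρ a → s ≠ t →
        ρ^[s] a ≠ ρ^[t] a := fun s t hs ht hst h =>
      hst ((iterate_eq_iterate_iff_of_lt_minimalPeriod hs ht).1 h)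
    have hcard := card_cycles_add_two_le hα ha.symm (e := ρ^[i] a)
      (hinj 0 i (by omega) (by omega) (by omega))
      (by rw [hik]; exact hinj 0 k (by omega) (by omega) (by omega))
      (by rw [hik]; exact hinj i k (by omega) (by omega) (by omega))
    -- Two distinct edges make `twiceGenus` at least `2`, so its rounded half is nonzero; that
    -- `twiceGenus` is even is never needed.
    have hne : twiceGenus φ α ρ / 2 ≠ 0 := by omega
    simp only [hne, false_and, false_or, ne_eq, not_false_iff, true_and, hsign]
    constructor
    · rintro ⟨g, hg, hΓ⟩
      rw [← hΓ, holClass, classSign_mk, sign_hol_eq_one hα hρ1 hg]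
    · intro h
      obtain ⟨σ, hσ⟩ := ConjClasses.mk_surjective (Γ (ρ.cyc d₀))
      rw [← hσ, classSign_mk] at h
      obtain ⟨p, q, rfl⟩ := exists_commutator_eq σ h
      obtain ⟨g, hg, hg'⟩ := exists_cocycle_of_interlaced hα hi hij hjk hk hj hik q⁻¹ p⁻¹
      refine ⟨g, hg, fun d => ?_⟩
      rw [hcyc (ρ.cyc d) d₀, ← hσ, holClass_eq_of_sameCycle (hρ1 d a), holClass, hg', inv_inv,
        inv_inv]

/-- Holonomies around the faces of a connected map: in genus `0` the only condition is that
representatives with product `1` can be chosen, in higher genus that the total sign is `1`. -/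
theorem realizable_iff [Finite D] [Nonempty D] (φ α ρ : Perm D) [Fintype ρ.Cycles]
    (hα : ∀ d, α (α d) = d) (hρ : ∀ d, ρ d = φ (α d))
    (hconn : ∀ s : Set D, (∀ d ∈ s, φ d ∈ s) → (∀ d ∈ s, α d ∈ s) → s.Nonempty → s = .univ)
    (Γ : ρ.Cycles → ConjClasses (Perm X)) :
    Realizable α ρ Γ ↔ (twiceGenus φ α ρ / 2 = 0 ∧ HasTrivialProduct Γ) ∨
      (twiceGenus φ α ρ / 2 ≠ 0 ∧ ∏ o, classSign (Γ o) = 1) := by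
  classical
  induction hN : Nat.card {d // α d ≠ d} using Nat.strong_induction_on generalizing φ α ρ with
  | _ N ih =>
  subst hN
  by_cases h1 : ∃ a, ¬ φ.SameCycle a (α a)
  · obtain ⟨a, ha⟩ := h1
    have haa : α a ≠ a := fun h => ha (by rw [h])
    rw [realizable_contract hρ hα ha, ih _ (card_moved_mul_swap_lt hα haa)
      (φ * Equiv.swap a (α a)) (α * Equiv.swap a (α a)) ρ (mul_swap_involutive hα) _ _ Γ rfl]
    · have : twiceGenus (φ * Equiv.swap a (α a)) (α * Equiv.swap a (α a)) ρ
          = twiceGenus φ α ρ := by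
        rw [twiceGenus, twiceGenus, numCycles_mul_swap ha, numCycles_involution_mul_swap hα haa]
        push_cast
        ring
      rw [this]
    · intro d
      rcases mul_swap_apply_cases (a := a) hα d with ⟨rfl | rfl, h⟩ | ⟨h1, h2, h⟩
      · rw [h, hρ, mul_apply, swap_apply_left]
      · rw [h, hρ, mul_apply, swap_apply_right, hα]
      · rw [h, hρ, mul_swap_apply_of_ne]
        · exact fun h => h2 (by rw [← h, hα])
        · exact fun h => h1 (α.injective h)
    · intro s hs1 hs2 hs
      have hsc : ∀ x y, (φ * Equiv.swap a (α a)).SameCycle x y → x ∈ s → y ∈ s := by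
        intro x y h hx
        obtain ⟨i, -, rfl⟩ := sameCycle_iff_iterate.1 h
        clear h
        induction i with
        | zero => exact hx
        | succ i ih => rw [iterate_succ_apply']; exact hs1 _ ih
      refine hconn s (fun d hd => hsc d _ (SameCycle.mul_swap ha ?_) hd) (fun d hd => ?_) hs
      · exact sameCycle_apply_right.2 (SameCycle.refl _ _)
      · rcases mul_swap_apply_cases (a := a) hα d with ⟨rfl | rfl, -⟩ | ⟨-, -, h⟩
        · exact hsc _ _ (mul_swap_sameCycle ha) hd
        · rw [hα]; exact hsc _ _ (mul_swap_sameCycle ha).symm hd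
        · rw [← h]; exact hs2 d hd
  push Not at h1
  -- No edge is left to contract, so connectedness leaves a single vertex, and edges may be deleted
  -- without disconnecting the map.
  have hφ1 : ∀ x y, φ.SameCycle x y := by
    intro x y
    have := hconn {y | φ.SameCycle x y} (fun d hd => sameCycle_apply_right.2 hd)
      (fun d hd => SameCycle.trans hd (h1 d)) ⟨x, SameCycle.refl _ _⟩
    exact (Set.ext_iff.1 this y).2 trivial
  by_cases h2 : ∃ a, ¬ ρ.SameCycle a (α a)
  · obtain ⟨a, ha⟩ := h2
    have haa : α a ≠ a := fun h => ha (by rw [h])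
    have := Fintype.ofFinite (ρ * Equiv.swap a (α a)).Cycles
    have key := ih _ (card_moved_mul_swap_lt hα haa) φ (α * Equiv.swap a (α a))
      (ρ * Equiv.swap a (α a)) (mul_swap_involutive hα) (fun d => by simp [hρ])
      (fun s hs _ hne => by
        obtain ⟨x, hx⟩ := hne
        refine Set.eq_univ_of_forall fun y => ?_
        obtain ⟨i, -, rfl⟩ := sameCycle_iff_iterate.1 (hφ1 x y)
        induction i with
        | zero => exact hx
        | succ i ih => rw [iterate_succ_apply']; exact hs _ ih)
    have hg : twiceGenus φ (α * Equiv.swap a (α a)) (ρ * Equiv.swap a (α a))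
        = twiceGenus φ α ρ := by
      rw [twiceGenus, twiceGenus, numCycles_mul_swap ha, numCycles_involution_mul_swap hα haa]
      push_cast
      ring
    replace key := fun Γ' => key Γ' rfl
    rw [hg] at key
    have hreal : Realizable α ρ Γ ↔ ∃ x y Γ', IsMerged ha Γ x y Γ' ∧
        Realizable (α * Equiv.swap a (α a)) (ρ * Equiv.swap a (α a)) Γ' := by
      constructor
      · exact fun h => h.exists_isMerged hα haa ha
      · rintro ⟨x, y, Γ', h, h'⟩
        exact h.realizable hα haa h'
    have hsg : ∀ x y Γ', IsMerged ha Γ x y Γ' →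
        ∏ o, classSign (Γ' o) = ∏ o, classSign (Γ o) := by
      intro x y Γ' h
      obtain ⟨m, e1, e2⟩ := prod_eq_mul_of_isMerged classSign ha Γ
      rw [e1, e2 x y Γ' h, ← h.left, ← h.right, classSign_mk, classSign_mk, classSign_mk, Perm.sign_mul]
    rw [hreal]
    by_cases hp : twiceGenus φ α ρ / 2 = 0
    · simp only [hp, true_and, ne_eq, not_true, false_and, or_false] at key ⊢
      rw [hasTrivialProduct_iff_exists_isMerged ha]
      constructor
      · rintro ⟨x, y, Γ', h, h'⟩
        exact ⟨x, y, Γ', h, (key Γ').1 h'⟩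
      · rintro ⟨x, y, Γ', h, h'⟩
        exact ⟨x, y, Γ', h, (key Γ').2 h'⟩
    · simp only [hp, false_and, ne_eq, not_false_iff, true_and, false_or] at key ⊢
      constructor
      · rintro ⟨x, y, Γ', h, h'⟩
        rw [← hsg x y Γ' h]
        exact (key Γ').1 h'
      · intro h
        -- In positive genus any representatives will do: only the total sign matters, and merging
        -- preserves it.
        obtain ⟨x, hx⟩ := ConjClasses.mk_surjective (Γ (ρ.cyc a))
        obtain ⟨y, hy⟩ := ConjClasses.mk_surjective (Γ (ρ.cyc (α a)))
        obtain ⟨Γ', hΓ'⟩ := exists_isMerged ha Γ hx hy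
        exact ⟨x, y, Γ', hΓ', (key Γ').2 ((hsg x y Γ' hΓ').trans h)⟩
  · push Not at h2
    refine realizable_iff_of_unicellular hα hρ hφ1 (fun x y => ?_) Γ
    have hφρ : ∀ d, ρ.SameCycle d (φ d) := fun d => by
      have := sameCycle_apply_right.2 (h2 d)
      rwa [hρ, hα] at this
    have := hconn {y | ρ.SameCycle x y} (fun d hd => SameCycle.trans hd (hφρ d))
      (fun d hd => SameCycle.trans hd (h2 d)) ⟨x, SameCycle.refl _ _⟩
    exact (Set.ext_iff.1 this y).2 trivial

end Main

end

/-! ### Permutations with equal orbits, and disjoint unions of circles. -/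

section

open Equiv Equiv.Perm Function Topology

namespace Equiv.Perm

variable {X : Type*} [Finite X]

theorem minimalPeriod_eq_ncard (σ : Perm X) (x : X) :
    minimalPeriod σ x = {y | σ.SameCycle x y}.ncard := by
  have h : {y | σ.SameCycle x y} = (fun i => σ^[i] x) '' Set.Iio (minimalPeriod σ x) := by
    ext y
    exact sameCycle_iff_iterate
  have hinj : Set.InjOn (fun i => σ^[i] x) (Set.Iio (minimalPeriod σ x)) := fun i hi j hj h =>
    (iterate_eq_iterate_iff_of_lt_minimalPeriod hi hj).1 h
  rw [h, hinj.ncard_image, ← Finset.coe_range, Set.ncard_coe_finset, Finset.card_range]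

/-- Permutations of a finite set with the same orbits are conjugate. -/
theorem isConj_of_sameCycle_iff {σ τ : Perm X}
    (h : ∀ x y, σ.SameCycle x y ↔ τ.SameCycle x y) : IsConj σ τ := by
  have hper : ∀ x, minimalPeriod σ x = minimalPeriod τ x := fun x => by
    simp only [minimalPeriod_eq_ncard, h]
  -- A base point in each common orbit. The conjugating map sends the `i`-th `σ`-iterate of the base
  -- point to its `i`-th `τ`-iterate; this is consistent because the periods agree.
  set R : X → X := fun x => (σ.cyc x).out with hR
  have hRx : ∀ x, σ.SameCycle (R x) x := fun x => cyc_eq_cyc.1 (Quotient.out_eq (σ.cyc x))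
  have hRσ : ∀ x, R (σ x) = R x := fun x => by simp only [hR, cyc_apply]
  choose i hi hix using fun x => sameCycle_iff_iterate.1 (hRx x)
  have key : ∀ {x : X} {a b : ℕ}, σ^[a] x = σ^[b] x ↔ τ^[a] x = τ^[b] x := by
    intro x a b
    rw [← iterate_mod_minimalPeriod_eq (n := a), ← iterate_mod_minimalPeriod_eq (n := b),
      ← iterate_mod_minimalPeriod_eq (f := τ) (n := a),
      ← iterate_mod_minimalPeriod_eq (f := τ) (n := b),
      iterate_eq_iterate_iff_of_lt_minimalPeriod (Nat.mod_lt _ (σ.minimalPeriod_pos x))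
        (Nat.mod_lt _ (σ.minimalPeriod_pos x)),
      iterate_eq_iterate_iff_of_lt_minimalPeriod (Nat.mod_lt _ (τ.minimalPeriod_pos x))
        (Nat.mod_lt _ (τ.minimalPeriod_pos x)), hper]
  set f : X → X := fun x => τ^[i x] (R x) with hf
  have hfσ : ∀ x, f (σ x) = τ (f x) := by
    intro x
    simp only [hf, hRσ]
    rw [← iterate_succ_apply' τ, ← key, iterate_succ_apply', hix, ← hRσ, hix]
  have hinj : Injective f := by
    intro x y hxy
    have hs : ∀ z, σ.SameCycle (R z) (f z) := fun z => (h _ _).2 (sameCycle_iterate _ _ _)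
    have hRR : R x = R y := by
      have h1 : ∀ z, R (R z) = R z := fun z => by
        have := cyc_eq_cyc.2 (hRx z)
        simp only [hR] at this ⊢
        rw [this]
      have h2 : σ.cyc (R x) = σ.cyc (R y) := cyc_eq_cyc.2 ((hs x).trans (hxy ▸ (hs y).symm))
      rw [← h1 x, ← h1 y]
      change (σ.cyc (R x)).out = (σ.cyc (R y)).out
      rw [h2]
    simp only [hf, hRR] at hxy
    rw [← key, ← hRR, hix, hRR, hix] at hxy
    exact hxy
  refine isConj_iff.2 ⟨Equiv.ofBijective f (Finite.injective_iff_bijective.1 hinj), ?_⟩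
  rw [mul_inv_eq_iff_eq_mul]
  ext x
  exact hfσ x

end Equiv.Perm

/-- A presentation of a space as a disjoint union of circles: `F` is the set of arcs, and the arc
`d` is followed by the arc `next d`. -/
structure CircleComplex (A : Type*) [TopologicalSpace A] (F : Type*) where
  next : Perm F
  arc : F → C(unitInterval, A)
  arc_one : ∀ d, arc d 1 = arc (next d) 0
  exists_arc : ∀ a, ∃ d t, arc d t = a
  arc_inj : ∀ d d' t t', t < 1 → t' < 1 → arc d t = arc d' t' → d = d' ∧ t = t'

namespace CircleComplex

variable {A : Type*} [TopologicalSpace A] {F : Type*} (K : CircleComplex A F)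

/-- The arcs as one map. -/
def arcs (x : Σ _ : F, unitInterval) : A := K.arc x.1 x.2

/-- A continuous surjection from a compact space to a Hausdorff space. -/
theorem isQuotientMap_arcs [Finite F] [T2Space A] : IsQuotientMap K.arcs := by
  refine .of_surjective_continuous (fun a => ?_) ?_
  · obtain ⟨d, t, h⟩ := K.exists_arc a
    exact ⟨⟨d, t⟩, h⟩
  · exact continuous_sigma fun d => (K.arc d).continuous

/-- A function on the arcs that is compatible with `next` is compatible with `arcs`. -/
theorem eq_of_arc_eq {α : Type*} {f : F → unitInterval → α} (hf : ∀ d, f d 1 = f (K.next d) 0) {d d' : F}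
    {t t' : unitInterval} (h : K.arc d t = K.arc d' t') : f d t = f d' t' := by
  have key : ∀ d t, ∃ d₁ t₁, t₁ < 1 ∧ K.arc d t = K.arc d₁ t₁ ∧ f d t = f d₁ t₁ := by
    intro d t
    rcases lt_or_eq_of_le (unitInterval.le_one' (t := t)) with h | h
    · exact ⟨d, t, h, rfl, rfl⟩
    · exact ⟨K.next d, 0, by simp, by rw [h, arc_one], by rw [h, hf]⟩
  obtain ⟨d₁, t₁, h1, h2, h3⟩ := key d t
  obtain ⟨d₂, t₂, h4, h5, h6⟩ := key d' t'
  obtain ⟨rfl, rfl⟩ := K.arc_inj _ _ _ _ h1 h4 (by rw [← h2, ← h5, h])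
  rw [h3, h6]

instance _root_.unitInterval.instPathConnectedSpace : PathConnectedSpace unitInterval :=
  isPathConnected_iff_pathConnectedSpace.1
    ((convex_Icc (0 : ℝ) 1).isPathConnected ⟨0, by simp⟩)

theorem joined_arc (d : F) (t t' : unitInterval) : Joined (K.arc d t) (K.arc d t') :=
  (PathConnectedSpace.joined t t').map (K.arc d).continuous

theorem joined_of_sameCycle [Finite F] {d d' : F} (h : K.next.SameCycle d d') (t t' : unitInterval) :
    Joined (K.arc d t) (K.arc d' t') := by
  obtain ⟨i, -, rfl⟩ := sameCycle_iff_iterate.1 h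
  clear h
  have : ∀ i, Joined (K.arc d 0) (K.arc (K.next^[i] d) 0) := by
    intro i
    induction i with
    | zero => exact Joined.refl _
    | succ i ih =>
      rw [iterate_succ_apply', ← arc_one]
      exact ih.trans (K.joined_arc _ _ _)
  exact (K.joined_arc d t 0).trans ((this i).trans (K.joined_arc _ _ _))

variable [Finite F] [T2Space A]

/-- Labelling each point by the cycle of an arc through it is well defined, and it is locally
constant because its pullback to every arc is constant. -/
theorem sameCycle_of_connectedComponents_eq {d d' : F} {t t' : unitInterval}
    (h : (K.arc d t : ConnectedComponents A) = K.arc d' t') : K.next.SameCycle d d' := by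
  set lab : A → K.next.Cycles := fun a => K.next.cyc (K.exists_arc a).choose with hlab
  have hl : ∀ d t, lab (K.arc d t) = K.next.cyc d := by
    intro d t
    obtain ⟨t₁, h1⟩ := (K.exists_arc (K.arc d t)).choose_spec
    exact K.eq_of_arc_eq (f := fun d _ => K.next.cyc d) (fun d => (cyc_apply _ _).symm) h1
  have hloc : IsLocallyConstant lab := by
    intro s
    rw [← K.isQuotientMap_arcs.isOpen_preimage, isOpen_sigma_iff]
    intro d
    have : ((fun t => (⟨d, t⟩ : Σ _ : F, unitInterval)) ⁻¹' (K.arcs ⁻¹' (lab ⁻¹' s)) : Set unitInterval) = {_t | K.next.cyc d ∈ s} := by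
      ext t
      change lab (K.arc d t) ∈ s ↔ _
      rw [hl]
      rfl
    rw [this]
    exact isOpen_const
  have := hloc.apply_eq_of_isPreconnected isPreconnected_connectedComponent
    (ConnectedComponents.coe_eq_coe'.1 h) mem_connectedComponent
  rw [hl, hl] at this
  exact cyc_eq_cyc.1 this

theorem connectedComponents_eq_iff {d d' : F} {t t' : unitInterval} :
    (K.arc d t : ConnectedComponents A) = K.arc d' t' ↔ K.next.SameCycle d d' := by
  refine ⟨K.sameCycle_of_connectedComponents_eq, fun h => ?_⟩
  obtain ⟨γ⟩ := K.joined_of_sameCycle h t t'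
  exact ConnectedComponents.coe_eq_coe'.2
    ((isPreconnected_range γ.continuous).subset_connectedComponent ⟨1, γ.target⟩ ⟨0, γ.source⟩)

/-- The components of a union of circles. -/
noncomputable def cyclesEquiv : K.next.Cycles ≃ ConnectedComponents A :=
  Equiv.ofBijective
    (Quotient.lift (fun d => (K.arc d 0 : ConnectedComponents A))
      fun _ _ h => K.connectedComponents_eq_iff.2 h) <| by
    constructor
    · rintro ⟨d⟩ ⟨d'⟩ h
      exact cyc_eq_cyc.2 (K.connectedComponents_eq_iff.1 h)
    · intro c
      obtain ⟨a, rfl⟩ := ConnectedComponents.surjective_coe c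
      obtain ⟨d, t, rfl⟩ := K.exists_arc a
      exact ⟨K.next.cyc d, K.connectedComponents_eq_iff.2 (SameCycle.refl _ _)⟩

/-- Unions of circles with isomorphic combinatorics are homeomorphic. -/
theorem exists_homeomorph {A' F' : Type*} [TopologicalSpace A'] [T2Space A'] [Finite F']
    (K' : CircleComplex A' F') (u : F ≃ F') (hu : ∀ d, u (K.next d) = K'.next (u d)) :
    ∃ h : A ≃ₜ A', ∀ d t, h (K.arc d t) = K'.arc (u d) t := by
  have hker : ∀ x y, K.arcs x = K.arcs y → K'.arc (u x.1) x.2 = K'.arc (u y.1) y.2 :=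
    fun x y h => K.eq_of_arc_eq (f := fun d t => K'.arc (u d) t)
      (fun d => by rw [K'.arc_one, hu]) h
  have hu' : ∀ d, u.symm (K'.next d) = K.next (u.symm d) := fun d => by
    rw [Equiv.symm_apply_eq, hu, Equiv.apply_symm_apply]
  have hker' : ∀ x y, K'.arcs x = K'.arcs y → K.arc (u.symm x.1) x.2 = K.arc (u.symm y.1) y.2 :=
    fun x y h => K'.eq_of_arc_eq (f := fun d t => K.arc (u.symm d) t)
      (fun d => by rw [K.arc_one, hu']) h
  choose f hf using K.isQuotientMap_arcs.surjective
  choose f' hf' using K'.isQuotientMap_arcs.surjective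
  set H : A → A' := fun a => K'.arc (u (f a).1) (f a).2 with hH
  set H' : A' → A := fun a => K.arc (u.symm (f' a).1) (f' a).2 with hH'
  have e : ∀ d t, H (K.arc d t) = K'.arc (u d) t := fun d t => hker _ ⟨d, t⟩ (hf _)
  have e' : ∀ d t, H' (K'.arc d t) = K.arc (u.symm d) t := fun d t => hker' _ ⟨d, t⟩ (hf' _)
  refine ⟨⟨⟨H, H', fun a => ?_, fun a => ?_⟩, ?_, ?_⟩, e⟩
  · obtain ⟨d, t, rfl⟩ := K.exists_arc a
    rw [e, e', Equiv.symm_apply_apply]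
  · obtain ⟨d, t, rfl⟩ := K'.exists_arc a
    rw [e', e, Equiv.apply_symm_apply]
  · rw [K.isQuotientMap_arcs.continuous_iff]
    refine continuous_sigma fun d => ?_
    refine (K'.arc (u d)).continuous.congr fun t => ?_
    exact (e d t).symm
  · rw [K'.isQuotientMap_arcs.continuous_iff]
    refine continuous_sigma fun d => ?_
    refine (K.arc (u.symm d)).continuous.congr fun t => ?_
    exact (e' d t).symm

end CircleComplex

end

/-! ### Lifts to a covering, and the monodromy around a circle. -/

section

open Equiv Equiv.Perm Function Topology

theorem Set.exists_equiv_fin_of_encard_eq {X : Type*} {s : Set X} {n : ℕ} (h : s.encard = n) :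
    Nonempty (s ≃ Fin n) := by
  have hf : s.Finite := Set.finite_of_encard_eq_coe h
  have := hf.to_subtype
  refine ⟨Finite.equivFinOfCardEq ?_⟩
  rw [Nat.card_coe_set_eq, Set.ncard, h, ENat.toNat_natCast]

section Lifts

variable {E X Y : Type*} [TopologicalSpace E] [TopologicalSpace X] [TopologicalSpace Y]
  {p : E → X} {n : ℕ}

/-- A covering with `n` sheets is trivial over a contractible space. -/
theorem IsCoveringMap.exists_lifts [ContractibleSpace Y] (hp : IsCoveringMap p)
    (hn : ∀ x, (p ⁻¹' {x}).encard = n) (κ : C(Y, X)) :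
    ∃ L : Fin n → C(Y, E), (∀ s y, p (L s y) = κ y) ∧
      (∀ y s s', L s y = L s' y → s = s') ∧ ∀ y e, p e = κ y → ∃ s, L s y = e := by
  obtain ⟨y₀, ⟨H⟩⟩ := id_nullhomotopic Y
  obtain ⟨e⟩ := Set.exists_equiv_fin_of_encard_eq (hn (κ y₀))
  have he : ∀ s, p (e.symm s) = κ y₀ := fun s => (e.symm s).2
  -- The contraction run backwards starts at the constant map to `κ y₀`, whose lifts are the points
  -- of one fibre; at time `1` the lifted homotopies are lifts of `κ`.
  have hlift : ∀ s : Fin n, ∃ f : C(unitInterval × Y, E),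
      p ∘ f = κ.comp H.symm.toContinuousMap ∧ ∀ y, f (0, y) = e.symm s := fun s =>
    ⟨hp.liftHomotopy (κ.comp H.symm.toContinuousMap) (.const Y (e.symm s))
      (fun a => by simp [he]), hp.liftHomotopy_lifts _ _ _, hp.liftHomotopy_zero _ _ _⟩
  choose f hf hf0 using hlift
  have hproj : ∀ s y, p (f s (1, y)) = κ y := fun s y => by
    simpa using congr_fun (hf s) (1, y)
  have hinj : ∀ y s s', f s (1, y) = f s' (1, y) → s = s' := by
    intro y s s' h
    have := hp.eq_of_comp_eq (g₁ := fun t => f s (t, y)) (g₂ := fun t => f s' (t, y))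
      (by fun_prop) (by fun_prop)
      (funext fun t => (congr_fun (hf s) (t, y)).trans (congr_fun (hf s') (t, y)).symm) 1 h
    have := congr_fun this 0
    simp only [hf0] at this
    exact e.symm.injective (Subtype.ext this)
  refine ⟨fun s => (f s).comp (.prodMk (.const Y 1) (.id Y)), hproj, hinj, fun y x hx => ?_⟩
  obtain ⟨e'⟩ := Set.exists_equiv_fin_of_encard_eq (hn (κ y))
  -- The lifts are distinct over each point and as many as the sheets, so they exhaust the fibre.
  have hbij : Bijective fun s => e' ⟨f s (1, y), hproj s y⟩ :=
    Finite.injective_iff_bijective.1 fun s s' h =>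
      hinj y s s' (congr_arg Subtype.val (e'.injective h))
  obtain ⟨s, hs⟩ := hbij.2 (e' ⟨x, hx⟩)
  exact ⟨s, congr_arg Subtype.val (e'.injective hs)⟩

theorem IsCoveringMap.t2Space [T2Space X] (hp : IsCoveringMap p) : T2Space E := by
  refine ⟨fun x y hxy => ?_⟩
  by_cases h : p x = p y
  · exact hp.isSeparatedMap x y h hxy
  · exact separated_by_continuous hp.continuous h

theorem IsCoveringMap.joined_monodromy (hp : IsCoveringMap p) {x x' : X}
    (γ : Path.Homotopic.Quotient x x') (y : p ⁻¹' {x}) : Joined y.1 (hp.monodromy γ y).1 := by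
  obtain ⟨Γ⟩ := hp.liftPathQuotient γ y
  exact ⟨Γ⟩

theorem IsCoveringMap.exists_monodromy_of_joined (hp : IsCoveringMap p) {x x' : X}
    {y : p ⁻¹' {x}} {y' : p ⁻¹' {x'}} (h : Joined y.1 y'.1) :
    ∃ γ : Path.Homotopic.Quotient x x', hp.monodromy γ y = y' := by
  obtain ⟨Γ⟩ := h
  obtain ⟨y, rfl⟩ := y
  obtain ⟨y', rfl⟩ := y'
  exact ⟨(Path.Homotopic.Quotient.mk Γ).map ⟨p, hp.continuous⟩, hp.monodromy_map _⟩

/-- A path between two points of the fibre projects to a loop, which is a power of the generator;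
conversely monodromy moves points along lifted paths. Hence the choice of generator does not affect
the orbits. -/
theorem IsCoveringMap.sameCycle_monodromyPerm_iff (hp : IsCoveringMap p) {x : X}
    {γ : FundamentalGroup X x} (hγ : Subgroup.zpowers γ = ⊤) (y y' : p ⁻¹' {x}) :
    (hp.monodromyPerm x γ).SameCycle y y' ↔ Joined y.1 y'.1 := by
  constructor
  · rintro ⟨i, rfl⟩
    rw [← map_zpow]
    exact hp.joined_monodromy _ y
  · intro h
    obtain ⟨γ', hγ'⟩ := hp.exists_monodromy_of_joined h
    have hmem : (FundamentalGroup.fromPath γ' : FundamentalGroup X x) ∈ Subgroup.zpowers γ :=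
      hγ ▸ Subgroup.mem_top _
    obtain ⟨i, hi⟩ := hmem
    refine ⟨i, ?_⟩
    rw [← map_zpow, ← hγ']
    exact congr_arg (fun γ => hp.monodromyPerm x γ y) hi

end Lifts

/-- Lifts to a space over `A` of the arcs of a union of circles, such that each point of a fibre
lies on exactly one of the `n` lifts of each arc through its image. -/
structure ArcLifts {A F C : Type*} [TopologicalSpace A] [TopologicalSpace C]
    (K : CircleComplex A F) (p : C → A) (n : ℕ) where
  lift : F → Fin n → C(unitInterval, C)
  proj : ∀ d s t, p (lift d s t) = K.arc d t
  lift_inj : ∀ d t s s', lift d s t = lift d s' t → s = s'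
  exists_lift : ∀ d t y, p y = K.arc d t → ∃ s, lift d s t = y
  trans : F → Perm (Fin n)
  lift_one : ∀ d s, lift d s 1 = lift (K.next d) (trans d s) 0

theorem IsCoveringMap.nonempty_arcLifts {A F C : Type*} [TopologicalSpace A] [TopologicalSpace C]
    (K : CircleComplex A F) {p : C → A} {n : ℕ} (hp : IsCoveringMap p)
    (hn : ∀ x, (p ⁻¹' {x}).encard = n) : Nonempty (ArcLifts K p n) := by
  have : ContractibleSpace unitInterval :=
    (convex_Icc (0 : ℝ) 1).contractibleSpace ⟨0, by simp⟩
  choose L hL1 hL2 hL3 using fun d => hp.exists_lifts hn (K.arc d)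
  have htr : ∀ d s, ∃ s', L (K.next d) s' 0 = L d s 1 := fun d s =>
    hL3 _ _ _ (by rw [hL1, K.arc_one])
  choose τ hτ using htr
  have hinj : ∀ d, Injective (τ d) := fun d s s' h =>
    hL2 d 1 s s' (by rw [← hτ, ← hτ, h])
  exact ⟨L, hL1, hL2, hL3, fun d => Equiv.ofBijective _ (Finite.injective_iff_bijective.1 (hinj d)),
    fun d s => (hτ d s).symm⟩

/-- The permutation `(d, s) ↦ (f d, τ d s)`. -/
def skewPerm {F X : Type*} (f : Perm F) (τ : F → Perm X) : Perm (F × X) := Equiv.prodShear f τ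

theorem skewPerm_apply {F X : Type*} (f : Perm F) (τ : F → Perm X) (x : F × X) :
    skewPerm f τ x = (f x.1, τ x.1 x.2) := rfl

theorem skewPerm_iterate {F X : Type*} (f : Perm F) (τ : F → Perm X) (d : F) (s : X) (i : ℕ) :
    (skewPerm f τ)^[i] (d, s) = (f^[i] d, walk f τ d i s) := by
  induction i with
  | zero => rfl
  | succ i ih => rw [iterate_succ_apply', ih, skewPerm_apply, iterate_succ_apply', walk_succ]; rfl

theorem walk_mul_minimalPeriod {F H : Type*} [Monoid H] (f : F → F) (τ : F → H) (d : F) (k : ℕ) :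
    walk f τ d (minimalPeriod f d * k) = hol f τ d ^ k := by
  induction k with
  | zero => simp [walk]
  | succ k ih =>
    rw [mul_add, mul_one, walk_add, ih, pow_succ']
    congr 1
    rw [((isPeriodicPt_minimalPeriod f d).mul_const k).eq, hol]

/-- The orbit returns to the fibre over `d` only after whole laps of `f`, and each lap acts by the
holonomy. -/
theorem skewPerm_sameCycle_iff {F X : Type*} [Finite F] [Finite X] (f : Perm F) (τ : F → Perm X)
    (d : F) (s s' : X) :
    (skewPerm f τ).SameCycle (d, s) (d, s') ↔ (hol f τ d).SameCycle s s' := by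
  constructor
  · intro h
    obtain ⟨i, -, hi⟩ := sameCycle_iff_iterate.1 h
    rw [skewPerm_iterate, Prod.mk.injEq] at hi
    obtain ⟨k, rfl⟩ := IsPeriodicPt.minimalPeriod_dvd hi.1
    rw [walk_mul_minimalPeriod] at hi
    exact ⟨k, hi.2⟩
  · intro h
    obtain ⟨i, -, rfl⟩ := sameCycle_iff_iterate.1 h
    have := sameCycle_iterate (skewPerm f τ) (d, s) (minimalPeriod f d * i)
    rwa [skewPerm_iterate, walk_mul_minimalPeriod,
      ((isPeriodicPt_minimalPeriod f d).mul_const i).eq, ← iterate_eq_pow] at this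

namespace ArcLifts

variable {A F C : Type*} [TopologicalSpace A] [TopologicalSpace C] {K : CircleComplex A F}
  {p : C → A} {n : ℕ} (L : ArcLifts K p n)

/-- The total space of a covering of a union of circles is a union of circles. -/
def circleComplex : CircleComplex C (F × Fin n) where
  next := skewPerm K.next L.trans
  arc x := L.lift x.1 x.2
  arc_one x := L.lift_one x.1 x.2
  exists_arc y := by
    obtain ⟨d, t, h⟩ := K.exists_arc (p y)
    obtain ⟨s, hs⟩ := L.exists_lift d t y h.symm
    exact ⟨(d, s), t, hs⟩
  arc_inj := by
    rintro ⟨d, s⟩ ⟨d', s'⟩ t t' ht ht' h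
    have h1 := congr_arg p h
    simp only [L.proj] at h1
    obtain ⟨rfl, rfl⟩ := K.arc_inj _ _ _ _ ht ht' h1
    exact ⟨by rw [L.lift_inj d t s s' h], rfl⟩

/-- The monodromy class of a covering of a union of circles is the holonomy around the circle. -/
theorem eq_holClass [Finite F] [T2Space A] (hp : IsCoveringMap p) {d : F}
    {Γ : ConjClasses (Perm (Fin n))} {c : ConnectedComponents A} (hc : K.arc d 0 = c)
    (hΓ : IsMonodromyClass hp c Γ) : Γ = holClass K.next L.trans d := by
  have := hp.t2Space
  obtain ⟨x, γ, e, hx, hγ, rfl⟩ := hΓ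
  obtain ⟨d₁, t, rfl⟩ := K.exists_arc x
  rw [← hx, K.connectedComponents_eq_iff] at hc
  rw [holClass_eq_of_sameCycle hc, holClass, ConjClasses.mk_eq_mk_iff_isConj]
  set e' : Fin n ≃ p ⁻¹' {K.arc d₁ t} := Equiv.ofBijective
    (fun s => ⟨L.lift d₁ s t, L.proj _ _ _⟩)
    ⟨fun s s' h => L.lift_inj _ _ _ _ (congr_arg Subtype.val h), fun y => by
      obtain ⟨s, hs⟩ := L.exists_lift d₁ t y.1 y.2
      exact ⟨s, Subtype.ext hs⟩⟩ with he'
  have h1 : IsConj (e.permCongr (hp.monodromyPerm _ γ))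
      (e'.symm.permCongr (hp.monodromyPerm _ γ)) := by
    refine isConj_iff.2 ⟨(e'.trans e).symm, ?_⟩
    ext s
    simp [Equiv.permCongr_apply]
  -- It suffices to compare orbits; for both permutations these are given by the path components of
  -- the total space, itself a union of circles.
  refine h1.trans (isConj_of_sameCycle_iff fun s s' => ?_)
  have h2 : (e'.symm.permCongr (hp.monodromyPerm _ γ)).SameCycle s s' ↔
      (hp.monodromyPerm _ γ).SameCycle (e' s) (e' s') := by
    have hz : ∀ i : ℤ, (e'.symm.permCongr (hp.monodromyPerm _ γ)) ^ i =
        e'.symm.permCongr ((hp.monodromyPerm _ γ) ^ i) := fun i =>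
      (map_zpow e'.symm.permCongrHom (hp.monodromyPerm _ γ) i).symm
    refine exists_congr fun i => ?_
    rw [hz, Equiv.permCongr_apply, Equiv.symm_symm, Equiv.symm_apply_eq]
  rw [h2, hp.sameCycle_monodromyPerm_iff hγ, ← skewPerm_sameCycle_iff]
  constructor
  · rintro ⟨Γ⟩
    refine L.circleComplex.connectedComponents_eq_iff (t := t) (t' := t).1
      (ConnectedComponents.coe_eq_coe'.2 ?_)
    exact (isPreconnected_range Γ.continuous).subset_connectedComponent ⟨1, Γ.target⟩
      ⟨0, Γ.source⟩
  · intro h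
    exact L.circleComplex.joined_of_sameCycle h t t

end ArcLifts

end

/-! ### Gauge equivalence of transition functions with conjugate holonomies. -/

section

open Equiv Equiv.Perm Function Topology

section Gauge

variable {F H : Type*} [Group H] [Finite F]

/-- Transition functions with conjugate holonomies differ by a gauge transformation. -/
theorem exists_gauge_of_holClass_eq (f : Perm F) {τ τ' : F → H}
    (h : ∀ d, holClass f τ d = holClass f τ' d) :
    ∃ u : F → H, ∀ d, u (f d) * τ d = τ' d * u d := by
  set R : F → F := fun x => (f.cyc x).out with hR
  have hRx : ∀ x, f.SameCycle (R x) x := fun x => cyc_eq_cyc.1 (Quotient.out_eq (f.cyc x))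
  have hRf : ∀ x, R (f x) = R x := fun x => by simp only [hR, cyc_apply]
  choose i hi hix using fun x => sameCycle_iff_iterate.1 (hRx x)
  have hconj : ∀ d, ∃ c : H, c * hol f τ d = hol f τ' d * c := fun d => by
    obtain ⟨c, hc⟩ := isConj_iff.1 (ConjClasses.mk_eq_mk_iff_isConj.1 (h d))
    exact ⟨c, by rw [← hc]; group⟩
  choose c hc using hconj
  -- The gauge at `f^[j] x` is forced by its value `c x` at the base point. It does not depend on
  -- the number of laps because `c x` intertwines the two holonomies.
  set V : F → ℕ → H := fun x j => walk f τ' x j * c x * (walk f τ x j)⁻¹ with hV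
  have hVmod : ∀ x j, V x j = V x (j % minimalPeriod f x) := by
    intro x j
    have hpow : ∀ k, c x * hol f τ x ^ k = hol f τ' x ^ k * c x := fun k =>
      (show SemiconjBy (c x) (hol f τ x) (hol f τ' x) from hc x).pow_right k
    have hw : ∀ τ : F → H, walk f τ x j =
        walk f τ x (j % minimalPeriod f x) * hol f τ x ^ (j / minimalPeriod f x) := by
      intro τ
      conv_lhs => rw [← Nat.div_add_mod j (minimalPeriod f x), walk_add, walk_mul_minimalPeriod,
        ((isPeriodicPt_minimalPeriod f x).mul_const _).eq]
    simp only [hV]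
    rw [hw τ, hw τ', mul_assoc (walk f τ' x _), ← hpow]
    group
  have hVeq : ∀ x a b, f^[a] x = f^[b] x → V x a = V x b := by
    intro x a b hab
    rw [← iterate_mod_minimalPeriod_eq (n := a), ← iterate_mod_minimalPeriod_eq (n := b),
      iterate_eq_iterate_iff_of_lt_minimalPeriod (Nat.mod_lt _ (f.minimalPeriod_pos x))
        (Nat.mod_lt _ (f.minimalPeriod_pos x))] at hab
    rw [hVmod, hab, ← hVmod]
  refine ⟨fun x => V (R x) (i x), fun d => ?_⟩
  have : V (R (f d)) (i (f d)) = V (R d) (i d + 1) := by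
    rw [hRf]
    refine hVeq _ _ _ ?_
    rw [iterate_succ_apply', hix, ← hRf, hix]
  simp only [this]
  simp only [hV, walk_succ, hix]
  group

/-- The gauge transformation renumbers the lifts of each arc so that the transitions match, which
makes the two total spaces isomorphic as unions of circles over `K`. -/
theorem ArcLifts.exists_homeomorph {A C C' : Type*} [TopologicalSpace A] [TopologicalSpace C]
    [TopologicalSpace C'] [T2Space C] [T2Space C'] {K : CircleComplex A F} {p : C → A}
    {p' : C' → A} {n : ℕ} (L : ArcLifts K p n) (L' : ArcLifts K p' n)
    (h : ∀ d, holClass K.next L.trans d = holClass K.next L'.trans d) :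
    ∃ h : C ≃ₜ C', ∀ y, p' (h y) = p y := by
  obtain ⟨u, hu⟩ := exists_gauge_of_holClass_eq K.next h
  obtain ⟨e, he⟩ := L.circleComplex.exists_homeomorph L'.circleComplex
    (Equiv.prodShear (Equiv.refl F) u) (by
      rintro ⟨d, s⟩
      exact Prod.ext rfl (DFunLike.congr_fun (hu d) s))
  refine ⟨e, fun y => ?_⟩
  obtain ⟨⟨d, s⟩, t, rfl⟩ := L.circleComplex.exists_arc y
  rw [he]
  exact (L'.proj _ _ _).trans (L.proj _ _ _).symm

end Gauge

/-! ### First return maps of permutations. -/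

namespace Equiv.Perm

variable {D : Type*} {ρ : Perm D} {S : Set D}

/-- The time needed to reach `S` along the orbit of `d`. -/
noncomputable def hitTime (ρ : Perm D) (S : Set D) (d : D) : ℕ := sInf {i | ρ^[i] d ∈ S}

theorem iterate_hitTime_mem {d : D} (h : ∃ i, ρ^[i] d ∈ S) : ρ^[ρ.hitTime S d] d ∈ S :=
  Nat.sInf_mem (s := {i | ρ^[i] d ∈ S}) h

theorem iterate_notMem_of_lt_hitTime {d : D} {i : ℕ} (h : i < ρ.hitTime S d) : ρ^[i] d ∉ S :=
  Nat.notMem_of_lt_sInf h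

theorem hitTime_of_mem {d : D} (h : d ∈ S) : ρ.hitTime S d = 0 :=
  Nat.sInf_eq_zero.2 (Or.inl h)

theorem hitTime_succ {d : D} (h : ∃ i, ρ^[i] d ∈ S) (hd : d ∉ S) :
    ρ.hitTime S d = ρ.hitTime S (ρ d) + 1 := by
  have h0 : ρ.hitTime S d ≠ 0 := fun h0 => hd (by simpa [h0] using iterate_hitTime_mem h)
  obtain ⟨k, hk⟩ := Nat.exists_eq_succ_of_ne_zero h0
  have hmem := iterate_hitTime_mem h
  rw [hk, iterate_succ_apply] at hmem
  rw [hk, Nat.succ_eq_add_one, add_left_inj]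
  refine le_antisymm ?_ (Nat.sInf_le hmem)
  by_contra! hlt
  have hmem' := iterate_hitTime_mem (ρ := ρ) (S := S) (d := ρ d) ⟨k, hmem⟩
  rw [← iterate_succ_apply] at hmem'
  exact iterate_notMem_of_lt_hitTime (by omega) hmem'

/-- The first point of `S` on the orbit of `d`. -/
noncomputable def firstHit (ρ : Perm D) (S : Set D) (d : D) : D := ρ^[ρ.hitTime S d] d

theorem firstHit_of_mem {d : D} (h : d ∈ S) : ρ.firstHit S d = d := by
  rw [firstHit, hitTime_of_mem h, iterate_zero_apply]

theorem firstHit_apply {d : D} (h : ∃ i, ρ^[i] d ∈ S) (hd : d ∉ S) :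
    ρ.firstHit S (ρ d) = ρ.firstHit S d := by
  rw [firstHit, firstHit, hitTime_succ h hd, iterate_succ_apply]

variable [Finite D]

theorem exists_iterate_mem_of_sameCycle {d d' : D} (h : ρ.SameCycle d d') (hd : d' ∈ S) :
    ∃ i, ρ^[i] d ∈ S := by
  obtain ⟨i, -, rfl⟩ := sameCycle_iff_iterate.1 h
  exact ⟨i, hd⟩

theorem exists_iterate_apply_mem {d : D} (hd : d ∈ S) : ∃ i, ρ^[i] (ρ d) ∈ S :=
  exists_iterate_mem_of_sameCycle (sameCycle_apply_left.2 (SameCycle.refl _ _)) hd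

/-- If two starting points reach the same point of `S`, then, running backwards, the one with the
shorter time lies on the path of the other before its first hit, unless they coincide. -/
theorem firstHit_apply_injective :
    Injective fun d : S => (⟨ρ.firstHit S (ρ d), iterate_hitTime_mem (exists_iterate_apply_mem d.2)⟩ : S) := by
  have key : ∀ a b : S, ρ.hitTime S (ρ a) ≤ ρ.hitTime S (ρ b) →
      ρ.firstHit S (ρ a) = ρ.firstHit S (ρ b) → a = b := by
    intro a b hle h
    obtain ⟨k, hk⟩ := Nat.exists_eq_add_of_le hle
    rw [firstHit, firstHit, hk, iterate_add_apply] at h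
    have h2 := ρ.injective.iterate _ h
    rw [← iterate_succ_apply, iterate_succ_apply'] at h2
    have h3 := ρ.injective h2
    rcases Nat.eq_zero_or_pos k with rfl | hpos
    · exact Subtype.ext h3
    · obtain ⟨l, rfl⟩ := Nat.exists_eq_succ_of_ne_zero hpos.ne'
      rw [iterate_succ_apply] at h3
      exact absurd (h3 ▸ a.2) (iterate_notMem_of_lt_hitTime (by omega))
  intro a b h
  rcases le_total (ρ.hitTime S (ρ a)) (ρ.hitTime S (ρ b)) with hle | hle
  · exact key a b hle (congr_arg Subtype.val h)
  · exact (key b a hle (congr_arg Subtype.val h).symm).symm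

/-- The first return map of a permutation to a subset. -/
noncomputable def firstReturn (ρ : Perm D) (S : Set D) : Perm S :=
  Equiv.ofBijective _ (Finite.injective_iff_bijective.1 (firstHit_apply_injective (ρ := ρ)))

theorem firstReturn_apply (d : S) :
    (ρ.firstReturn S d : D) = ρ^[ρ.hitTime S (ρ d) + 1] d := by
  rw [iterate_succ_apply]
  rfl

/-- The time of the `j`-th return. -/
noncomputable def returnTime (ρ : Perm D) (S : Set D) (d : S) : ℕ → ℕ
  | 0 => 0
  | j + 1 => returnTime ρ S d j + (ρ.hitTime S (ρ ((ρ.firstReturn S)^[j] d)) + 1)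

theorem firstReturn_iterate (d : S) (j : ℕ) :
    ((ρ.firstReturn S)^[j] d : D) = ρ^[ρ.returnTime S d j] d := by
  induction j with
  | zero => rfl
  | succ j ih =>
    rw [iterate_succ_apply', firstReturn_apply, returnTime,
      add_comm (ρ.returnTime S d j), iterate_add_apply _ (_ + 1), ← ih]

/-- Every time lies between two successive returns, and strictly between them the orbit avoids `S`.
-/
theorem exists_returnTime_eq {d : S} {i : ℕ} (h : ρ^[i] d ∈ S) : ∃ j, ρ.returnTime S d j = i := by
  have key : ∀ i, ∃ j t, i = ρ.returnTime S d j + t ∧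
      t ≤ ρ.hitTime S (ρ ((ρ.firstReturn S)^[j] d)) := by
    intro i
    induction i with
    | zero => exact ⟨0, 0, rfl, Nat.zero_le _⟩
    | succ i ih =>
      obtain ⟨j, t, h1, h2⟩ := ih
      rcases h2.lt_or_eq with h3 | h3
      · exact ⟨j, t + 1, by omega, h3⟩
      · exact ⟨j + 1, 0, by rw [returnTime]; omega, Nat.zero_le _⟩
  obtain ⟨j, t, rfl, ht⟩ := key i
  rcases Nat.eq_zero_or_pos t with rfl | hpos
  · exact ⟨j, rfl⟩
  · obtain ⟨l, rfl⟩ := Nat.exists_eq_succ_of_ne_zero hpos.ne'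
    rw [add_comm, iterate_add_apply, ← firstReturn_iterate, iterate_succ_apply] at h
    exact absurd h (iterate_notMem_of_lt_hitTime (by omega))

theorem firstReturn_sameCycle_iff {d d' : S} :
    (ρ.firstReturn S).SameCycle d d' ↔ ρ.SameCycle d d' := by
  constructor
  · intro h
    obtain ⟨j, -, rfl⟩ := sameCycle_iff_iterate.1 h
    rw [firstReturn_iterate]
    exact sameCycle_iterate _ _ _
  · intro h
    obtain ⟨i, -, hi⟩ := sameCycle_iff_iterate.1 h
    obtain ⟨j, rfl⟩ := exists_returnTime_eq (d := d) (i := i) (by rw [hi]; exact d'.2)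
    rw [← firstReturn_iterate] at hi
    rw [← Subtype.ext hi]
    exact sameCycle_iterate _ _ _

variable {H : Type*}

/-- The transition functions of the first return map have the same holonomy. -/
theorem hol_firstReturn [Monoid H] (g : D → H) (d : S) :
    hol (ρ.firstReturn S) (fun d => walk ρ g d (ρ.hitTime S (ρ d) + 1)) d = hol ρ g d := by
  have hw : ∀ j, walk (ρ.firstReturn S) (fun d => walk ρ g d (ρ.hitTime S (ρ d) + 1)) d j =
      walk ρ g d (ρ.returnTime S d j) := by
    intro j
    induction j with
    | zero => rfl
    | succ j ih => rw [walk_succ, ih, returnTime, walk_add (ρ.returnTime S d j), ← firstReturn_iterate]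
  have hmono : Monotone (ρ.returnTime S d) := monotone_nat_of_le_succ fun j => by
    rw [returnTime]; omega
  have hfp := (ρ.firstReturn S).minimalPeriod_pos d
  have hpos : 0 < ρ.returnTime S d (minimalPeriod (ρ.firstReturn S) d) := by
    obtain ⟨j, hj⟩ := Nat.exists_eq_succ_of_ne_zero hfp.ne'
    rw [hj, returnTime]; omega
  -- One lap of the first return map takes exactly one lap of `ρ`, so the two products run over the
  -- same factors.
  have hret : ρ.returnTime S d (minimalPeriod (ρ.firstReturn S) d) = minimalPeriod ρ d := by
    refine le_antisymm ?_ ?_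
    · obtain ⟨j, hj⟩ := exists_returnTime_eq (ρ := ρ) (d := d) (i := minimalPeriod ρ d)
        (by rw [iterate_minimalPeriod]; exact d.2)
      rw [← hj]
      refine hmono (IsPeriodicPt.minimalPeriod_le ?_ ?_)
      · rcases Nat.eq_zero_or_pos j with rfl | h
        · have := ρ.minimalPeriod_pos d
          rw [← hj, returnTime] at this
          omega
        · exact h
      · refine Subtype.ext ?_
        rw [firstReturn_iterate, hj, iterate_minimalPeriod]
    · refine IsPeriodicPt.minimalPeriod_le hpos ?_
      rw [IsPeriodicPt, IsFixedPt, ← firstReturn_iterate, iterate_minimalPeriod]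
  rw [hol, hw, hret, hol]

end Equiv.Perm

end

/-! ### Points and identifications in the glued surface. -/

section

open Equiv Equiv.Perm Function Topology

section Simplex

theorem sidePoint_apply_self (i : Fin 3) (t : unitInterval) : (sidePoint i t).1 i = 1 - t := by
  have : i ≠ i + 1 := by decide +revert
  simp [sidePoint, this]

theorem sidePoint_apply_add_one (i : Fin 3) (t : unitInterval) : (sidePoint i t).1 (i + 1) = t := by
  have : i + 1 ≠ i := by decide +revert
  simp [sidePoint, this]

theorem sidePoint_apply_add_two (i : Fin 3) (t : unitInterval) : (sidePoint i t).1 (i + 2) = 0 := by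
  have h1 : i + 2 ≠ i := by decide +revert
  have h2 : i + 2 ≠ i + 1 := by decide +revert
  simp [sidePoint, h1, h2]

theorem sidePoint_one (i : Fin 3) : sidePoint i 1 = sidePoint (i + 1) 0 := by
  refine Subtype.ext ?_
  simp [sidePoint]

theorem Fin.eq_add_three_cases (i j : Fin 3) : j = i ∨ j = i + 1 ∨ j = i + 2 := by
  decide +revert

theorem Fin.add_one_add_two (i : Fin 3) : i + 1 + 2 = i := by
  decide +revert

theorem stdSimplex_sum_three (x : stdSimplex ℝ (Fin 3)) (i : Fin 3) :
    x.1 i + x.1 (i + 1) + x.1 (i + 2) = 1 := by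
  have h := x.2.2
  rw [Fin.sum_univ_three] at h
  fin_cases i
  · exact h
  · change x.1 1 + x.1 2 + x.1 0 = 1
    linarith
  · change x.1 2 + x.1 0 + x.1 1 = 1
    linarith

theorem continuous_sidePoint (i : Fin 3) : Continuous (sidePoint i) := by
  unfold sidePoint
  fun_prop

theorem eq_sidePoint {x : stdSimplex ℝ (Fin 3)} {i : Fin 3} (h : x.1 (i + 2) = 0) :
    x = sidePoint i ⟨x.1 (i + 1), x.2.1 _, by
      have := stdSimplex_sum_three x i
      have := x.2.1 i
      linarith⟩ := by
  refine Subtype.ext (funext fun j => ?_)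
  have := stdSimplex_sum_three x i
  rcases Fin.eq_add_three_cases i j with rfl | rfl | rfl
  · rw [sidePoint_apply_self]
    change _ = 1 - x.1 (j + 1)
    linarith
  · rw [sidePoint_apply_add_one]
  · rw [sidePoint_apply_add_two, h]

/-- Excluding `t = 1` assigns each vertex to the side that starts there, so every boundary point of
the triangle has unique coordinates. -/
theorem sidePoint_inj {i j : Fin 3} {t t' : unitInterval} (ht : t < 1) (ht' : t' < 1)
    (h : sidePoint i t = sidePoint j t') : i = j ∧ t = t' := by
  have hval : ∀ l, (sidePoint i t).1 l = (sidePoint j t').1 l := fun l => by rw [h]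
  have h1 : (t : ℝ) < 1 := ht
  have h2 : (t' : ℝ) < 1 := ht'
  rcases Fin.eq_add_three_cases i j with rfl | rfl | rfl
  · refine ⟨rfl, Subtype.ext ?_⟩
    have := hval (j + 1)
    rwa [sidePoint_apply_add_one, sidePoint_apply_add_one] at this
  · have := hval (i + 1 + 2)
    rw [sidePoint_apply_add_two, Fin.add_one_add_two i, sidePoint_apply_self] at this
    linarith
  · have := hval (i + 2)
    rw [sidePoint_apply_add_two, sidePoint_apply_self] at this
    linarith

end Simplex

namespace TriangleGluing

variable (G : TriangleGluing)

instance : Finite G.Face := G.finite_face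

/-- The gluing as a permutation of the sides. -/
def alpha : Perm (G.Face × Fin 3) := Function.Involutive.toPerm G.glue G.glue_glue

/-- The rotation of the sides of each triangle. -/
def phi : Perm (G.Face × Fin 3) := Equiv.prodCongr (Equiv.refl _) (Equiv.addRight 1)

/-- The rotation around the vertices: a side which is not free is sent to the next side with the
same initial vertex, a free side to the next side of its triangle. -/
def rho : Perm (G.Face × Fin 3) := G.phi * G.alpha

/-- The free sides. -/
def free : Set (G.Face × Fin 3) := {d | G.glue d = d}

variable {G}

theorem alpha_apply (d : G.Face × Fin 3) : G.alpha d = G.glue d := rfl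

theorem rho_apply (d : G.Face × Fin 3) : G.rho d = G.phi (G.glue d) := rfl

theorem mem_free {d : G.Face × Fin 3} : d ∈ G.free ↔ G.glue d = d := Iff.rfl

theorem rho_of_mem_free {d : G.Face × Fin 3} (h : d ∈ G.free) : G.rho d = G.phi d := by
  rw [rho_apply, mem_free.1 h]

/-- The projection to the glued space. -/
def proj (x : G.Pieces) : G.Realization := Quot.mk G.Glued x

theorem isQuotientMap_proj : IsQuotientMap (proj : G.Pieces → G.Realization) := isQuotientMap_quot_mk

theorem side_one (d : G.Face × Fin 3) : G.side d 1 = G.side (G.phi d) 0 := by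
  rw [side, sidePoint_one]
  rfl

theorem continuous_side (d : G.Face × Fin 3) : Continuous (G.side d) :=
  continuous_sigmaMk.comp (continuous_sidePoint d.2)

theorem side_inj {d d' : G.Face × Fin 3} {t t' : unitInterval} (ht : t < 1) (ht' : t' < 1)
    (h : G.side d t = G.side d' t') : d = d' ∧ t = t' := by
  obtain ⟨f, i⟩ := d
  obtain ⟨f', i'⟩ := d'
  have hf : f = f' := congr_arg Sigma.fst h
  subst hf
  have hs : sidePoint i t = sidePoint i' t' := by simpa [side] using h
  obtain ⟨rfl, rfl⟩ := sidePoint_inj ht ht' hs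
  exact ⟨rfl, rfl⟩

theorem side_cases (x : G.Pieces) :
    (∀ i, 0 < x.2.1 i) ∨ ∃ d t, t < 1 ∧ x = G.side d t := by
  by_cases h : ∀ i, 0 < x.2.1 i
  · exact Or.inl h
  push Not at h
  obtain ⟨i, hi⟩ := h
  obtain ⟨f, x⟩ := x
  have h0 : x.1 (i + 1 + 2) = 0 := by
    rw [Fin.add_one_add_two i]
    exact le_antisymm hi (x.2.1 i)
  obtain ⟨t, ht⟩ : ∃ t, x = sidePoint (i + 1) t := ⟨_, eq_sidePoint h0⟩
  right
  rcases lt_or_eq_of_le (unitInterval.le_one' (t := t)) with h | h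
  · exact ⟨(f, i + 1), t, h, by rw [ht]; rfl⟩
  · refine ⟨(f, i + 1 + 1), 0, by simp, ?_⟩
    rw [ht, h, sidePoint_one]
    rfl

theorem proj_side (d : G.Face × Fin 3) (t : unitInterval) (h : d ∉ G.free) :
    proj (G.side d t) = proj (G.side (G.glue d) (unitInterval.symm t)) :=
  Quot.sound (Glued.mk d t h)

/-- The three ways in which points of the triangles can be identified. -/
def Identified (x y : G.Pieces) : Prop :=
  x = y ∨ (∃ d t, 0 < t ∧ t < 1 ∧ d ∉ G.free ∧ x = G.side d t ∧
      y = G.side (G.glue d) (unitInterval.symm t)) ∨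
    ∃ d d', Quot.mk G.CornerGlued d = Quot.mk G.CornerGlued d' ∧ x = G.side d 0 ∧ y = G.side d' 0

theorem glue_notMem_free {d : G.Face × Fin 3} (h : d ∉ G.free) : G.glue d ∉ G.free := by
  intro h'
  rw [mem_free, G.glue_glue] at h'
  exact h h'.symm

theorem symm_pos {t : unitInterval} (h : t < 1) : 0 < unitInterval.symm t := by
  have : (t : ℝ) < 1 := h
  rw [← Subtype.coe_lt_coe]
  simpa using this

theorem symm_lt_one {t : unitInterval} (h : 0 < t) : unitInterval.symm t < 1 := by
  have : (0 : ℝ) < t := h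
  rw [← Subtype.coe_lt_coe]
  simpa using this

theorem Identified.symm {x y : G.Pieces} (h : Identified x y) : Identified y x := by
  rcases h with rfl | ⟨d, t, h0, h1, hd, rfl, rfl⟩ | ⟨d, d', h, rfl, rfl⟩
  · exact Or.inl rfl
  · refine Or.inr (Or.inl ⟨G.glue d, unitInterval.symm t, symm_pos h1, symm_lt_one h0,
      glue_notMem_free hd, rfl, ?_⟩)
    rw [G.glue_glue, unitInterval.symm_symm]
  · exact Or.inr (Or.inr ⟨d', d, h.symm, rfl, rfl⟩)

theorem Identified.trans {x y z : G.Pieces} (h : Identified x y) (h' : Identified y z) :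
    Identified x z := by
  rcases h with rfl | ⟨d, t, h0, h1, hd, rfl, rfl⟩ | ⟨d, d', h, rfl, rfl⟩
  · exact h'
  · rcases h' with rfl | ⟨d', t', h0', h1', hd', he, rfl⟩ | ⟨d', d'', h, he, rfl⟩
    · exact Or.inr (Or.inl ⟨d, t, h0, h1, hd, rfl, rfl⟩)
    · obtain ⟨rfl, rfl⟩ := side_inj (symm_lt_one h0) h1' he
      left
      rw [G.glue_glue, unitInterval.symm_symm]
    · obtain ⟨-, h3⟩ := side_inj (symm_lt_one h0) (by simp) he
      exact absurd h3 (symm_pos h1).ne'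
  · rcases h' with rfl | ⟨e, t', h0', h1', hd', he, rfl⟩ | ⟨e, e', h', he, rfl⟩
    · exact Or.inr (Or.inr ⟨d, d', h, rfl, rfl⟩)
    · obtain ⟨-, h3⟩ := side_inj (by simp) h1' he
      exact absurd h3 h0'.ne
    · obtain ⟨rfl, -⟩ := side_inj (by simp) (by simp) he
      exact Or.inr (Or.inr ⟨d, e', h.trans h', rfl, rfl⟩)

/-- The relation on the right is already an equivalence relation: sides are glued in pairs, so
interior points of sides are identified at most in pairs, and the two endpoints of a glued side give
the generating corner identifications. -/
theorem proj_eq_iff {x y : G.Pieces} : proj x = proj y ↔ Identified x y := by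
  constructor
  · intro h
    have h' := Quot.eqvGen_exact h
    clear h
    induction h' with
    | rel x y h =>
      obtain ⟨d, t, hd⟩ := h
      rcases eq_or_ne t 0 with rfl | h0
      · refine Or.inr (Or.inr ⟨d, G.rho d, Quot.sound (.mk d hd), rfl, ?_⟩)
        rw [unitInterval.symm_zero, side_one, rho_apply]
      rcases eq_or_ne t 1 with rfl | h1
      · refine Or.inr (Or.inr ⟨G.phi d, G.glue d, ?_, side_one d, by rw [unitInterval.symm_one]⟩)
        have := CornerGlued.mk (G.glue d) (glue_notMem_free hd)
        rw [G.glue_glue] at this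
        exact (Quot.sound this).symm
      · exact Or.inr (Or.inl ⟨d, t, unitInterval.pos_iff_ne_zero.2 h0,
          unitInterval.lt_one_iff_ne_one.2 h1, hd, rfl, rfl⟩)
    | refl x => exact Or.inl rfl
    | symm x y _ ih => exact ih.symm
    | trans x y z _ _ ih1 ih2 => exact ih1.trans ih2
  · rintro (rfl | ⟨d, t, -, -, hd, rfl, rfl⟩ | ⟨d, d', h, rfl, rfl⟩)
    · rfl
    · exact proj_side d t hd
    · have hwd : ∀ e e', G.CornerGlued e e' → proj (G.side e 0) = proj (G.side e' 0) := by
        rintro e _ ⟨he⟩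
        rw [proj_side e 0 he, unitInterval.symm_zero, side_one]
        rfl
      exact congr_arg (Quot.lift (fun e => proj (G.side e 0)) hwd) h

theorem cornerGlued_rho {d : G.Face × Fin 3} (h : d ∉ G.free) : G.CornerGlued d (G.rho d) :=
  .mk d h

theorem cornerGlued_iff {d d' : G.Face × Fin 3} :
    G.CornerGlued d d' ↔ d ∉ G.free ∧ d' = G.rho d := by
  constructor
  · rintro ⟨h⟩
    exact ⟨h, rfl⟩
  · rintro ⟨h, rfl⟩
    exact .mk d h

theorem corner_iterate {d : G.Face × Fin 3} {i : ℕ} (h : ∀ j < i, G.rho^[j] d ∉ G.free) :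
    Quot.mk G.CornerGlued (G.rho^[i] d) = Quot.mk G.CornerGlued d := by
  induction i with
  | zero => rfl
  | succ i ih =>
    rw [iterate_succ_apply', ← ih fun j hj => h j (by omega)]
    exact (Quot.sound (cornerGlued_rho (h i (by omega)))).symm

theorem corner_firstHit (d : G.Face × Fin 3) :
    Quot.mk G.CornerGlued (G.rho.firstHit G.free d) = Quot.mk G.CornerGlued d :=
  corner_iterate fun _ hj => iterate_notMem_of_lt_hitTime hj

theorem exists_iterate_rho_mem_iff {d : G.Face × Fin 3} :
    (∃ i, G.rho^[i] (G.rho d) ∈ G.free) ↔ ∃ i, G.rho^[i] d ∈ G.free := by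
  constructor
  · rintro ⟨i, h⟩
    exact ⟨i + 1, by rwa [iterate_succ_apply]⟩
  · rintro ⟨i, h⟩
    refine exists_iterate_mem_of_sameCycle (sameCycle_apply_left.2 (sameCycle_iterate _ d i)) h

/-- Label a corner by the first free side on its `ρ`-orbit, if there is one. Corner identifications
are steps of `ρ` away from free sides and preserve the label, and a free side is its own label. -/
theorem corner_eq_of_mem_free {d d' : G.Face × Fin 3} (hd : d ∈ G.free) (hd' : d' ∈ G.free)
    (h : Quot.mk G.CornerGlued d = Quot.mk G.CornerGlued d') : d = d' := by
  classical
  have hwd : ∀ e e', G.CornerGlued e e' →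
      (if ∃ i, G.rho^[i] e ∈ G.free then some (G.rho.firstHit G.free e) else none) =
        if ∃ i, G.rho^[i] e' ∈ G.free then some (G.rho.firstHit G.free e') else none := by
    intro e e' he
    obtain ⟨he', rfl⟩ := cornerGlued_iff.1 he
    simp only [exists_iterate_rho_mem_iff]
    split_ifs with hex
    · rw [firstHit_apply hex he']
    · rfl
  have := congr_arg (Quot.lift _ hwd) h
  simp only at this
  rw [if_pos ⟨0, hd⟩, if_pos ⟨0, hd'⟩, firstHit_of_mem hd, firstHit_of_mem hd'] at this
  exact Option.some_injective _ this

/-- The saturation of a closed set adds only finitely many continuous images of compact sets and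
finitely many corners. -/
theorem isClosedMap_proj : IsClosedMap (proj : G.Pieces → G.Realization) := by
  intro A hA
  rw [← isQuotientMap_proj.isClosed_preimage]
  have hset : proj ⁻¹' (proj '' A) = A ∪ (⋃ d ∈ {d | d ∉ G.free},
      (fun t => G.side (G.glue d) (unitInterval.symm t)) '' (G.side d ⁻¹' A)) ∪
        (fun d => G.side d 0) '' {d' | ∃ d, Quot.mk G.CornerGlued d = Quot.mk G.CornerGlued d' ∧
          G.side d 0 ∈ A} := by
    ext y
    constructor
    · rintro ⟨x, hx, hxy⟩
      rcases proj_eq_iff.1 hxy with rfl | ⟨d, t, -, -, hd, rfl, rfl⟩ | ⟨d, d', h, rfl, rfl⟩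
      · exact Or.inl (Or.inl hx)
      · exact Or.inl (Or.inr (Set.mem_biUnion (x := d) hd ⟨t, hx, rfl⟩))
      · exact Or.inr ⟨d', ⟨d, h, hx⟩, rfl⟩
    · rintro ((hy | hy) | ⟨d', ⟨d, h, hx⟩, rfl⟩)
      · exact ⟨y, hy, rfl⟩
      · obtain ⟨d, hd, t, ht, rfl⟩ := Set.mem_iUnion₂.1 hy
        exact ⟨_, ht, proj_side d t hd⟩
      · exact ⟨_, hx, proj_eq_iff.2 (Or.inr (Or.inr ⟨d, d', h, rfl, rfl⟩))⟩
  rw [hset]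
  refine (hA.union ?_).union ((Set.toFinite _).image _).isClosed
  refine (Set.toFinite _).isClosed_biUnion fun d _ => ?_
  refine (((hA.preimage (continuous_side d)).isCompact).image ?_).isClosed
  exact (continuous_side _).comp unitInterval.continuous_symm

/-- Distinct fibres are disjoint closed sets in a normal space; images of the complements of
separating open sets are closed, and their complements separate the points. -/
instance : T2Space G.Realization := by
  have hsing : ∀ y : G.Realization, IsClosed ({y} : Set G.Realization) := fun y => by
    obtain ⟨x, rfl⟩ := isQuotientMap_proj.surjective y
    rw [← Set.image_singleton]
    exact isClosedMap_proj _ isClosed_singleton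
  refine ⟨fun y y' hyy' => ?_⟩
  have hdisj : Disjoint ((proj : G.Pieces → G.Realization) ⁻¹' {y}) (proj ⁻¹' {y'}) :=
    Disjoint.preimage _ (by simpa using hyy')
  obtain ⟨U, V, hU, hV, hyU, hyV, hUV⟩ := normal_separation
    ((hsing y).preimage isQuotientMap_proj.continuous)
    ((hsing y').preimage isQuotientMap_proj.continuous) hdisj
  refine ⟨(proj '' Uᶜ)ᶜ, (proj '' Vᶜ)ᶜ, (isClosedMap_proj _ hU.isClosed_compl).isOpen_compl,
    (isClosedMap_proj _ hV.isClosed_compl).isOpen_compl, ?_, ?_, ?_⟩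
  · rintro ⟨x, hx, rfl⟩
    exact hx (hyU rfl)
  · rintro ⟨x, hx, rfl⟩
    exact hx (hyV rfl)
  · rw [Set.disjoint_left]
    intro z hz hz'
    obtain ⟨x, rfl⟩ := isQuotientMap_proj.surjective z
    have h1 : x ∈ U := by by_contra h; exact hz ⟨x, h, rfl⟩
    have h2 : x ∈ V := by by_contra h; exact hz' ⟨x, h, rfl⟩
    exact Set.disjoint_left.1 hUV h1 h2

/-- The boundary as a union of circles. -/
noncomputable def boundaryComplex : CircleComplex G.boundary G.free where
  next := G.rho.firstReturn G.free
  arc d := ⟨fun t => ⟨proj (G.side d t), d, t, d.2, rfl⟩,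
    (isQuotientMap_proj.continuous.comp (continuous_side _)).subtype_mk _⟩
  arc_one d := by
    refine Subtype.ext ?_
    change proj (G.side d 1) = proj (G.side (G.rho.firstReturn G.free d) 0)
    -- The end of a free side `d` is the corner `φ d = ρ d`. Turning around that vertex by `ρ` leads
    -- to the next free side.
    refine proj_eq_iff.2 (Or.inr (Or.inr ⟨G.phi d, _, ?_, side_one _, rfl⟩))
    rw [← rho_of_mem_free d.2, ← corner_firstHit]
    rfl
  exists_arc := by
    rintro ⟨x, d, t, hd, rfl⟩
    exact ⟨⟨d, hd⟩, t, rfl⟩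
  arc_inj := by
    intro d d' t t' ht ht' h
    have h' : proj (G.side d t) = proj (G.side d' t') := congr_arg Subtype.val h
    rcases proj_eq_iff.1 h' with h | ⟨e, s, -, h1, he, hs, -⟩ | ⟨e, e', hee, h1, h2⟩
    · obtain ⟨h1, h2⟩ := side_inj ht ht' h
      exact ⟨Subtype.ext h1, h2⟩
    · exact absurd ((side_inj ht h1 hs).1 ▸ d.2) he
    · obtain ⟨rfl, rfl⟩ := side_inj ht (by simp) h1
      obtain ⟨rfl, rfl⟩ := side_inj ht' (by simp) h2
      exact ⟨Subtype.ext (corner_eq_of_mem_free d.2 d'.2 hee), rfl⟩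

end TriangleGluing

end

/-! ### The space glued from copies of the triangles, and its local trivializations. -/

section

open Equiv Equiv.Perm Function Topology

namespace TriangleGluing

variable {G : TriangleGluing} {n : ℕ} {g : G.Face × Fin 3 → Perm (Fin n)}

/-- The identifications of the points of `n` copies of each triangle prescribed by `g`. -/
inductive CoverGlued (g : G.Face × Fin 3 → Perm (Fin n)) : G.Pieces × Fin n → G.Pieces × Fin n → Prop
  | mk (d : G.Face × Fin 3) (t : unitInterval) (h : d ∉ G.free) (s : Fin n) :
      CoverGlued g (G.side d t, s) (G.side (G.glue d) (unitInterval.symm t), g d s)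

/-- The space glued from `n` copies of each triangle. -/
def CoverSpace (g : G.Face × Fin 3 → Perm (Fin n)) : Type := Quot (CoverGlued g)

instance : TopologicalSpace (CoverSpace g) := inferInstanceAs (TopologicalSpace (Quot (CoverGlued g)))

/-- The projection of the copies of the triangles to the glued space. -/
def coverProj (g : G.Face × Fin 3 → Perm (Fin n)) (x : G.Pieces × Fin n) : CoverSpace g :=
  Quot.mk _ x

theorem isQuotientMap_coverProj : IsQuotientMap (coverProj g) := isQuotientMap_quot_mk

theorem coverProj_side {d : G.Face × Fin 3} (h : d ∉ G.free) (t : unitInterval) (s : Fin n) :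
    coverProj g (G.side d t, s) =
      coverProj g (G.side (G.glue d) (unitInterval.symm t), g d s) :=
  Quot.sound (.mk d t h s)

/-- The map that forgets the number of the copy. -/
def coverMap (g : G.Face × Fin 3 → Perm (Fin n)) : CoverSpace g → G.Realization :=
  Quot.lift (fun x => proj x.1) (by rintro _ _ ⟨d, t, h, s⟩; exact proj_side d t h)

theorem continuous_coverMap : Continuous (coverMap g) :=
  isQuotientMap_coverProj.continuous_iff.2 (isQuotientMap_proj.continuous.comp continuous_fst)

/-- A family of disjoint open sets in the triangles on which the gluing of the copies can be
trivialized by renumbering the copies. -/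
structure TrivializingFamily (g : G.Face × Fin 3 → Perm (Fin n)) (ι : Type*) where
  set : ι → Set G.Pieces
  isOpen : ∀ l, IsOpen (set l)
  disj : ∀ {l l' x}, x ∈ set l → x ∈ set l' → l = l'
  num : ι → Perm (Fin n)
  compat : ∀ l d t, d ∉ G.free → G.side d t ∈ set l →
    ∃ l', G.side (G.glue d) (unitInterval.symm t) ∈ set l' ∧ num l' * g d = num l

namespace TrivializingFamily

variable {ι : Type*} (W : TrivializingFamily g ι)

open Classical in
/-- The index of the set to which a point belongs. -/
noncomputable def label (x : G.Pieces) : Option ι :=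
  if h : ∃ l, x ∈ W.set l then some h.choose else none

theorem label_eq_some_iff {x : G.Pieces} {l : ι} : W.label x = some l ↔ x ∈ W.set l := by
  unfold label
  split_ifs with h
  · rw [Option.some_inj]
    exact ⟨fun hl => hl ▸ h.choose_spec, fun hl => W.disj h.choose_spec hl⟩
  · exact ⟨fun h => by simp at h, fun hl => absurd ⟨l, hl⟩ h⟩

theorem label_eq_none_iff {x : G.Pieces} : W.label x = none ↔ ∀ l, x ∉ W.set l := by
  rw [Option.eq_none_iff_forall_not_mem]
  exact forall_congr' fun l => not_congr W.label_eq_some_iff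

/-- `compat` transfers membership in one direction only; applied to the opposite side it shows that
unlabelled points are glued to unlabelled ones. -/
theorem label_side (d : G.Face × Fin 3) (t : unitInterval) (h : d ∉ G.free) :
    (∃ l l', W.label (G.side d t) = some l ∧
      W.label (G.side (G.glue d) (unitInterval.symm t)) = some l' ∧ W.num l' * g d = W.num l) ∨
    (W.label (G.side d t) = none ∧ W.label (G.side (G.glue d) (unitInterval.symm t)) = none) := by
  by_cases hd : ∃ l, G.side d t ∈ W.set l
  · obtain ⟨l, hl⟩ := hd
    obtain ⟨l', hl', hnum⟩ := W.compat l d t h hl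
    exact Or.inl ⟨l, l', W.label_eq_some_iff.2 hl, W.label_eq_some_iff.2 hl', hnum⟩
  · push Not at hd
    refine Or.inr ⟨W.label_eq_none_iff.2 hd, W.label_eq_none_iff.2 fun l hl => ?_⟩
    obtain ⟨l', hl', -⟩ := W.compat l _ _ (glue_notMem_free h) hl
    rw [G.glue_glue, unitInterval.symm_symm] at hl'
    exact hd l' hl'

/-- The new number of the copy. -/
noncomputable def color : CoverSpace g → Option (Fin n) :=
  Quot.lift (fun x => (W.label x.1).map fun l => W.num l x.2) (by
    rintro _ _ ⟨d, t, h, s⟩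
    rcases W.label_side d t h with ⟨l, l', h1, h2, h3⟩ | ⟨h1, h2⟩
    · simp only [h1, h2, Option.map_some, ← h3, mul_apply]
    · simp only [h1, h2, Option.map_none])

theorem color_coverProj (x : G.Pieces × Fin n) :
    W.color (coverProj g x) = (W.label x.1).map fun l => W.num l x.2 := rfl

/-- The copy with new number `s`. -/
noncomputable def sheet (s : Fin n) : G.Realization → Option (CoverSpace g) :=
  Quot.lift (fun x => (W.label x).map fun l => coverProj g (x, (W.num l)⁻¹ s)) (by
    rintro _ _ ⟨d, t, h⟩
    rcases W.label_side d t h with ⟨l, l', h1, h2, h3⟩ | ⟨h1, h2⟩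
    · simp only [h1, h2, Option.map_some, ← h3, mul_inv_rev, mul_apply]
      rw [coverProj_side h, Perm.inv_def (g d), Equiv.apply_symm_apply]
    · simp only [h1, h2, Option.map_none])

theorem sheet_proj (s : Fin n) (x : G.Pieces) :
    W.sheet s (proj x) = (W.label x).map fun l => coverProj g (x, (W.num l)⁻¹ s) := rfl

/-- The part of the glued space over which the family trivializes. -/
def base : Set G.Realization := proj '' ⋃ l, W.set l

theorem proj_mem_base_iff {x : G.Pieces} : proj x ∈ W.base ↔ ∃ l, x ∈ W.set l := by
  constructor
  · rintro ⟨y, hy, hxy⟩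
    rw [Set.mem_iUnion] at hy
    have hwd : ∀ x y, G.Glued x y → (W.label x).isSome = (W.label y).isSome := by
      rintro _ _ ⟨d, t, h⟩
      rcases W.label_side d t h with ⟨l, l', h1, h2, -⟩ | ⟨h1, h2⟩ <;> simp [h1, h2]
    have := congr_arg (Quot.lift _ hwd) hxy
    change (W.label y).isSome = (W.label x).isSome at this
    obtain ⟨l, hl⟩ := hy
    rw [W.label_eq_some_iff.2 hl] at this
    obtain ⟨l', hl'⟩ := Option.isSome_iff_exists.1 this.symm
    exact ⟨l', W.label_eq_some_iff.1 hl'⟩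
  · rintro h
    exact ⟨x, Set.mem_iUnion.2 h, rfl⟩

theorem isOpen_base : IsOpen W.base := by
  rw [← isQuotientMap_proj.isOpen_preimage]
  have : (proj ⁻¹' W.base : Set G.Pieces) = ⋃ l, W.set l := by
    ext x
    rw [Set.mem_preimage, proj_mem_base_iff, Set.mem_iUnion]
  rw [this]
  exact isOpen_iUnion W.isOpen

/-- The trivialization sends a point to its image and its `color`, with inverse given by `sheet`.
Continuity both ways is checked on the triangles, where the sets of the family are open and the
renumbering is constant on each. -/
theorem isEvenlyCovered {x : G.Realization} (hx : x ∈ W.base) :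
    IsEvenlyCovered (coverMap g) x (Fin n) := by
  have hcol : ∀ y : coverMap g ⁻¹' W.base, ∃ k, W.color y = some k := by
    rintro ⟨y, hy⟩
    obtain ⟨⟨x, s⟩, rfl⟩ := isQuotientMap_coverProj.surjective y
    obtain ⟨l, hl⟩ := W.proj_mem_base_iff.1 hy
    exact ⟨W.num l s, by rw [color_coverProj, W.label_eq_some_iff.2 hl]; rfl⟩
  have hsheet : ∀ (u : W.base) (s : Fin n), ∃ z, W.sheet s u = some z ∧ coverMap g z = u ∧
      W.color z = some s := by
    rintro ⟨u, hu⟩ s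
    obtain ⟨x, rfl⟩ := isQuotientMap_proj.surjective u
    obtain ⟨l, hl⟩ := W.proj_mem_base_iff.1 hu
    refine ⟨coverProj g (x, (W.num l)⁻¹ s), ?_, rfl, ?_⟩
    · rw [sheet_proj, W.label_eq_some_iff.2 hl]; rfl
    · rw [color_coverProj, W.label_eq_some_iff.2 hl]
      simp
  choose col hcol using hcol
  choose lift hlift1 hlift2 hlift3 using hsheet
  have hinv : ∀ (u : W.base) (y : CoverSpace g) (s : Fin n), coverMap g y = u →
      W.color y = some s → lift u s = y := by
    rintro ⟨u, hu⟩ y s hy hs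
    obtain ⟨⟨x, s'⟩, rfl⟩ := isQuotientMap_coverProj.surjective y
    obtain rfl : proj x = u := hy
    obtain ⟨l, hl⟩ := W.proj_mem_base_iff.1 hu
    have h1 := hlift1 ⟨proj x, hu⟩ s
    rw [sheet_proj, W.label_eq_some_iff.2 hl, Option.map_some, Option.some_inj] at h1
    rw [color_coverProj, W.label_eq_some_iff.2 hl, Option.map_some, Option.some_inj] at hs
    rw [← h1, ← hs, Perm.inv_def, Equiv.symm_apply_apply]
  refine ⟨inferInstance, W.base, hx, W.isOpen_base,
    W.isOpen_base.preimage continuous_coverMap, ⟨⟨⟨fun y => (⟨coverMap g y, y.2⟩, col y),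
      fun z => ⟨lift z.1 z.2, by rw [Set.mem_preimage, hlift2]; exact z.1.2⟩, fun y => ?_,
      fun z => ?_⟩, ?_, ?_⟩, fun y => rfl⟩⟩
  · exact Subtype.ext (hinv _ _ _ rfl (hcol y))
  · refine Prod.ext (Subtype.ext (hlift2 _ _)) ?_
    have h1 := hcol ⟨lift z.1 z.2, by rw [Set.mem_preimage, hlift2]; exact z.1.2⟩
    rw [hlift3, Option.some_inj] at h1
    exact h1.symm
  · refine Continuous.prodMk ((continuous_coverMap.comp continuous_subtype_val).subtype_mk _) ?_
    rw [continuous_discrete_rng]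
    intro k
    have h1 : IsOpen {y : CoverSpace g | W.color y = some k} := by
      rw [← isQuotientMap_coverProj.isOpen_preimage]
      have : coverProj g ⁻¹' {y : CoverSpace g | W.color y = some k} =
          ⋃ l, W.set l ×ˢ {s | W.num l s = k} := by
        ext ⟨x, s⟩
        simp only [Set.mem_preimage, Set.mem_ofPred_eq, color_coverProj, Option.map_eq_some_iff,
          label_eq_some_iff, Set.mem_iUnion, Set.mem_prod]
      rw [this]
      exact isOpen_iUnion fun l => (W.isOpen l).prod (isOpen_discrete _)
    have h2 : col ⁻¹' {k} = Subtype.val ⁻¹' {y : CoverSpace g | W.color y = some k} := by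
      ext y
      simp [hcol]
    rw [h2]
    exact h1.preimage continuous_subtype_val
  · refine Continuous.subtype_mk ?_ _
    rw [continuous_prod_of_discrete_right]
    intro s
    refine continuous_def.2 fun O hO => ?_
    have h1 : IsOpen {u | ∃ z ∈ O, W.sheet s u = some z} := by
      rw [← isQuotientMap_proj.isOpen_preimage]
      have : (proj ⁻¹' {u | ∃ z ∈ O, W.sheet s u = some z} : Set G.Pieces) =
          ⋃ l, W.set l ∩ (fun x => coverProj g (x, (W.num l)⁻¹ s)) ⁻¹' O := by
        ext x
        simp only [Set.mem_preimage, Set.mem_ofPred_eq, sheet_proj, Option.map_eq_some_iff,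
          label_eq_some_iff, Set.mem_iUnion, Set.mem_inter_iff]
        constructor
        · rintro ⟨_, hz, l, hl, rfl⟩
          exact ⟨l, hl, hz⟩
        · rintro ⟨l, hl, hz⟩
          exact ⟨_, hz, l, hl, rfl⟩
      rw [this]
      refine isOpen_iUnion fun l => (W.isOpen l).inter (hO.preimage ?_)
      exact isQuotientMap_coverProj.continuous.comp (Continuous.prodMk_left _)
    have h2 : (fun u => lift u s) ⁻¹' O = Subtype.val ⁻¹' {u | ∃ z ∈ O, W.sheet s u = some z} := by
      ext u
      simp [hlift1]
    rw [h2]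
    exact h1.preimage continuous_subtype_val

theorem eq_of_coverProj_eq {x : G.Pieces} {l : ι} (hx : x ∈ W.set l) {s s' : Fin n}
    (h : coverProj g (x, s) = coverProj g (x, s')) : s = s' := by
  have := congr_arg W.color h
  rw [color_coverProj, color_coverProj, W.label_eq_some_iff.2 hx, Option.map_some, Option.map_some,
    Option.some_inj] at this
  exact (W.num l).injective this

end TrivializingFamily

end TriangleGluing

end

/-! ### Trivial holonomy at interior vertices yields a covering. -/

section

open Equiv Equiv.Perm Function Topology

/-- Transition functions whose holonomy is trivial around the cycles that avoid `S` become trivial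
outside `S` after a gauge transformation. -/
theorem Equiv.Perm.exists_gauge_eq_one {D H : Type*} [Finite D] [Group H] (ρ : Perm D) (S : Set D)
    (g : D → H) (h : ∀ d, (∀ i, ρ^[i] d ∉ S) → hol ρ g d = 1) :
    ∃ u : D → H, ∀ d, d ∉ S → u (ρ d) * g d = u d := by
  classical
  -- On `S` the value is replaced by the inverse of the product accumulated up to the next visit to
  -- `S`. This kills the holonomy of every cycle that meets `S` and changes nothing outside `S`.
  set g' : D → H := fun d => if d ∈ S then (walk ρ g (ρ d) (ρ.hitTime S (ρ d)))⁻¹ else g d with hg'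
  have hmem : ∀ d ∈ S, hol ρ g' d = 1 := by
    intro d hd
    rw [← hol_firstReturn g' (⟨d, hd⟩ : S), hol]
    refine walk_eq_one fun j _ => ?_
    rw [walk_succ', walk_congr (g' := g) (f' := ρ)
      (d' := ρ ((ρ.firstReturn S)^[j] ⟨d, hd⟩).1)]
    · simp [hg', Subtype.prop]
    · intro j hj
      simp only [hg', if_neg (iterate_notMem_of_lt_hitTime hj)]
  have hone : ∀ d, holClass ρ g' d = holClass ρ (fun _ => 1) d := by
    intro d
    have h1 : hol ρ (fun _ : D => (1 : H)) d = 1 := walk_eq_one fun _ _ => rfl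
    rw [holClass, holClass, h1]
    by_cases hd : ∃ i, ρ^[i] d ∈ S
    · obtain ⟨i, hi⟩ := hd
      have := holClass_eq_of_sameCycle (g := g') (sameCycle_iterate ρ d i)
      rw [holClass, holClass, hmem _ hi] at this
      exact this
    · push Not at hd
      rw [← h d hd]
      congr 1
      refine walk_congr fun j _ => ?_
      simp only [hg', if_neg (hd j)]
  obtain ⟨u, hu⟩ := exists_gauge_of_holClass_eq ρ hone
  refine ⟨u, fun d hd => ?_⟩
  have := hu d
  simpa only [hg', if_neg hd, one_mul] using this

theorem Fin.add_one_add_one (i : Fin 3) : i + 1 + 1 = i + 2 := by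
  decide +revert

theorem Fin.add_two_add_two (i : Fin 3) : i + 2 + 2 = i + 1 := by
  decide +revert

namespace TriangleGluing

variable {G : TriangleGluing} {n : ℕ} {g : G.Face × Fin 3 → Perm (Fin n)}

theorem continuous_coord (i : Fin 3) : Continuous fun x : G.Pieces => x.2.1 i :=
  continuous_sigma fun _ => (continuous_apply i).comp continuous_subtype_val

theorem isOpen_face (f : G.Face) : IsOpen {x : G.Pieces | x.1 = f} := by
  have : {x : G.Pieces | x.1 = f} = Set.range (Sigma.mk f) := by
    ext ⟨f', x⟩
    constructor
    · rintro rfl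
      exact ⟨x, rfl⟩
    · rintro ⟨y, hy⟩
      exact (congr_arg Sigma.fst hy).symm
  rw [this]
  exact isOpen_range_sigmaMk

/-- The interiors of the triangles. -/
def interiorFamily (g : G.Face × Fin 3 → Perm (Fin n)) : TrivializingFamily g G.Face where
  set f := {x | x.1 = f} ∩ ⋂ i, {x | 0 < x.2.1 i}
  isOpen f := (isOpen_face f).inter
    (isOpen_iInter_of_finite fun i => isOpen_lt continuous_const (continuous_coord i))
  disj h h' := h.1.symm.trans h'.1
  num _ := 1
  compat l d t _ h := by
    have h1 : 0 < (sidePoint d.2 t).1 (d.2 + 2) := Set.mem_iInter.1 h.2 (d.2 + 2)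
    rw [sidePoint_apply_add_two] at h1
    exact absurd h1 (lt_irrefl _)

/-- The points of a triangle near the interior of a side. -/
def nearSide (e : G.Face × Fin 3) : Set G.Pieces :=
  {x | x.1 = e.1} ∩ ({x | x.2.1 (e.2 + 2) < x.2.1 e.2} ∩ {x | x.2.1 (e.2 + 2) < x.2.1 (e.2 + 1)})

theorem isOpen_nearSide (e : G.Face × Fin 3) : IsOpen (nearSide e) :=
  (isOpen_face _).inter ((isOpen_lt (continuous_coord _) (continuous_coord _)).inter
    (isOpen_lt (continuous_coord _) (continuous_coord _)))

/-- The coordinate opposite to the side is strictly the smallest of the three, and this determines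
the side. -/
theorem eq_of_mem_nearSide {e e' : G.Face × Fin 3} {x : G.Pieces} (h : x ∈ nearSide e)
    (h' : x ∈ nearSide e') : e = e' := by
  obtain ⟨f, i⟩ := e
  obtain ⟨f', i'⟩ := e'
  obtain ⟨rfl, h1, h2⟩ := h
  obtain ⟨rfl, h3, h4⟩ := h'
  simp only [Set.mem_ofPred_eq] at h1 h2 h3 h4
  rcases Fin.eq_add_three_cases i i' with rfl | rfl | rfl
  · rfl
  · rw [Fin.add_one_add_two] at h3 h4
    rw [Fin.add_one_add_one] at h4
    exact absurd h4 h1.not_gt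
  · rw [Fin.add_two_add_two] at h3
    exact absurd h3 h2.not_gt

theorem side_mem_nearSide {d : G.Face × Fin 3} {t : unitInterval} :
    G.side d t ∈ nearSide d ↔ 0 < t ∧ t < 1 := by
  change _ ∧ (sidePoint d.2 t).1 (d.2 + 2) < (sidePoint d.2 t).1 d.2 ∧
    (sidePoint d.2 t).1 (d.2 + 2) < (sidePoint d.2 t).1 (d.2 + 1) ↔ _
  rw [sidePoint_apply_add_two, sidePoint_apply_self, sidePoint_apply_add_one, sub_pos, and_comm,
    and_comm (a := (t : ℝ) < 1)]
  exact and_iff_left rfl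

theorem eq_of_side_mem_nearSide {d e : G.Face × Fin 3} {t : unitInterval}
    (h : G.side d t ∈ nearSide e) : d = e := by
  obtain ⟨f, i⟩ := d
  obtain ⟨f', i'⟩ := e
  obtain ⟨h0, h1, h2⟩ := h
  obtain rfl : f = f' := h0
  change (sidePoint i t).1 (i' + 2) < (sidePoint i t).1 i' at h1
  change (sidePoint i t).1 (i' + 2) < (sidePoint i t).1 (i' + 1) at h2
  have hn := (sidePoint i t).2.1 (i' + 2)
  rcases Fin.eq_add_three_cases i i' with rfl | rfl | rfl
  · rfl
  · rw [Fin.add_one_add_one, sidePoint_apply_add_two] at h2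
    exact absurd (hn.trans_lt h2) (lt_irrefl _)
  · rw [sidePoint_apply_add_two] at h1
    exact absurd (hn.trans_lt h1) (lt_irrefl _)

open Classical in
/-- A neighbourhood of the interior of a side. -/
noncomputable def sideFamily (hg : IsCocycle G.alpha g) (d : G.Face × Fin 3) :
    TrivializingFamily g {e // e = d ∨ e = G.glue d} where
  set e := nearSide e.1
  isOpen e := isOpen_nearSide e.1
  disj h h' := Subtype.ext (eq_of_mem_nearSide h h')
  -- The copies along `d` keep their numbers, and those along the partner are renumbered by the
  -- transition back to `d`.
  num e := if e.1 = d then 1 else g e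
  compat := by
    rintro ⟨e, he⟩ d' t hd' h
    obtain rfl := eq_of_side_mem_nearSide h
    have h1 := side_mem_nearSide.1 h
    refine ⟨⟨G.glue d', ?_⟩, side_mem_nearSide.2 ⟨symm_pos h1.2, symm_lt_one h1.1⟩, ?_⟩
    · rcases he with rfl | rfl
      · exact Or.inr rfl
      · exact Or.inl (G.glue_glue d)
    · rcases he with rfl | rfl
      · rw [if_pos rfl]
        exact (congr_arg (· * _) (if_neg hd')).trans (hg.1 _)
      · have h2 : G.glue d ≠ d := fun h2 => hd' (by rw [mem_free, G.glue_glue, h2])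
        rw [if_neg h2, if_pos (G.glue_glue d), one_mul]

theorem side_mem_corner {d e : G.Face × Fin 3} {t : unitInterval} (h1 : (G.side d t).1 = e.1)
    (h2 : 1 / 2 < (G.side d t).2.1 e.2) : (e = d ∧ (t : ℝ) < 1 / 2) ∨ (e = G.phi d ∧ 1 / 2 < (t : ℝ)) := by
  obtain ⟨f, i⟩ := d
  obtain ⟨f', i'⟩ := e
  obtain rfl : f = f' := h1
  change 1 / 2 < (sidePoint i t).1 i' at h2
  rcases Fin.eq_add_three_cases i i' with rfl | rfl | rfl
  · rw [sidePoint_apply_self] at h2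
    exact Or.inl ⟨rfl, by linarith⟩
  · rw [sidePoint_apply_add_one] at h2
    exact Or.inr ⟨rfl, h2⟩
  · rw [sidePoint_apply_add_two] at h2
    norm_num at h2

/-- Neighbourhoods of the vertices. -/
noncomputable def cornerFamily (hg : IsCocycle G.alpha g) (u : G.Face × Fin 3 → Perm (Fin n))
    (hu : ∀ d, d ∉ G.free → u (G.rho d) * g d = u d) :
    TrivializingFamily g (G.Face × Fin 3) where
  -- Two coordinates with sum at most `1` cannot both exceed `1 / 2`, so the corners of a triangle
  -- stay disjoint; the bound is compatible with reversing the parameter of a side.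
  set e := {x | x.1 = e.1} ∩ {x | 1 / 2 < x.2.1 e.2}
  isOpen e := (isOpen_face _).inter (isOpen_lt continuous_const (continuous_coord _))
  disj := by
    rintro ⟨f, i⟩ ⟨f', i'⟩ x ⟨rfl, h1⟩ ⟨rfl, h2⟩
    simp only [Set.mem_ofPred_eq] at h1 h2
    have h3 := stdSimplex_sum_three x.2 i
    have h4 := x.2.2.1 (i + 1)
    have h5 := x.2.2.1 (i + 2)
    rcases Fin.eq_add_three_cases i i' with rfl | rfl | rfl
    · rfl
    · linarith
    · linarith
  -- The gauge `u` makes the transition functions trivial around the vertices. The relation at `d`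
  -- handles the initial end of the side, the relation at `glue d` the other end.
  num := u
  compat := by
    rintro e d t hd ⟨h1, h2⟩
    rcases side_mem_corner h1 h2 with ⟨rfl, ht⟩ | ⟨rfl, ht⟩
    · refine ⟨G.rho e, ⟨rfl, ?_⟩, hu e hd⟩
      change 1 / 2 < (sidePoint (G.glue e).2 (unitInterval.symm t)).1 ((G.glue e).2 + 1)
      rw [sidePoint_apply_add_one, unitInterval.coe_symm_eq]
      linarith
    · refine ⟨G.glue d, ⟨rfl, ?_⟩, ?_⟩
      · change 1 / 2 < (sidePoint (G.glue d).2 (unitInterval.symm t)).1 (G.glue d).2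
        rw [sidePoint_apply_self, unitInterval.coe_symm_eq]
        linarith
      · have h3 := hu (G.glue d) (glue_notMem_free hd)
        rw [rho_apply, G.glue_glue] at h3
        rw [← h3, mul_assoc]
        have h4 : g (G.glue d) * g d = 1 := hg.1 d
        rw [h4, mul_one]

/-- Every point of the triangles lies in a set of one of the families. -/
theorem exists_trivializingFamily (hg : IsCocycle G.alpha g)
    (h : ∀ d, (∀ i, G.rho^[i] d ∉ G.free) → hol G.rho g d = 1) (x : G.Pieces) :
    ∃ (ι : Type) (W : TrivializingFamily g ι) (l : ι), x ∈ W.set l := by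
  obtain ⟨u, hu⟩ := G.rho.exists_gauge_eq_one G.free g h
  rcases side_cases x with hx | ⟨d, t, ht, rfl⟩
  · exact ⟨_, interiorFamily g, x.1, rfl, Set.mem_iInter.2 hx⟩
  rcases eq_or_ne t 0 with rfl | h0
  · refine ⟨_, cornerFamily hg u hu, d, rfl, ?_⟩
    change 1 / 2 < (sidePoint d.2 0).1 d.2
    rw [sidePoint_apply_self]
    norm_num
  · exact ⟨_, sideFamily hg d, ⟨d, Or.inl rfl⟩,
      (side_mem_nearSide (d := d)).2 ⟨unitInterval.pos_iff_ne_zero.2 h0, ht⟩⟩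

theorem isCoveringMap_coverMap (hg : IsCocycle G.alpha g)
    (h : ∀ d, (∀ i, G.rho^[i] d ∉ G.free) → hol G.rho g d = 1) : IsCoveringMap (coverMap g) := by
  intro x
  obtain ⟨x, rfl⟩ := isQuotientMap_proj.surjective x
  obtain ⟨ι, W, l, hl⟩ := exists_trivializingFamily hg h x
  exact (W.isEvenlyCovered (W.proj_mem_base_iff.2 ⟨l, hl⟩)).to_isEvenlyCovered_preimage

theorem coverProj_inj (hg : IsCocycle G.alpha g)
    (h : ∀ d, (∀ i, G.rho^[i] d ∉ G.free) → hol G.rho g d = 1) {x : G.Pieces} {s s' : Fin n}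
    (hs : coverProj g (x, s) = coverProj g (x, s')) : s = s' := by
  obtain ⟨ι, W, l, hl⟩ := exists_trivializingFamily hg h x
  exact W.eq_of_coverProj_eq hl hs

/-- The copies of a point exhaust its fibre. -/
theorem exists_coverProj_eq (x : G.Pieces) (y : CoverSpace g) (h : coverMap g y = proj x) :
    ∃ s, coverProj g (x, s) = y := by
  obtain ⟨⟨x', s⟩, rfl⟩ := isQuotientMap_coverProj.surjective y
  have hwd : ∀ x x', G.Glued x x' → (Set.range fun s => coverProj g (x, s)) =
      Set.range fun s => coverProj g (x', s) := by
    rintro _ _ ⟨d, t, hd⟩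
    rw [← (g d).surjective.range_comp
      fun s => coverProj g (G.side (G.glue d) (unitInterval.symm t), s)]
    exact congr_arg Set.range (funext fun s => coverProj_side hd t s)
  have h1 := congr_arg (Quot.lift _ hwd) h
  have h2 : coverProj g (x', s) ∈ Set.range fun s => coverProj g (x', s) := ⟨s, rfl⟩
  exact (congr_arg (coverProj g (x', s) ∈ ·) h1).mp h2

end TriangleGluing

end

/-! ### Numbered sheets of a covering of the surface. -/

section

open Equiv Equiv.Perm Function Topology

namespace OrientedTriangulation

variable {S S' : Type*} [TopologicalSpace S] [TopologicalSpace S'] (T : OrientedTriangulation S)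

/-- The identification of the boundary with that of the glued space. -/
noncomputable def boundaryHomeo : T.gluing.boundary ≃ₜ T.boundary := T.homeo.image T.gluing.boundary

/-- The boundary as a union of circles. -/
noncomputable def boundaryComplex : CircleComplex T.boundary T.gluing.free where
  next := T.gluing.boundaryComplex.next
  arc d := ⟨fun t => T.boundaryHomeo (T.gluing.boundaryComplex.arc d t),
    T.boundaryHomeo.continuous.comp (T.gluing.boundaryComplex.arc d).continuous⟩
  arc_one d := congr_arg T.boundaryHomeo (T.gluing.boundaryComplex.arc_one d)
  exists_arc y := by
    obtain ⟨d, t, h⟩ := T.gluing.boundaryComplex.exists_arc (T.boundaryHomeo.symm y)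
    exact ⟨d, t, (congr_arg T.boundaryHomeo h).trans (T.boundaryHomeo.apply_symm_apply y)⟩
  arc_inj _ _ _ _ ht ht' h := T.gluing.boundaryComplex.arc_inj _ _ _ _ ht ht'
    (T.boundaryHomeo.injective h)

theorem t2Space (T : OrientedTriangulation S) : T2Space S := T.homeo.symm.isEmbedding.t2Space

/-- Numberings by `Fin n` of the sheets of a space over `S` over each triangle, which change by `g`
across the sides of the triangles. -/
structure SheetSystem (P : S' → S) {n : ℕ} (g : T.gluing.Face × Fin 3 → Perm (Fin n)) where
  lift : Fin n → C(T.gluing.Pieces, S')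
  proj : ∀ s x, P (lift s x) = T.homeo (TriangleGluing.proj x)
  lift_inj : ∀ x s s', lift s x = lift s' x → s = s'
  exists_lift : ∀ x y, P y = T.homeo (TriangleGluing.proj x) → ∃ s, lift s x = y
  lift_side : ∀ d t s, d ∉ T.gluing.free → lift s (T.gluing.side d t) =
    lift (g d s) (T.gluing.side (T.gluing.glue d) (unitInterval.symm t))

variable {T} {P : S' → S} {n : ℕ}

/-- Triangles are contractible, so the covering is trivial over each. Matching the sheets at one
point of a side gives the transition permutation, and uniqueness of lifts propagates it along the
side. -/
theorem _root_.IsCoveringMap.exists_sheetSystem (hP : IsCoveringMap P)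
    (hn : ∀ x, (P ⁻¹' {x}).encard = n) :
    ∃ g : T.gluing.Face × Fin 3 → Perm (Fin n), IsCocycle T.gluing.alpha g ∧
      Nonempty (T.SheetSystem P g) := by
  classical
  have : ContractibleSpace (stdSimplex ℝ (Fin 3)) :=
    (convex_stdSimplex ℝ (Fin 3)).contractibleSpace ⟨_, single_mem_stdSimplex ℝ 0⟩
  set q : C(T.gluing.Pieces, S) := ⟨fun x => T.homeo (TriangleGluing.proj x),
    T.homeo.continuous.comp TriangleGluing.isQuotientMap_proj.continuous⟩ with hq
  choose L hL1 hL2 hL3 using fun f : T.gluing.Face =>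
    hP.exists_lifts hn (q.comp (ContinuousMap.sigmaMk f))
  set M : Fin n → C(T.gluing.Pieces, S') := fun s => ContinuousMap.sigma fun f => L f s with hM
  have hM1 : ∀ s x, P (M s x) = q x := fun s x => hL1 x.1 s x.2
  have hM2 : ∀ x s s', M s x = M s' x → s = s' := fun x => hL2 x.1 x.2
  have hM3 : ∀ x y, P y = q x → ∃ s, M s x = y := fun x => hL3 x.1 x.2
  have hqs : ∀ d t, d ∉ T.gluing.free → q (T.gluing.side d t) =
      q (T.gluing.side (T.gluing.glue d) (unitInterval.symm t)) := fun d t hd =>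
    congr_arg T.homeo (TriangleGluing.proj_side d t hd)
  have htr : ∀ d s, ∃ s', d ∉ T.gluing.free → M s' (T.gluing.side (T.gluing.glue d) 1) =
      M s (T.gluing.side d 0) := fun d s => by
    by_cases hd : d ∈ T.gluing.free
    · exact ⟨s, fun h => absurd hd h⟩
    · obtain ⟨s', hs'⟩ := hM3 (T.gluing.side (T.gluing.glue d) 1) (M s (T.gluing.side d 0))
        (by rw [hM1, hqs d 0 hd, unitInterval.symm_zero])
      exact ⟨s', fun _ => hs'⟩
  choose τ hτ using htr
  have hinj : ∀ d, d ∉ T.gluing.free → Injective (τ d) := fun d hd s s' h =>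
    hM2 _ s s' (by rw [← hτ d s hd, ← hτ d s' hd, h])
  -- The default `1` on free sides is the value that a cocycle must have at fixed points.
  set g : T.gluing.Face × Fin 3 → Perm (Fin n) := fun d =>
    if hd : d ∉ T.gluing.free then
      Equiv.ofBijective _ (Finite.injective_iff_bijective.1 (hinj d hd)) else 1 with hg
  have hgτ : ∀ d s, d ∉ T.gluing.free → g d s = τ d s := fun d s hd => by
    simp only [hg, dif_pos hd, Equiv.ofBijective_apply]
  have hside : ∀ d t s, d ∉ T.gluing.free → M s (T.gluing.side d t) =
      M (g d s) (T.gluing.side (T.gluing.glue d) (unitInterval.symm t)) := by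
    intro d t s hd
    refine congr_fun (hP.eq_of_comp_eq (g₁ := fun t => M s (T.gluing.side d t))
      (g₂ := fun t => M (g d s) (T.gluing.side (T.gluing.glue d) (unitInterval.symm t)))
      ((M s).continuous.comp (TriangleGluing.continuous_side d))
      ((M _).continuous.comp ((TriangleGluing.continuous_side _).comp unitInterval.continuous_symm))
      (funext fun t => ?_) 0 ?_) t
    · simp only [comp_apply, hM1]
      exact hqs d t hd
    · simp only [unitInterval.symm_zero]
      rw [hgτ d s hd, hτ d s hd]
  refine ⟨g, ⟨fun d => ?_, fun d hd => dif_neg (not_not_intro hd)⟩, ⟨M, hM1, hM2, hM3, hside⟩⟩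
  by_cases hd : d ∈ T.gluing.free
  · rw [TriangleGluing.alpha_apply, TriangleGluing.mem_free.1 hd]
    simp only [hg, dif_neg (not_not_intro hd), mul_one]
  · ext s
    refine congr_arg Fin.val (hM2 (T.gluing.side d 0) _ _ ?_)
    have h1 := hside (T.gluing.glue d) (unitInterval.symm 0) (g d s)
      (TriangleGluing.glue_notMem_free hd)
    rw [T.gluing.glue_glue, unitInterval.symm_symm] at h1
    exact h1.symm.trans (hside d 0 s hd).symm

/-- The covering glued from copies of the triangles. -/
theorem exists_covering {S : Type u} [TopologicalSpace S] {T : OrientedTriangulation S}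
    {g : T.gluing.Face × Fin 3 → Perm (Fin n)} (hg : IsCocycle T.gluing.alpha g)
    (h : ∀ d, (∀ i, T.gluing.rho^[i] d ∉ T.gluing.free) → hol T.gluing.rho g d = 1) :
    ∃ (S' : Type u) (_ : TopologicalSpace S') (P : S' → S), IsCoveringMap P ∧
      (∀ x, (P ⁻¹' {x}).encard = n) ∧ Nonempty (T.SheetSystem P g) := by
  have hex : ∀ (x : T.gluing.Pieces) (y : ULift.{u} (TriangleGluing.CoverSpace g)),
      T.homeo (TriangleGluing.coverMap g y.down) = T.homeo (TriangleGluing.proj x) →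
      ∃ s, ULift.up (TriangleGluing.coverProj g (x, s)) = y := fun x y hy => by
    obtain ⟨s, hs⟩ := TriangleGluing.exists_coverProj_eq x y.down (T.homeo.injective hy)
    exact ⟨s, by rw [hs]⟩
  -- The glued space lives in `Type` and is lifted to the universe of `S`.
  refine ⟨ULift (TriangleGluing.CoverSpace g), inferInstance,
    fun y => T.homeo (TriangleGluing.coverMap g y.down), ?_, fun x => ?_, ⟨⟨fun s =>
      ⟨fun x => ULift.up (TriangleGluing.coverProj g (x, s)), ?_⟩, fun s x => rfl,
      fun x s s' hs => ?_, hex, fun d t s hd => ?_⟩⟩⟩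
  · exact ((TriangleGluing.isCoveringMap_coverMap hg h).homeomorph_comp T.homeo).comp_homeomorph
      Homeomorph.ulift
  · obtain ⟨x, rfl⟩ := T.homeo.surjective x
    obtain ⟨x, rfl⟩ := TriangleGluing.isQuotientMap_proj.surjective x
    have : (fun y : ULift.{u} (TriangleGluing.CoverSpace g) =>
        T.homeo (TriangleGluing.coverMap g y.down)) ⁻¹' {T.homeo (TriangleGluing.proj x)} =
        (fun s => ULift.up (TriangleGluing.coverProj g (x, s))) '' _root_.Set.univ := by
      ext y
      constructor
      · intro hy
        obtain ⟨s, hs⟩ := hex x y hy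
        exact ⟨s, trivial, hs⟩
      · rintro ⟨s, -, rfl⟩
        rfl
    rw [this, Injective.encard_image]
    · simp
    · intro s s' hs
      exact TriangleGluing.coverProj_inj hg h (congr_arg ULift.down hs)
  · exact continuous_uliftUp.comp (TriangleGluing.isQuotientMap_coverProj.continuous.comp
      (Continuous.prodMk_left s))
  · exact TriangleGluing.coverProj_inj hg h (congr_arg ULift.down hs)
  · exact congr_arg ULift.up (TriangleGluing.coverProj_side hd t s)

namespace SheetSystem

variable {g : T.gluing.Face × Fin 3 → Perm (Fin n)} (L : T.SheetSystem P g)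

/-- Each step of `ρ` away from a free side crosses one side at the same vertex and changes the
number of the sheet by `g`. -/
theorem lift_corner {d : T.gluing.Face × Fin 3} {i : ℕ}
    (h : ∀ j < i, T.gluing.rho^[j] d ∉ T.gluing.free) (s : Fin n) :
    L.lift s (T.gluing.side d 0) =
      L.lift (walk T.gluing.rho g d i s) (T.gluing.side (T.gluing.rho^[i] d) 0) := by
  induction i with
  | zero => rfl
  | succ i ih =>
    rw [ih fun j hj => h j (by omega), L.lift_side _ _ _ (h i (by omega)), unitInterval.symm_zero,
      TriangleGluing.side_one, iterate_succ_apply', walk_succ]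
    rfl

/-- A full turn around an interior vertex leads back to the same side, so one point of the covering
carries both numbers. -/
theorem hol_eq_one (L : T.SheetSystem P g) {d : T.gluing.Face × Fin 3} (h : ∀ i, T.gluing.rho^[i] d ∉ T.gluing.free) :
    hol T.gluing.rho g d = 1 := by
  ext s
  refine congr_arg Fin.val (L.lift_inj (T.gluing.side d 0) _ _ ?_)
  have h1 := L.lift_corner (i := minimalPeriod T.gluing.rho d) (fun j _ => h j) s
  rw [iterate_minimalPeriod] at h1
  exact h1.symm

theorem lift_side_mem (d : T.gluing.free) (s : Fin n) (t : unitInterval) :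
    L.lift s (T.gluing.side d t) ∈ P ⁻¹' T.boundary := by
  rw [Set.mem_preimage, L.proj]
  exact (T.boundaryComplex.arc d t).2

/-- The lifts of the boundary arcs. -/
noncomputable def arcLifts (hg : IsCocycle T.gluing.alpha g) :
    ArcLifts T.boundaryComplex (T.boundary.restrictPreimage P) n where
  lift d s := ⟨fun t => ⟨L.lift s (T.gluing.side d t), L.lift_side_mem d s t⟩,
    ((L.lift s).continuous.comp (TriangleGluing.continuous_side d.1)).subtype_mk
      (L.lift_side_mem d s)⟩
  proj d s t := Subtype.ext (L.proj s _)
  lift_inj d t s s' h := L.lift_inj _ s s' (congr_arg Subtype.val h)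
  exists_lift d t y h := by
    obtain ⟨s, hs⟩ := L.exists_lift (T.gluing.side d t) y (congr_arg Subtype.val h)
    exact ⟨s, Subtype.ext hs⟩
  -- The walk also counts the free side `d` itself, which contributes `1`; in this form it is the
  -- transition function of `hol_firstReturn`.
  trans d := walk T.gluing.rho g d (T.gluing.rho.hitTime T.gluing.free (T.gluing.rho d) + 1)
  lift_one d s := by
    refine Subtype.ext ?_
    change L.lift s (T.gluing.side d 1) = L.lift (walk T.gluing.rho g d _ s)
      (T.gluing.side (T.gluing.rho.firstReturn T.gluing.free d) 0)
    rw [TriangleGluing.side_one, ← TriangleGluing.rho_of_mem_free d.2,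
      L.lift_corner (i := T.gluing.rho.hitTime T.gluing.free (T.gluing.rho d))
        (fun _ hj => iterate_notMem_of_lt_hitTime hj), walk_succ', hg.2 d d.2, mul_one]
    rfl

theorem holClass_arcLifts (hg : IsCocycle T.gluing.alpha g) (d : T.gluing.free) :
    holClass T.boundaryComplex.next (L.arcLifts hg).trans d = holClass T.gluing.rho g d :=
  congr_arg ConjClasses.mk (hol_firstReturn g d)

end SheetSystem

end OrientedTriangulation

end

/-! ### Counting vertices, edges and boundary components: the genus. -/

section

open Equiv Equiv.Perm Function Topology

namespace Equiv.Perm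

variable {D : Type*} [Finite D]

theorem exists_iterate_mem_iff {ρ : Perm D} {S : Set D} {d : D} :
    (∃ i, ρ^[i] d ∈ S) ↔ ∃ d' ∈ S, ρ.cyc d' = ρ.cyc d := by
  constructor
  · rintro ⟨i, h⟩
    exact ⟨_, h, cyc_eq_cyc.2 (sameCycle_iterate _ _ _).symm⟩
  · rintro ⟨d', hd', h⟩
    exact exists_iterate_mem_of_sameCycle (cyc_eq_cyc.1 h).symm hd'

/-- The cycles of the first return map to `S` are the cycles that meet `S`. -/
noncomputable def firstReturnCyclesEquiv (ρ : Perm D) (S : Set D) :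
    (ρ.firstReturn S).Cycles ≃ {o : ρ.Cycles // ∃ d ∈ S, ρ.cyc d = o} :=
  Equiv.ofBijective (Quotient.lift (fun d => ⟨ρ.cyc d, d, d.2, rfl⟩)
      fun _ _ h => Subtype.ext (cyc_eq_cyc.2 (firstReturn_sameCycle_iff.1 h))) <| by
    constructor
    · rintro ⟨d⟩ ⟨d'⟩ h
      exact cyc_eq_cyc.2 (firstReturn_sameCycle_iff.2 (cyc_eq_cyc.1 (congr_arg Subtype.val h)))
    · rintro ⟨_, d, hd, rfl⟩
      exact ⟨(ρ.firstReturn S).cyc ⟨d, hd⟩, rfl⟩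

theorem sameCycle_iff_of_involutive {α : Perm D} (hα : ∀ d, α (α d) = d) {d d' : D} :
    α.SameCycle d d' ↔ d' = d ∨ d' = α d := by
  constructor
  · intro h
    obtain ⟨i, -, rfl⟩ := sameCycle_iff_iterate.1 h
    induction i with
    | zero => exact Or.inl rfl
    | succ i ih =>
      rw [iterate_succ_apply']
      rcases ih (sameCycle_iterate _ _ _) with h | h <;> rw [h]
      · exact Or.inr rfl
      · exact Or.inl (hα d)
  · rintro (rfl | rfl)
    · exact SameCycle.refl _ _
    · exact sameCycle_iterate α d 1

/-- Each cycle is counted by a representative and by the partner of that representative. A fixed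
point is its own partner and is sent the second time to the extra copy of the fixed points. -/
theorem two_mul_numCycles_of_involutive {α : Perm D} (hα : ∀ d, α (α d) = d) :
    2 * α.numCycles = Nat.card D + Nat.card {d | α d = d} := by
  classical
  have hout : ∀ o : α.Cycles, α.cyc o.out = o := fun o => Quotient.out_eq o
  have hout' : ∀ d, (α.cyc d).out = d ∨ (α.cyc d).out = α d := fun d =>
    (sameCycle_iff_of_involutive hα).1 (cyc_eq_cyc.1 (hout _)).symm
  have hbij : Bijective fun x : α.Cycles ⊕ α.Cycles =>
      (match x with
        | .inl o => .inl o.out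
        | .inr o => if h : α o.out = o.out then .inr ⟨o.out, h⟩ else .inl (α o.out) :
          D ⊕ {d | α d = d}) := by
    constructor
    · rintro (o | o) (o' | o') h
      · have := congr_arg α.cyc (Sum.inl_injective h)
        rw [hout, hout] at this
        rw [this]
      · simp only at h
        split_ifs at h with h'
        have h1 := Sum.inl_injective h
        have := congr_arg α.cyc h1
        rw [cyc_apply, hout, hout] at this
        rw [this] at h1
        exact absurd h1.symm h'
      · simp only at h
        split_ifs at h with h'
        have h1 := Sum.inl_injective h
        have := congr_arg α.cyc h1
        rw [cyc_apply, hout, hout] at this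
        rw [← this] at h1
        exact absurd h1 h'
      · simp only at h
        have h2 : o.out = o'.out := by
          split_ifs at h
          · exact congr_arg Subtype.val (Sum.inr_injective h)
          · exact α.injective (Sum.inl_injective h)
        have := congr_arg α.cyc h2
        rw [hout, hout] at this
        rw [this]
    · rintro (d | ⟨d, hd⟩)
      · rcases hout' d with h | h
        · exact ⟨.inl (α.cyc d), congr_arg Sum.inl h⟩
        · by_cases hd : α d = d
          · exact ⟨.inl (α.cyc d), congr_arg Sum.inl (h.trans hd)⟩
          · refine ⟨.inr (α.cyc d), ?_⟩
            simp only
            rw [dif_neg (by rw [h, hα]; exact Ne.symm hd), h, hα]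
      · have h : (α.cyc d).out = d := (hout' d).elim id fun h => h.trans hd
        refine ⟨.inr (α.cyc d), ?_⟩
        simp only
        rw [dif_pos (by rw [h]; exact hd)]
        exact congr_arg Sum.inr (Subtype.ext h)
  have := Nat.card_congr (Equiv.ofBijective _ hbij)
  rw [Nat.card_sum, Nat.card_sum] at this
  rw [numCycles, two_mul, this]

end Equiv.Perm

namespace TriangleGluing

variable (G : TriangleGluing)

-- A boundary vertex is the initial point of exactly one free side, and an interior vertex is a
-- cycle of `ρ` without free sides.
open Classical in
theorem numVertices_eq : G.numVertices = Nat.card G.free +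
    Nat.card {o : G.rho.Cycles // ¬ ∃ d ∈ G.free, G.rho.cyc d = o} := by
  set F : G.Face × Fin 3 → G.free ⊕ {o : G.rho.Cycles // ¬ ∃ d ∈ G.free, G.rho.cyc d = o} :=
    fun d => if h : ∃ i, G.rho^[i] d ∈ G.free then
      .inl ⟨G.rho.firstHit G.free d, iterate_hitTime_mem h⟩ else
      .inr ⟨G.rho.cyc d, fun h' => h (exists_iterate_mem_iff.2 h')⟩ with hF
  have hF1 : ∀ d (h : ∃ i, G.rho^[i] d ∈ G.free),
      F d = .inl ⟨G.rho.firstHit G.free d, iterate_hitTime_mem h⟩ := fun d h => dif_pos h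
  have hF2 : ∀ d (h : ¬ ∃ i, G.rho^[i] d ∈ G.free),
      F d = .inr ⟨G.rho.cyc d, fun h' => h (exists_iterate_mem_iff.2 h')⟩ := fun d h => dif_neg h
  have hwd : ∀ d d', G.CornerGlued d d' → F d = F d' := by
    intro d d' h
    obtain ⟨hd, rfl⟩ := cornerGlued_iff.1 h
    by_cases hex : ∃ i, G.rho^[i] d ∈ G.free
    · rw [hF1 d hex, hF1 _ (exists_iterate_rho_mem_iff.2 hex)]
      exact congr_arg Sum.inl (Subtype.ext (firstHit_apply hex hd).symm)
    · rw [hF2 d hex, hF2 _ (fun h => hex (exists_iterate_rho_mem_iff.1 h))]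
      exact congr_arg Sum.inr (Subtype.ext (cyc_apply _ _).symm)
  have hbij : Bijective (Quot.lift F hwd) := by
    constructor
    · rintro ⟨d⟩ ⟨d'⟩ h
      change F d = F d' at h
      by_cases hex : ∃ i, G.rho^[i] d ∈ G.free <;> by_cases hex' : ∃ i, G.rho^[i] d' ∈ G.free
      · rw [hF1 d hex, hF1 d' hex'] at h
        have := congr_arg Subtype.val (Sum.inl_injective h)
        change G.rho.firstHit G.free d = G.rho.firstHit G.free d' at this
        rw [← corner_firstHit d, this, corner_firstHit d']
      · rw [hF1 d hex, hF2 d' hex'] at h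
        cases h
      · rw [hF2 d hex, hF1 d' hex'] at h
        cases h
      · rw [hF2 d hex, hF2 d' hex'] at h
        have := congr_arg Subtype.val (Sum.inr_injective h)
        obtain ⟨i, -, rfl⟩ := sameCycle_iff_iterate.1 (cyc_eq_cyc.1 this)
        exact (corner_iterate fun j _ hj => hex ⟨j, hj⟩).symm
    · rintro (⟨d, hd⟩ | ⟨o, ho⟩)
      · refine ⟨Quot.mk _ d, (hF1 d ⟨0, hd⟩).trans ?_⟩
        exact congr_arg Sum.inl (Subtype.ext (firstHit_of_mem hd))
      · obtain ⟨d, rfl⟩ := G.rho.cyc_surjective o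
        exact ⟨Quot.mk _ d, hF2 d fun h => ho (exists_iterate_mem_iff.1 h)⟩
  rw [numVertices, Nat.card_congr (Equiv.ofBijective _ hbij), Nat.card_sum]

theorem numEdges_eq : G.numEdges = G.alpha.numCycles := by
  refine Nat.card_congr ⟨Quot.lift G.alpha.cyc ?_, Quotient.lift (Quot.mk _) fun d d' h => ?_, ?_, ?_⟩
  · rintro d _ rfl
    exact (cyc_apply _ _).symm
  · exact SameCycle.of_forall_eq (F := Quot.mk fun d d' => d' = G.glue d)
      (fun d => (Quot.sound (r := fun d d' => d' = G.glue d) (a := d) rfl).symm) h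
  · rintro ⟨d⟩
    rfl
  · rintro ⟨d⟩
    rfl

theorem numCycles_phi : G.phi.numCycles = Nat.card G.Face := by
  have hfst : ∀ d, (G.phi d).1 = d.1 := fun d => rfl
  refine Nat.card_congr (Equiv.ofBijective (Quotient.lift Prod.fst fun d d' h =>
    SameCycle.of_forall_eq hfst h) ⟨?_, fun f => ⟨G.phi.cyc (f, 0), rfl⟩⟩)
  rintro ⟨f, i⟩ ⟨f', j⟩ h
  obtain rfl : f = f' := h
  refine cyc_eq_cyc.2 ?_
  rcases Fin.eq_add_three_cases i j with rfl | rfl | rfl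
  · exact SameCycle.refl _ _
  · exact sameCycle_iterate G.phi (f, i) 1
  · rw [← Fin.add_one_add_one]
    exact sameCycle_iterate G.phi (f, i) 2

end TriangleGluing

namespace OrientedTriangulation

variable {S : Type*} [TopologicalSpace S] (T : OrientedTriangulation S)

/-- The boundary components correspond to the cycles that contain a free side. -/
noncomputable def boundaryCyclesEquiv : {o : T.gluing.rho.Cycles // ∃ d ∈ T.gluing.free,
    T.gluing.rho.cyc d = o} ≃ ConnectedComponents T.boundary :=
  have := T.t2Space
  (T.gluing.rho.firstReturnCyclesEquiv T.gluing.free).symm.trans T.boundaryComplex.cyclesEquiv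

theorem boundaryCyclesEquiv_apply (d : T.gluing.free) :
    T.boundaryCyclesEquiv ⟨T.gluing.rho.cyc d, d, d.2, rfl⟩ = T.boundaryComplex.arc d 0 := by
  have h : (⟨T.gluing.rho.cyc d, d, d.2, rfl⟩ : {o : T.gluing.rho.Cycles // ∃ d ∈ T.gluing.free,
      T.gluing.rho.cyc d = o}) = T.gluing.rho.firstReturnCyclesEquiv T.gluing.free
        ((T.gluing.rho.firstReturn T.gluing.free).cyc d) := rfl
  have := T.t2Space
  rw [h]
  exact congr_arg T.boundaryComplex.cyclesEquiv (Equiv.symm_apply_apply _ _)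

/-- Write `D` for the set of sides, `b` for the number of free sides and `V₀` for the number of
interior vertices. Then `V = V₀ + b` and `2 E = |D| + b`, and `ρ` has `V₀ + k` cycles. Hence the
cycles of `φ`, `α` and `ρ` together, minus `|D|`, number `χ + k`. -/
theorem genus_eq : T.genus = twiceGenus T.gluing.phi T.gluing.alpha T.gluing.rho / 2 := by
  classical
  have h1 := two_mul_numCycles_of_involutive (α := T.gluing.alpha) T.gluing.glue_glue
  have h2 := Nat.card_congr T.boundaryCyclesEquiv
  have h3 := Nat.card_congr (Equiv.sumCompl fun o : T.gluing.rho.Cycles =>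
    ∃ d ∈ T.gluing.free, T.gluing.rho.cyc d = o)
  have h4 : Nat.card (T.gluing.Face × Fin 3) = Nat.card T.gluing.Face * 3 := by
    rw [Nat.card_prod, Nat.card_eq_fintype_card (α := Fin 3), Fintype.card_fin]
  have h5 : Nat.card {d | T.gluing.alpha d = d} = Nat.card T.gluing.free := rfl
  rw [Nat.card_sum] at h3
  rw [genus, twiceGenus, TriangleGluing.eulerChar, TriangleGluing.numVertices_eq,
    TriangleGluing.numEdges_eq, TriangleGluing.numCycles_phi]
  congr 1
  rw [h5, h4] at h1
  rw [h4]
  simp only [numCycles] at h1 ⊢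
  push_cast
  omega

end OrientedTriangulation

end

/-! ### From coverings to cocycles, and the conclusion. -/

section

open Equiv Equiv.Perm Function Topology
open scoped Pointwise

theorem prod_eq_one_iff_sum_eq_zero {ι : Type*} [Fintype ι] (f : ι → ℤˣ) :
    ∏ i, f i = 1 ↔ ∑ i, (if f i = 1 then 0 else 1 : ZMod 2) = 0 := by
  classical
  have hmul : ∀ a b : ℤˣ, (if a * b = 1 then 0 else 1 : ZMod 2) =
      (if a = 1 then 0 else 1) + if b = 1 then 0 else 1 := by decide
  have key : ∀ s : Finset ι, (if ∏ i ∈ s, f i = 1 then 0 else 1 : ZMod 2) =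
      ∑ i ∈ s, (if f i = 1 then 0 else 1 : ZMod 2) := by
    intro s
    induction s using Finset.induction_on with
    | empty => simp
    | insert i s hi ih => rw [Finset.prod_insert hi, Finset.sum_insert hi, hmul, ih]
  rw [← key]
  split_ifs with h <;> simp [h]

theorem parity_eq {n : ℕ} (c : ConjClasses (Perm (Fin n))) :
    parity c = if classSign c = 1 then 0 else 1 := by
  obtain ⟨σ, rfl⟩ := ConjClasses.exists_rep c
  rfl

/-- The inclusion of the centre is a monoid homomorphism, so the unordered product becomes the
product of the classes in the order of the list; the order of the boundary components is therefore
immaterial. -/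
theorem hasTrivialProduct_fin_iff {H : Type*} [Group H] {k : ℕ} (Γ : Fin k → ConjClasses H) :
    HasTrivialProduct Γ ↔
      ∃ σ : Fin k → H, (∀ i, σ i ∈ (Γ i).carrier) ∧ (List.ofFn σ).prod = 1 := by
  have : (∏ i, centralCarrier (Γ i)).1 = (List.ofFn fun i => (Γ i).carrier).prod := by
    rw [← List.prod_ofFn]
    change (Submonoid.center (Set H)).subtype _ = _
    rw [map_list_prod, List.map_ofFn]
    rfl
  rw [HasTrivialProduct, this, Set.mem_prod_list_ofFn]
  constructor
  · rintro ⟨f, hf⟩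
    exact ⟨fun i => f i, fun i => (f i).2, hf⟩
  · rintro ⟨σ, h1, h2⟩
    exact ⟨fun i => ⟨σ i, h1 i⟩, h2⟩

/-- Lifts of arcs transported along an isomorphism of spaces over the base. -/
noncomputable def ArcLifts.ofHomeomorph {A F C C' : Type*} [TopologicalSpace A] [TopologicalSpace C]
    [TopologicalSpace C'] {K : CircleComplex A F} {p : C → A} {p' : C' → A} {n : ℕ}
    (L : ArcLifts K p n) (e : C ≃ₜ C') (he : ∀ y, p' (e y) = p y) : ArcLifts K p' n where
  lift d s := ⟨fun t => e (L.lift d s t), e.continuous.comp (L.lift d s).continuous⟩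
  proj d s t := (he _).trans (L.proj d s t)
  lift_inj d t s s' hs := L.lift_inj d t s s' (e.injective hs)
  exists_lift d t y hy := by
    obtain ⟨s, hs⟩ := L.exists_lift d t (e.symm y) (by rw [← he, e.apply_symm_apply, hy])
    exact ⟨s, (congr_arg e hs).trans (e.apply_symm_apply y)⟩
  trans := L.trans
  lift_one d s := congr_arg e (L.lift_one d s)

namespace TriangleGluing

/-- Such a set consists of all sides of certain triangles and is stable under gluing, so these
triangles form a nonempty clopen part of the surface. -/
theorem eq_univ_of_closed {G : TriangleGluing} [ConnectedSpace G.Realization]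
    (s : Set (G.Face × Fin 3)) (hφ : ∀ d ∈ s, G.phi d ∈ s) (hα : ∀ d ∈ s, G.alpha d ∈ s)
    (hs : s.Nonempty) : s = _root_.Set.univ := by
  have hiter : ∀ i d, d ∈ s → G.phi^[i] d ∈ s := fun i d hd => by
    induction i with
    | zero => exact hd
    | succ i ih => rw [iterate_succ_apply']; exact hφ _ ih
  have hface : ∀ f i j, (f, i) ∈ s → (f, j) ∈ s := by
    intro f i j h
    rcases Fin.eq_add_three_cases i j with rfl | rfl | rfl
    · exact h
    · exact hiter 1 _ h
    · rw [← Fin.add_one_add_one]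
      exact hiter 2 _ h
  have hglue : ∀ d, d ∈ s ↔ G.glue d ∈ s := fun d =>
    ⟨hα d, fun h => by simpa [alpha_apply, G.glue_glue] using hα _ h⟩
  have hwd : ∀ x y, G.Glued x y → ((x.1, 0) ∈ s) = ((y.1, 0) ∈ s) := by
    rintro _ _ ⟨d, t, -⟩
    exact propext ⟨fun h => hface _ _ _ ((hglue d).1 (hface _ _ _ h)),
      fun h => hface _ _ _ ((hglue d).2 (hface _ _ _ h))⟩
  set U : Set G.Realization := {y | Quot.lift (fun x : G.Pieces => (x.1, 0) ∈ s) hwd y} with hU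
  have hpre : (proj ⁻¹' U : Set G.Pieces) = {x | (x.1, 0) ∈ s} := rfl
  have hclopen : IsClopen U := by
    rw [← isQuotientMap_proj.isClopen_preimage, hpre]
    have hopen : ∀ s' : Set G.Face, IsOpen {x : G.Pieces | x.1 ∈ s'} := fun s' =>
      isOpen_sigma_iff.2 fun f => by
        by_cases hf : f ∈ s'
        · convert isOpen_univ
          ext x
          simp [hf]
        · convert isOpen_empty
          ext x
          simp [hf]
    exact ⟨⟨hopen {f | (f, 0) ∈ s}ᶜ⟩, hopen {f | (f, 0) ∈ s}⟩
  obtain ⟨⟨f, i⟩, hd⟩ := hs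
  rcases isClopen_iff.1 hclopen with h | h
  · have : proj ⟨f, sidePoint 0 0⟩ ∈ U := hface f i 0 hd
    rw [h] at this
    exact absurd this (Set.notMem_empty _)
  · refine Set.eq_univ_of_forall fun ⟨f', j⟩ => ?_
    have : proj ⟨f', sidePoint 0 0⟩ ∈ U := h ▸ Set.mem_univ _
    exact hface f' 0 j this

end TriangleGluing

namespace OrientedTriangulation

variable {S : Type u} [TopologicalSpace S] (T : OrientedTriangulation S) {n k : ℕ}

open Classical in
/-- The classes prescribed on the boundary components as classes for all vertex cycles, trivial
at the interior vertices. -/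
noncomputable def vertexClass {H : Type*} [Group H] (c : Fin k ≃ ConnectedComponents T.boundary)
    (Γ : Fin k → ConjClasses H) (o : T.gluing.rho.Cycles) : ConjClasses H :=
  if h : ∃ d ∈ T.gluing.free, T.gluing.rho.cyc d = o then
    Γ (c.symm (T.boundaryCyclesEquiv ⟨o, h⟩)) else ConjClasses.mk 1

section VertexClass

variable {H : Type*} [Group H] (c : Fin k ≃ ConnectedComponents T.boundary)
    (Γ : Fin k → ConjClasses H)

theorem vertexClass_of_mem_free (d : T.gluing.free) :
    T.vertexClass c Γ (T.gluing.rho.cyc d) = Γ (c.symm (T.boundaryComplex.arc d 0)) := by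
  rw [vertexClass, dif_pos ⟨d, d.2, rfl⟩, boundaryCyclesEquiv_apply]

theorem vertexClass_of_forall_notMem {d : T.gluing.Face × Fin 3}
    (h : ∀ i, T.gluing.rho^[i] d ∉ T.gluing.free) :
    T.vertexClass c Γ (T.gluing.rho.cyc d) = ConjClasses.mk 1 :=
  dif_neg fun h' => not_exists.2 h (exists_iterate_mem_iff.2 h')

theorem prod_vertexClass [Fintype T.gluing.rho.Cycles] {M : Type*} [CommMonoid M]
    (F : ConjClasses H → M) (hF : F (ConjClasses.mk 1) = 1) :
    ∏ o, F (T.vertexClass c Γ o) = ∏ i, F (Γ i) := by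
  classical
  rw [← Fintype.prod_subtype_mul_prod_subtype
    (fun o => ∃ d ∈ T.gluing.free, T.gluing.rho.cyc d = o)]
  rw [Finset.prod_eq_one (s := Finset.univ (α := {o // ¬ ∃ d ∈ T.gluing.free, T.gluing.rho.cyc d = o}))
    (fun o _ => by rw [vertexClass, dif_neg o.2, hF]), mul_one]
  refine Fintype.prod_equiv (T.boundaryCyclesEquiv.trans c.symm) _ _ fun o => ?_
  rw [vertexClass, dif_pos o.2]
  rfl

theorem hasTrivialProduct_vertexClass [Fintype T.gluing.rho.Cycles] :
    HasTrivialProduct (T.vertexClass c Γ) ↔ HasTrivialProduct Γ := by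
  rw [HasTrivialProduct, HasTrivialProduct, T.prod_vertexClass c Γ centralCarrier centralCarrier_one]

end VertexClass

variable {T}

/-- A covering of `S` gives a cocycle through a numbering of its sheets: its holonomy is trivial at
interior vertices and gives the monodromy along the boundary. Conversely the covering glued from a
cocycle has the prescribed classes over the boundary, and coverings of circles with equal classes
are isomorphic. -/
theorem extendsToCovering_iff {C : Type v} [TopologicalSpace C] {p : C → T.boundary}
    (hp : IsCoveringMap p) (hn : ∀ x, (p ⁻¹' {x}).encard = n)
    (c : Fin k ≃ ConnectedComponents T.boundary) {Γ : Fin k → ConjClasses (Perm (Fin n))}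
    (hΓ : ∀ i, IsMonodromyClass hp (c i) (Γ i)) :
    ExtendsToCovering n T.boundary p ↔
      Realizable T.gluing.alpha T.gluing.rho (T.vertexClass c Γ) := by
  have := T.t2Space
  have := hp.t2Space
  have hclass : ∀ (L : ArcLifts T.boundaryComplex p n) (d : T.gluing.free),
      T.vertexClass c Γ (T.gluing.rho.cyc d) = holClass T.boundaryComplex.next L.trans d := by
    intro L d
    rw [vertexClass_of_mem_free]
    exact L.eq_holClass hp (c.apply_symm_apply _).symm (hΓ _)
  constructor
  · rintro ⟨S', _, P, hP, hPn, h, hh⟩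
    obtain ⟨g, hg, ⟨L⟩⟩ := hP.exists_sheetSystem (T := T) hPn
    have hsymm : ∀ y, p (h.symm y) = T.boundary.restrictPreimage P y := fun y =>
      Subtype.ext ((hh _).symm.trans (by rw [h.apply_symm_apply]; rfl))
    set K := L.arcLifts hg with hK
    set K' := K.ofHomeomorph h.symm hsymm
    refine ⟨g, hg, fun d => ?_⟩
    by_cases hd : ∃ i, T.gluing.rho^[i] d ∈ T.gluing.free
    · obtain ⟨i, hi⟩ := hd
      have hs := sameCycle_iterate T.gluing.rho d i
      rw [holClass_eq_of_sameCycle hs, cyc_eq_cyc.2 hs, hclass K' ⟨_, hi⟩]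
      exact (L.holClass_arcLifts hg ⟨_, hi⟩).symm
    · push Not at hd
      rw [vertexClass_of_forall_notMem _ _ _ hd, holClass, L.hol_eq_one hd]
  · rintro ⟨g, hg, hgΓ⟩
    obtain ⟨S', _, P, hP, hPn, ⟨L⟩⟩ := exists_covering hg fun d hd => by
      have := hgΓ d
      rwa [vertexClass_of_forall_notMem _ _ _ hd, holClass, ConjClasses.mk_eq_mk_iff_isConj,
        isConj_one_left] at this
    obtain ⟨K⟩ := hp.nonempty_arcLifts T.boundaryComplex hn
    have := hP.t2Space
    obtain ⟨h, hh⟩ := K.exists_homeomorph (L.arcLifts hg) fun d => by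
      rw [L.holClass_arcLifts hg, hgΓ, hclass K]
    exact ⟨S', _, P, hP, hPn, h, fun y => congr_arg Subtype.val (hh y)⟩

end OrientedTriangulation

end

theorem mainTheorem6 {S : Type u} [TopologicalSpace S] [ConnectedSpace S]
    (T : OrientedTriangulation S) (n : ℕ)
    {C : Type v} [TopologicalSpace C] (p : C → T.boundary) (hp : IsCoveringMap p)
    (hn : ∀ x, (p ⁻¹' {x}).encard = n)
    (k : ℕ) (c : Fin k ≃ ConnectedComponents T.boundary)
    (Γ : Fin k → ConjClasses (Equiv.Perm (Fin n)))
    (hΓ : ∀ i, IsMonodromyClass hp (c i) (Γ i)) :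
    ExtendsToCovering n T.boundary p ↔
      (T.IsPlanar ∧ ∃ σ : Fin k → Equiv.Perm (Fin n),
        (∀ i, σ i ∈ (Γ i).carrier) ∧ (List.ofFn σ).prod = 1) ∨
      (¬ T.IsPlanar ∧ ∑ i, parity (Γ i) = 0) := by
  classical
  have : ConnectedSpace T.gluing.Realization :=
    T.homeo.symm.surjective.connectedSpace T.homeo.symm.continuous
  have : Nonempty (T.gluing.Face × Fin 3) := by
    obtain ⟨x⟩ := ConnectedSpace.toNonempty (α := T.gluing.Realization)
    obtain ⟨x, -⟩ := TriangleGluing.isQuotientMap_proj.surjective x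
    exact ⟨(x.1, 0)⟩
  have : Fintype T.gluing.rho.Cycles := Fintype.ofFinite _
  rw [OrientedTriangulation.extendsToCovering_iff hp hn c hΓ,
    realizable_iff T.gluing.phi T.gluing.alpha T.gluing.rho T.gluing.glue_glue (fun _ => rfl)
      TriangleGluing.eq_univ_of_closed,
    ← hasTrivialProduct_fin_iff, T.hasTrivialProduct_vertexClass c Γ,
    T.prod_vertexClass c Γ classSign (by rw [classSign_mk, map_one]), prod_eq_one_iff_sum_eq_zero,
    OrientedTriangulation.IsPlanar, T.genus_eq]
  simp only [parity_eq, ne_eq]
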